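/- **Notation.** For $s,t>0$ let $B(s,t)$ be the probability law on $(-1,1)$ with density $\frac{2^{1-s-t}\Gamma(s+t)}{\Gamma(s)\Gamma(t)}(1-x)^{s-1}(1+x)^{t-1}$. For $\alpha_0,\dots,\alpha_{n-1}$ in the closed unit disk put $\rho_k=\sqrt{1-|\alpha_k|^2}$, $\Xi_k=\begin{bmatrix}\bar\alpha_k&\rho_k\\ \rho_k&-\alpha_k\end{bmatrix}$ for $0\le k\le n-2$, $\Xi_{-1}=[1]$ and $\Xi_{n-1}=[\bar\alpha_{n-1}]$. The CMV matrix is the $n\times n$ matrix $\mathcal C(\alpha_0,\dots,\alpha_{n-1})=\mathrm{diag}(\Xi_0,\Xi_2,\dots)\,\mathrm{diag}(\Xi_{-1},\Xi_1,\Xi_3,\dots)$. For $L,M\ge0$ with $L+2M=n$ let $D_{L,M}$ be the set of points $(x_1,\dots,x_L,x_{L+1}\pm iy_{L+1},\dots,x_{L+M}\pm iy_{L+M})$ in $\mathbb D^n$, $\mathbb D=\{|z|<1\}$, with $-1<x_1<\dots<x_L<1$, $-1<x_{L+1}<\dots<x_{L+M}<1$ and $y_{L+1},\dots,y_{L+M}>0$.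 For permutation-invariant $f$, non-negative on $D=\bigcup_{L+2M=n}D_{L,M}$, the measure $f\,|dz_1\wedge\dots\wedge dz_n|$ on $D$ is the one with $\int f\,|dz_1\wedge\dots\wedge dz_n|=\sum_{L+2M=n}2^M\int_{D_{L,M}}f\,dx_1\cdots dx_{L+M}\,dy_{L+1}\cdots dy_{L+M}$. For $\beta>0$ and $a,b>-1$ let $\Lambda_n^{\beta,a,b}$ be the distribution $$\frac1{P_n}\prod_{j,k=1}^n(1-z_j\bar z_k)^{\frac\beta4-\frac12}\prod_{j=1}^n(1-z_j)^{a+\frac12-\frac\beta4}(1+z_j)^{b+\frac12-\frac\beta4}\prod_{j<k}|z_k-z_j|\;|dz_1\wedge\dots\wedge dz_n|$$ of unordered $n$-tuples, where (with empty products equal to $1$) $$P_n=2^{n(a+b+1)+\frac\beta4n(n-1)}\prod_{j=0}^{\lfloor\frac{n-1}2\rfloor}\frac{\Gamma(a+1+\frac\beta2j)\Gamma(b+1+\frac\beta2j)}{\Gamma(a+b+2+\frac\beta2(\lfloor\frac n2\rfloor+j))}\prod_{j=1}^{\lfloor\frac n2\rfloor}\Gamma(\tfrac\beta2j).$$ **Theorem.**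 Eigenvalues are counted with algebraic multiplicity. (1) Let $\beta>0$, $a,b>-1$, and let $\alpha_0,\dots,\alpha_{n-1}$ be independent with $\alpha_k\sim B(\frac{\beta k}4+a+1,\frac{\beta k}4+b+1)$ for even $k$ and $\alpha_k\sim B(\frac{\beta(k-1)}4+a+b+2,\frac{\beta(k+1)}4)$ for odd $k$. Then the eigenvalues of $\mathcal C(\alpha_0,\dots,\alpha_{n-1})$ have the joint law $\Lambda_n^{\beta,a,b}$. (2) Let $n$ be odd, $\beta>0$, $a,b>-1$, and let $\alpha_0,\dots,\alpha_{n-1}$ be independent with $\alpha_k\sim B(\frac{n-1-k}4\beta+a+1,\frac{n-1-k}4\beta+b+1)$ for even $k$ and $\alpha_k\sim B(\frac{n-2-k}4\beta+a+b+2,\frac{n-k}4\beta)$ for odd $k$. Then the eigenvalues of the matrix obtained by removing the first row and column of the real orthogonal $\beta$-ensemble matrix $\mathcal C(\alpha_0,\dots,\alpha_{n-1},-1)$ have the joint law $\Lambda_n^{\beta,a,b}$. (3) Let $\beta>0$, $\sigma\in\{1,-1\}$, and let $\alpha_0,\dots,\alpha_{n-1}$ be independent with $\alpha_k\sim B(\frac{n-k}4\beta,\frac{n-k}4\beta)$.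 Then the eigenvalues of $\mathcal C(\alpha_0,\dots,\alpha_{n-1},\sigma)$ with the first row and column removed have the joint law $\Lambda_n^{\beta,a,b}$ with $a=b=-1+\frac\beta4$. (4) Let $U$ be a Haar distributed random matrix from $\mathbb O(n+1)$, or from $\mathbb{SO}(n+1)$, or a Haar distributed matrix from $\mathbb O(n+1)$ conditioned to lie in $\mathbb O(n+1)\setminus\mathbb{SO}(n+1)$. Then, for every $i$, the eigenvalues of $U$ with the $i$-th row and the $i$-th column removed have the joint law $\Lambda_n^{2,-1/2,-1/2}$. -/

import Mathlib

open MeasureTheory ProbabilityTheory Finset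
open scoped BigOperators ComplexConjugate ENNReal

noncomputable section

namespace TruncatedOrthogonal

/-- The law `B(s,t)` on `(-1,1)`, for `s, t > 0`, with density
`2^(1-s-t) Γ(s+t) / (Γ(s) Γ(t)) * (1-x)^(s-1) (1+x)^(t-1)`. -/
def betaLaw (s t : ℝ) : Measure ℝ :=
  (volume.restrict (Set.Ioo (-1 : ℝ) 1)).withDensity fun x =>
    ENNReal.ofReal
      ((2 : ℝ) ^ (1 - s - t) * Real.Gamma (s + t) / (Real.Gamma s * Real.Gamma t) *
        ((1 - x) ^ (s - 1) * (1 + x) ^ (t - 1)))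

/-- The block-diagonal `n × n` matrix (rows and columns numbered from `0`) with the blocks
`Ξ_k = [[conj α_k, ρ_k], [ρ_k, -α_k]]`, `ρ_k = √(1 - |α_k|²)`, in the rows and columns `k, k+1`,
for all `k ≡ p` modulo `2` with `k + 1 < n`; the block of `k = n - 1` (if `n - 1 ≡ p`) is the
`1 × 1` block `[conj α_{n-1}]`, and for `p = 1` there is a first `1 × 1` block `[1]`. -/
def cmvFactor (p : ℕ) {n : ℕ} (α : Fin n → ℂ) : Matrix (Fin n) (Fin n) ℂ :=
  fun i j =>
    if i = j then
      if i.val % 2 = p then conj (α i)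
      else if i.val = 0 then 1
      else -α ⟨i.val - 1, lt_of_le_of_lt (Nat.sub_le _ _) i.isLt⟩
    else if i.val + 1 = j.val ∧ i.val % 2 = p then ((√(1 - ‖α i‖ ^ 2) : ℝ) : ℂ)
    else if j.val + 1 = i.val ∧ j.val % 2 = p then ((√(1 - ‖α j‖ ^ 2) : ℝ) : ℂ)
    else 0

/-- The CMV matrix `𝒞(α_0, …, α_{n-1}) = ℒ ℳ` with `ℒ = diag(Ξ_0, Ξ_2, …)` and
`ℳ = diag([1], Ξ_1, Ξ_3, …)`. -/
def cmv {n : ℕ} (α : Fin n → ℂ) : Matrix (Fin n) (Fin n) ℂ :=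
  cmvFactor 0 α * cmvFactor 1 α

/-- Removal of the row and the column with index `i`. -/
def minor {R : Type*} {n : ℕ} (i : Fin (n + 1)) (A : Matrix (Fin (n + 1)) (Fin (n + 1)) R) :
    Matrix (Fin n) (Fin n) R :=
  A.submatrix i.succAbove i.succAbove

/-- The unordered `n`-tuple underlying an ordered one. -/
def unordered {n : ℕ} (z : Fin n → ℂ) : Sym ℂ n :=
  ⟨(univ : Finset (Fin n)).val.map z, by simp⟩

/-- The quotient σ-algebra on unordered `n`-tuples: its measurable sets correspond to the
permutation-invariant Borel sets of `ℂⁿ`. -/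
instance instMeasurableSpaceSym (n : ℕ) : MeasurableSpace (Sym ℂ n) :=
  MeasurableSpace.map unordered inferInstance

/-- The eigenvalues of a complex matrix, with algebraic multiplicity. -/
def eigenvalues {n : ℕ} (A : Matrix (Fin n) (Fin n) ℂ) : Sym ℂ n :=
  ⟨A.charpoly.roots, by
    rw [IsAlgClosed.card_roots_eq_natDegree, Matrix.charpoly_natDegree_eq_dim, Fintype.card_fin]⟩

/-- Parameters `(x, u, v)` of `L` real numbers `x_i` and `M` conjugate pairs `u_i ± i v_i`. -/
abbrev Params (L M : ℕ) : Type := (Fin L → ℝ) × (Fin M → ℝ) × (Fin M → ℝ)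

/-- The set `D_{L,M}` in terms of its parameters: all points lie in the open unit disk,
`x_1 < … < x_L`, `u_1 < … < u_M` and `v_i > 0`. -/
def paramSet (L M : ℕ) : Set (Params L M) :=
  {p | (∀ i, -1 < p.1 i ∧ p.1 i < 1) ∧ StrictMono p.1 ∧ StrictMono p.2.1 ∧
    (∀ i, 0 < p.2.2 i) ∧ ∀ i, p.2.1 i ^ 2 + p.2.2 i ^ 2 < 1}

/-- The point `(x_1, …, x_L, u_1 + i v_1, u_1 - i v_1, …, u_M + i v_M, u_M - i v_M)` of `ℂⁿ`,
where `L = n - 2 M` (used for `2 M ≤ n`). -/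
def config (n M : ℕ) (p : Params (n - 2 * M) M) : Fin n → ℂ := fun j =>
  if h : j.val < n - 2 * M then ((p.1 ⟨j.val, h⟩ : ℝ) : ℂ)
  else
    let i : Fin M := ⟨(j.val - (n - 2 * M)) / 2, by have := j.isLt; omega⟩
    if (j.val - (n - 2 * M)) % 2 = 0 then (⟨p.2.1 i, p.2.2 i⟩ : ℂ)
    else (⟨p.2.1 i, -p.2.2 i⟩ : ℂ)

/-- The measure `|dz_1 ∧ … ∧ dz_n|` on `D = ⋃_{L + 2M = n} D_{L,M}`: the integral of `f` is
`∑_{L + 2M = n} 2^M ∫_{D_{L,M}} f(x_1, …, x_L, u_1 ± i v_1, …, u_M ± i v_M) dx du dv`. -/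
def wedgeMeasure (n : ℕ) : Measure (Fin n → ℂ) :=
  ∑ M ∈ range (n / 2 + 1),
    ((2 : ℝ≥0∞) ^ M) • ((volume.restrict (paramSet (n - 2 * M) M)).map (config n M))

/-- The normalization constant `P_n`. The first product has the range
`0 ≤ j ≤ ⌊(n-1)/2⌋ = ⌊(n+1)/2⌋ - 1`. -/
def normConst (n : ℕ) (β a b : ℝ) : ℝ :=
  (2 : ℝ) ^ ((n : ℝ) * (a + b + 1) + β / 4 * n * ((n : ℝ) - 1)) *
    (∏ j ∈ range ((n + 1) / 2),
      Real.Gamma (a + 1 + β / 2 * j) * Real.Gamma (b + 1 + β / 2 * j) /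
        Real.Gamma (a + b + 2 + β / 2 * (((n / 2 : ℕ) : ℝ) + j))) *
    ∏ j ∈ Icc 1 (n / 2), Real.Gamma (β / 2 * j)

/-- The joint density. On `D` the tuple is closed under complex conjugation and lies in the open
unit disk, so that the three complex products whose real powers are taken are positive real
numbers. -/
def density (n : ℕ) (β a b : ℝ) (z : Fin n → ℂ) : ℝ :=
  1 / normConst n β a b *
    (∏ j, ∏ k, (1 - z j * conj (z k))).re ^ (β / 4 - 1 / 2) *
    (∏ j, (1 - z j)).re ^ (a + 1 / 2 - β / 4) *
    (∏ j, (1 + z j)).re ^ (b + 1 / 2 - β / 4) *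
    ∏ j, ∏ k ∈ Ioi j, ‖z k - z j‖

/-- The distribution of unordered `n`-tuples with density `density n β a b` with respect to
`|dz_1 ∧ … ∧ dz_n|`. -/
def eigenvalueLaw (n : ℕ) (β a b : ℝ) : Measure (Sym ℂ n) :=
  ((wedgeMeasure n).withDensity fun z => ENNReal.ofReal (density n β a b z)).map unordered

/-- `α_0, …, α_{n-1}` are independent and `α_k` has the law `B(s_k, t_k)`. -/
structure IndepBeta {Ω : Type*} [MeasurableSpace Ω] (P : Measure Ω) {n : ℕ}
    (α : Fin n → Ω → ℝ) (s t : ℕ → ℝ) : Prop where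
  indep : iIndepFun α P
  law : ∀ k : Fin n, HasLaw (α k) (betaLaw (s k) (t k)) P

/-- The Borel σ-algebra on a group of real matrices. -/
instance instMeasurableSpaceSubmonoid {N : ℕ} (G : Submonoid (Matrix (Fin N) (Fin N) ℝ)) :
    MeasurableSpace G := borel G

instance instBorelSpaceSubmonoid {N : ℕ} (G : Submonoid (Matrix (Fin N) (Fin N) ℝ)) :
    BorelSpace G := ⟨rfl⟩

end TruncatedOrthogonal

end

noncomputable section

namespace TruncatedOrthogonal

/-! ### Scaling a row of an orthogonal matrix -/

section RowScaling

open Polynomial Matrix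

variable {R : Type*} [CommRing R]

/-! Everything is read off from the characteristic polynomial. If one row of an orthogonal matrix is
scaled, the characteristic polynomial of the result is zP − γP*, where P belongs to the
complementary minor, P* is P with reversed coefficients, and γ is the scaling factor up to sign
(`charpoly_updateRow_smul_of_orthogonal`). A CMV matrix is an orthogonal CMV matrix with a scaled
last row or column, so its characteristic polynomials obey the Szegő recursion Φ_{k+1} = zΦ_k − α_k
Φ_k^* (`charpoly_realCmv`).

For independent α_k, the law of the zeros of Φ_n comes from two changes of variables on the set
`diskSet n` of coefficient vectors of monic real polynomials with all zeros in the open disk. From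
Verblunsky coefficients to polynomial coefficients, step k has Jacobian (1 − α_k)^⌈k/2⌉ (1 +
α_k)^⌊k/2⌋ (`lintegral_diskSet_succ`). From zeros to polynomial coefficients, the Jacobian is 2^M
times the modulus of the Vandermonde product (`abs_det_rootMap`, `lintegral_diskSet_rootsSym`). The
other factors of the density are functions of the α_k: ∏(1 − z_j z̄_k) = ∏(1 − α_k²)^{k+1}
(`pairProd_szego`), while Φ_n(1) = ∏(1 − α_k) and (−1)^n Φ_n(−1) = ∏(1 + (−1)^k α_k). The beta laws
are exactly those for which these factors match, and their constants telescope to 1/P_n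
(`normConst_succ`), so no integral of Selberg type is needed. This gives `hasLaw_rootsSym`, on which
all four statements rest.

For (2) and (3): removing the first row and column of a CMV matrix with last coefficient σ = ±1
leaves, up to conjugation and the order of the two factors, the CMV matrix with coefficients
−σα_{n−1−k} (`charpoly_minor_zero_realCmv`).

For (4), only invariance under left multiplication by rotations is used, which covers the three Haar
cases together. A reflection exchanging e_0 and the first row of A shows that the truncation of A is
an orthogonal matrix times a truncated reflection. After multiplication by an independent rotation,
its characteristic polynomial is a Szegő step with γ = ± det A · A_00 applied to that of a
truncation one size smaller (`exists_charpoly_mul_minor_zero`). Up to sign, γ is a coordinate of a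
uniform unit vector, hence beta distributed, and induction on the size
(`IsRotationLaw.map_charCoeff_minor_zero`) gives the same random recursion as in (1) with β = 2, a =
b = −1/2. -/

lemma adjugate_diag_eq_det_minor {n : ℕ} (A : Matrix (Fin (n + 1)) (Fin (n + 1)) R)
    (i : Fin (n + 1)) : A.adjugate i i = (minor i A).det := by
  rw [Matrix.adjugate_fin_succ_eq_det_submatrix, ← two_mul, pow_mul]
  simp [minor]

lemma charmatrix_minor {n : ℕ} (A : Matrix (Fin (n + 1)) (Fin (n + 1)) R) (i : Fin (n + 1)) :
    minor i A.charmatrix = (minor i A).charmatrix := by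
  ext1 j k
  simp [minor, Matrix.charmatrix_apply, Matrix.diagonal_apply]

lemma adjugate_charmatrix_diag {n : ℕ} (A : Matrix (Fin (n + 1)) (Fin (n + 1)) R)
    (i : Fin (n + 1)) : A.charmatrix.adjugate i i = (minor i A).charpoly := by
  rw [adjugate_diag_eq_det_minor, charmatrix_minor]; rfl

/-- Row i of the new characteristic matrix is u times the old row plus (1 − u)X e_i; the determinant
is linear in that row. -/
lemma charpoly_updateRow_smul {n : ℕ} (W : Matrix (Fin (n + 1)) (Fin (n + 1)) R)
    (i : Fin (n + 1)) (u : R) :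
    (W.updateRow i (u • W i)).charpoly =
      C u * W.charpoly + C (1 - u) * X * (minor i W).charpoly := by
  have h : (W.updateRow i (u • W i)).charmatrix =
      W.charmatrix.updateRow i (C u • W.charmatrix i + (C (1 - u) * X) • Pi.single i 1) := by
    ext1 j k
    rcases eq_or_ne j i with rfl | hj
    · rcases eq_or_ne j k with rfl | hk
      · simp; ring
      · simp [Matrix.charmatrix_apply, Matrix.diagonal_apply_ne _ hk, hk.symm]
    · simp [Matrix.charmatrix_apply, hj]
  rw [Matrix.charpoly, h, Matrix.det_updateRow_add, Matrix.det_updateRow_smul,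
    Matrix.det_updateRow_smul, Matrix.updateRow_eq_self, ← Matrix.adjugate_apply,
    adjugate_charmatrix_diag]
  rfl

/-- Jacobi's complementary minor identity for the characteristic matrix of an orthogonal matrix. -/
lemma orthogonal_charpoly_minor [Nontrivial R] {n : ℕ}
    (W : Matrix (Fin (n + 1)) (Fin (n + 1)) R) (hW : Wᵀ * W = 1) (i : Fin (n + 1)) :
    C ((-1) ^ n * W.det) * (X * (minor i W).charpoly - W.charpoly) =
      reflect n (minor i W).charpoly := by
  have hrev : reflect n (minor i W).charpoly =
      (1 - (X : R[X]) • W.map C).adjugate i i := by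
    have h1 : reflect n (minor i W).charpoly = (minor i W).charpoly.reverse := by
      rw [Polynomial.reverse, Matrix.charpoly_natDegree_eq_dim, Fintype.card_fin]
    rw [h1, Matrix.reverse_charpoly, adjugate_diag_eq_det_minor, Matrix.charpolyRev]
    congr 1
    ext1 j k
    simp [minor, Matrix.one_apply]
  have hWC : (W.map C)ᵀ * W.map C = (1 : Matrix _ _ R[X]) := by
    rw [← Matrix.transpose_map, ← Matrix.map_mul, hW]
    simp
  have hWC' : W.map C * (W.map C)ᵀ = (1 : Matrix _ _ R[X]) := mul_eq_one_comm.mp hWC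
  have hadjW : (W.map C).adjugate = C W.det • (W.map C)ᵀ := by
    have h1 := congrArg ((W.map C).adjugate * ·) hWC'
    simp only [← mul_assoc, Matrix.adjugate_mul, mul_one] at h1
    rw [← h1, Matrix.smul_mul, one_mul]
    congr 1
    exact (RingHom.map_det C W).symm
  -- Since WᵀW = 1, the reversed characteristic matrix 1 − XW equals −(X − W)ᵀW. Its adjugate is
  -- therefore a product of adj(X − W)ᵀ and Wᵀ, and `hcomm` evaluates that product.
  have hfac : (1 - (X : R[X]) • W.map C) = -(W.charmatrixᵀ) * W.map C := by
    have : W.charmatrix = (X : R[X]) • 1 - W.map C := by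
      ext1 j k; simp [Matrix.charmatrix_apply, Matrix.one_apply, Matrix.diagonal_apply]
    rw [this, Matrix.transpose_sub, Matrix.neg_mul, sub_mul, hWC]
    simp
  have hcomm : W.charmatrix.adjugate * W.map C =
      (X : R[X]) • W.charmatrix.adjugate - W.charpoly • (1 : Matrix _ _ R[X]) := by
    have h1 := Matrix.adjugate_mul W.charmatrix
    have : W.charmatrix = (X : R[X]) • 1 - W.map C := by
      ext1 j k; simp [Matrix.charmatrix_apply, Matrix.one_apply, Matrix.diagonal_apply]
    have h2 : W.charmatrix.adjugate * W.charmatrix =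
        (X : R[X]) • W.charmatrix.adjugate - W.charmatrix.adjugate * W.map C := by
      conv_lhs => rw [this, mul_sub]
      rw [← this]; simp
    rw [h2] at h1
    rw [Matrix.charpoly, ← h1]; abel
  rw [hrev, hfac, Matrix.adjugate_mul_distrib, hadjW]
  have hneg : (-(W.charmatrixᵀ)).adjugate = C ((-1 : R) ^ n) • W.charmatrix.adjugateᵀ := by
    rw [← neg_one_smul R[X], Matrix.adjugate_smul, Matrix.adjugate_transpose]
    simp
  rw [hneg, Matrix.smul_mul, Matrix.mul_smul, ← Matrix.transpose_mul, hcomm]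
  simp only [Matrix.smul_apply, Matrix.transpose_apply, Matrix.sub_apply, Matrix.one_apply_eq,
    smul_eq_mul, adjugate_charmatrix_diag, map_mul, mul_one]
  ring

/-- Scaling a row of an orthogonal matrix: the Szegő recursion. -/
lemma charpoly_updateRow_smul_of_orthogonal [Nontrivial R] {n : ℕ}
    (W : Matrix (Fin (n + 1)) (Fin (n + 1)) R) (hW : Wᵀ * W = 1) (i : Fin (n + 1)) (u : R) :
    (W.updateRow i (u • W i)).charpoly =
      X * (minor i W).charpoly -
        C (u * ((-1) ^ n * W.det)) * reflect n (minor i W).charpoly := by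
  have hdet : W.det * W.det = 1 := by
    have := congrArg Matrix.det hW
    simpa using this
  have hk : ((-1) ^ n * W.det) * ((-1) ^ n * W.det) = 1 := by
    rw [mul_mul_mul_comm, hdet, ← mul_pow]; simp
  rw [charpoly_updateRow_smul, ← orthogonal_charpoly_minor W hW i, ← mul_assoc, ← C_mul,
    mul_assoc u, hk]
  simp only [mul_one, map_sub, map_one]
  ring

end RowScaling

/-! ### CMV matrices and their characteristic polynomials -/

section CMV

open Polynomial Matrix

/-- Entries of the real factors of the CMV matrix, for a sequence of real coefficients. -/
def realEntry (p : ℕ) (a : ℕ → ℝ) (i j : ℕ) : ℝ :=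
  if i = j then if i % 2 = p then a i else if i = 0 then 1 else -a (i - 1)
  else if i + 1 = j ∧ i % 2 = p then √(1 - a i ^ 2)
  else if j + 1 = i ∧ j % 2 = p then √(1 - a j ^ 2)
  else 0

/-- The leading `n × n` block of a real CMV factor. -/
def realFactor (p n : ℕ) (a : ℕ → ℝ) : Matrix (Fin n) (Fin n) ℝ :=
  fun i j => realEntry p a i j

/-- The monic Szegő polynomials with real Verblunsky coefficients. -/
def szego (a : ℕ → ℝ) : ℕ → ℝ[X]
  | 0 => 1
  | n + 1 => X * szego a n - C (a n) * reflect n (szego a n)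

lemma cmvFactor_ofReal (p : ℕ) {n : ℕ} (α : Fin n → ℂ) (a : ℕ → ℝ) (h : ∀ k : Fin n, α k = a k) :
    cmvFactor p α = (realFactor p n a).map Complex.ofReal := by
  ext i j
  simp only [cmvFactor, realFactor, realEntry, Matrix.map_apply, h, Fin.ext_iff,
    Complex.conj_ofReal, Complex.norm_real, Real.norm_eq_abs, sq_abs]
  split_ifs <;> simp

lemma cmv_ofReal {n : ℕ} (α : Fin n → ℂ) (a : ℕ → ℝ) (h : ∀ k : Fin n, α k = a k) :
    cmv α = (realFactor 0 n a * realFactor 1 n a).map Complex.ofReal := by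
  rw [cmv, cmvFactor_ofReal 0 α a h, cmvFactor_ofReal 1 α a h]
  exact (Matrix.map_mul (f := Complex.ofRealHom)).symm

lemma realEntry_symm (p : ℕ) (a : ℕ → ℝ) (i j : ℕ) : realEntry p a i j = realEntry p a j i := by
  rcases lt_trichotomy i j with h | h | h
  · simp only [realEntry, h.ne, h.ne', if_false]
    split_ifs <;> first | rfl | omega
  · rw [h]
  · simp only [realEntry, h.ne, h.ne', if_false]
    split_ifs <;> first | rfl | omega

lemma realEntry_congr (p : ℕ) {n : ℕ} {a b : ℕ → ℝ} (h : ∀ k < n, a k = b k) {i j : ℕ}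
    (hi : i < n) (hj : j < n) : realEntry p a i j = realEntry p b i j := by
  simp only [realEntry, h i hi, h j hj, h (i - 1) (by omega)]

lemma realFactor_congr (p : ℕ) {n : ℕ} {a b : ℕ → ℝ} (h : ∀ k < n, a k = b k) :
    realFactor p n a = realFactor p n b := by
  ext i j
  exact realEntry_congr p h i.2 j.2

lemma realFactor_transpose (p n : ℕ) (a : ℕ → ℝ) : (realFactor p n a)ᵀ = realFactor p n a := by
  ext i j
  exact realEntry_symm p a j i

lemma realEntry_block (p : ℕ) (a : ℕ → ℝ) (i : ℕ) (h : i % 2 = p) :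
    realEntry p a i i = a i ∧ realEntry p a i (i + 1) = √(1 - a i ^ 2) ∧
      realEntry p a (i + 1) (i + 1) = -a i ∧
      ∀ k, k ≠ i → k ≠ i + 1 → realEntry p a i k = 0 ∧ realEntry p a (i + 1) k = 0 := by
  refine ⟨by simp [realEntry, h], by simp [realEntry, h], ?_, fun k hk hk' => ?_⟩
  · rw [realEntry, if_pos rfl, if_neg (by omega), if_neg (by omega), Nat.add_sub_cancel]
  · constructor <;> (simp only [realEntry]; split_ifs <;> first | rfl | omega)

/-- Each block [[a, ρ], [ρ, −a]] is an involution because ρ² = 1 − a². The condition on `a n` makes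
the cut-off last block an involution as well. -/
lemma sum_realEntry_mul (p : ℕ) (hp : p < 2) (n : ℕ) (a : ℕ → ℝ) (ha : ∀ k < n, |a k| ≤ 1)
    (hn : a n = 1) {i j : ℕ} (hi : i < n + 1) (hj : j < n + 1) :
    ∑ k ∈ range (n + 1), realEntry p a i k * realEntry p a k j = if i = j then 1 else 0 := by
  have hsq : ∀ k < n + 1, √(1 - a k ^ 2) * √(1 - a k ^ 2) = 1 - a k ^ 2 := fun k hk => by
    apply Real.mul_self_sqrt
    rcases Nat.lt_succ_iff_lt_or_eq.mp hk with h | h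
    · have := (sq_le_one_iff_abs_le_one _).mpr (ha k h); linarith
    · rw [h, hn]; norm_num
  by_cases h : i % 2 = p
  · obtain ⟨hA, hB, hD, hZ⟩ := realEntry_block p a i h
    have hC := (realEntry_symm p a (i + 1) i).trans hB
    by_cases hin : i = n
    · rw [sum_eq_single_of_mem i (by simpa using hi), hA, hin, hn, one_mul, ← hin]
      · by_cases hij : i = j
        · rw [if_pos hij, ← hij, hA, hin, hn]
        · rw [if_neg hij, (hZ j (Ne.symm hij) (by omega)).1]
      · intro k hk hki
        rw [(hZ k hki (by have := mem_range.mp hk; omega)).1, zero_mul]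
    · rw [← sum_subset (s₁ := {i, i + 1}) (by intro k; simp; omega), sum_pair (by omega), hA, hB]
      · by_cases hij : i = j
        · rw [if_pos hij, ← hij, hA, hC, hsq i hi]; ring
        · rw [if_neg hij]
          by_cases hij' : j = i + 1
          · rw [hij', hB, hD]; ring
          · rw [(hZ j (Ne.symm hij) hij').1, (hZ j (Ne.symm hij) hij').2]; ring
      · intro k hk hki
        simp only [mem_insert, mem_singleton, not_or] at hki
        rw [(hZ k hki.1 hki.2).1, zero_mul]
  · rcases i with _ | i
    · have h0 : ∀ k, realEntry p a 0 k = if 0 = k then 1 else 0 := by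
        intro k
        have hp0 : ¬0 = p := h
        by_cases hk : 0 = k
        · simp [realEntry, ← hk, hp0]
        · simp [realEntry, hk, hp0]
      rw [sum_eq_single_of_mem 0 (by simp), h0, h0]
      · simp
      · intro k hk hki
        rw [h0, if_neg (Ne.symm hki), zero_mul]
    · obtain ⟨hA, hB, hD, hZ⟩ := realEntry_block p a i (by omega)
      have hC := (realEntry_symm p a (i + 1) i).trans hB
      rw [← sum_subset (s₁ := {i, i + 1}) (by intro k; simp; omega), sum_pair (by omega), hC, hD]
      · by_cases hij : i + 1 = j
        · rw [if_pos hij, ← hij, hB, hD, hsq i (by omega)]; ring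
        · rw [if_neg hij]
          by_cases hij' : j = i
          · rw [hij', hA, hC]; ring
          · rw [(hZ j hij' (Ne.symm hij)).1, (hZ j hij' (Ne.symm hij)).2]; ring
      · intro k hk hki
        simp only [mem_insert, mem_singleton, not_or] at hki
        rw [(hZ k hki.1 hki.2).2, zero_mul]

lemma realFactor_mul_self (p : ℕ) (hp : p < 2) (n : ℕ) (a : ℕ → ℝ) (ha : ∀ k < n, |a k| ≤ 1)
    (hn : a n = 1) : realFactor p (n + 1) a * realFactor p (n + 1) a = 1 := by
  ext i j
  rw [Matrix.mul_apply, Matrix.one_apply]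
  have := sum_realEntry_mul p hp n a ha hn i.2 j.2
  rw [sum_range] at this
  simp only [Fin.ext_iff]
  exact this

lemma realCmv_orthogonal (n : ℕ) (a : ℕ → ℝ) (ha : ∀ k < n, |a k| ≤ 1) (hn : a n = 1) :
    (realFactor 0 (n + 1) a * realFactor 1 (n + 1) a)ᵀ *
      (realFactor 0 (n + 1) a * realFactor 1 (n + 1) a) = 1 := by
  rw [Matrix.transpose_mul, realFactor_transpose, realFactor_transpose, Matrix.mul_assoc,
    ← Matrix.mul_assoc (realFactor 0 _ _), realFactor_mul_self 0 (by norm_num) n a ha hn,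
    Matrix.one_mul, realFactor_mul_self 1 (by norm_num) n a ha hn]

lemma realFactor_ones (p n : ℕ) :
    realFactor p n (fun _ => 1) =
      diagonal fun i : Fin n => if (i : ℕ) % 2 = p then 1 else if (i : ℕ) = 0 then 1 else -1 := by
  ext i j
  simp only [realFactor, realEntry, diagonal_apply, Fin.ext_iff]
  split_ifs <;> simp

lemma det_realCmv_ones (n : ℕ) :
    (realFactor 0 (n + 1) (fun _ => 1) * realFactor 1 (n + 1) (fun _ => 1)).det = (-1) ^ n := by
  rw [realFactor_ones, realFactor_ones, diagonal_mul_diagonal, det_diagonal, Fin.prod_univ_succ]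
  have : ∀ i : Fin n, ((if (i.succ : ℕ) % 2 = 0 then (1 : ℝ) else
      if (i.succ : ℕ) = 0 then 1 else -1) * if (i.succ : ℕ) % 2 = 1 then 1 else
      if (i.succ : ℕ) = 0 then 1 else -1) = -1 := by
    intro i
    simp only [Fin.val_succ]
    split_ifs <;> first | contradiction | omega | norm_num
  rw [prod_congr rfl fun i _ => this i]
  simp

lemma continuous_realEntry (p i j : ℕ) : Continuous fun a : ℕ → ℝ => realEntry p a i j := by
  unfold realEntry
  split_ifs <;> fun_prop

/-- The segment from `a` to the constant sequence 1 stays among orthogonal matrices, so the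
determinant takes values in {1, −1} along it and is constant by continuity. At the end of the
segment both factors are diagonal. -/
lemma det_realCmv (n : ℕ) (a : ℕ → ℝ) (ha : ∀ k < n, |a k| ≤ 1) (hn : a n = 1) :
    (realFactor 0 (n + 1) a * realFactor 1 (n + 1) a).det = (-1) ^ n := by
  set b : ℝ → ℕ → ℝ := fun s k => (1 - s) * a k + s with hb
  set f : ℝ → ℝ := fun s =>
    (realFactor 0 (n + 1) (b s) * realFactor 1 (n + 1) (b s)).det with hf
  have hbc : Continuous b := by fun_prop
  have hfac : ∀ p, Continuous fun s => realFactor p (n + 1) (b s) := fun p =>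
    continuous_matrix fun i j => (continuous_realEntry p i j).comp hbc
  have hfc : Continuous f := Continuous.matrix_det ((hfac 0).matrix_mul (hfac 1))
  have hsq : ∀ s ∈ Set.Icc (0 : ℝ) 1, f s = 1 ∨ f s = -1 := by
    intro s hs
    have h1 := realCmv_orthogonal n (b s) (fun k hk => by
      have h2 := abs_le.mp (ha k hk)
      rw [abs_le]
      constructor <;> simp only [hb] <;> nlinarith [hs.1, hs.2]) (by simp [hb, hn])
    have h2 := congrArg Matrix.det h1
    rw [Matrix.det_mul, Matrix.det_transpose, Matrix.det_one] at h2
    exact mul_self_eq_one_iff.mp h2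
  have hone : f 1 = (-1) ^ n := by
    have : b 1 = fun _ => 1 := by ext; simp [hb]
    simp only [hf, this, det_realCmv_ones]
  have hzero : f 0 = (realFactor 0 (n + 1) a * realFactor 1 (n + 1) a).det := by
    have : b 0 = a := by ext; simp [hb]
    simp only [hf, this]
  rw [← hzero, ← hone]
  by_contra hne
  have : (0 : ℝ) ∈ f '' Set.uIcc 0 1 := by
    apply intermediate_value_uIcc hfc.continuousOn
    rcases hsq 0 (by simp) with h0 | h0 <;> rcases hsq 1 (by simp) with h1 | h1 <;>
      rw [h0, h1] at hne ⊢ <;> first | exact absurd rfl hne | (rw [Set.mem_uIcc]; norm_num)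
  obtain ⟨s, hs, hs0⟩ := this
  rw [Set.uIcc_of_le zero_le_one] at hs
  rcases hsq s hs with h | h <;> rw [hs0] at h <;> norm_num at h

lemma minor_mul_of_col {R : Type*} [CommRing R] {n : ℕ} (i : Fin (n + 1))
    (A B : Matrix (Fin (n + 1)) (Fin (n + 1)) R) (h : ∀ j, A (i.succAbove j) i = 0) :
    minor i (A * B) = minor i A * minor i B := by
  ext j k
  simp only [minor, Matrix.submatrix_apply, Matrix.mul_apply]
  rw [Fin.sum_univ_succAbove _ i, h, zero_mul, zero_add]

lemma minor_mul_of_row {R : Type*} [CommRing R] {n : ℕ} (i : Fin (n + 1))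
    (A B : Matrix (Fin (n + 1)) (Fin (n + 1)) R) (h : ∀ j, B i (i.succAbove j) = 0) :
    minor i (A * B) = minor i A * minor i B := by
  ext j k
  simp only [minor, Matrix.submatrix_apply, Matrix.mul_apply]
  rw [Fin.sum_univ_succAbove _ i, h, mul_zero, zero_add]

lemma minor_last_realFactor (p n : ℕ) (a : ℕ → ℝ) :
    minor (Fin.last n) (realFactor p (n + 1) a) = realFactor p n a := by
  ext i j
  simp [minor, realFactor]

lemma realFactor_col_last (p n : ℕ) (a : ℕ → ℝ) (hp : n % 2 = p) (j : Fin n) :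
    realFactor p (n + 1) a ((Fin.last n).succAbove j) (Fin.last n) = 0 := by
  have := j.2
  simp only [realFactor, realEntry, Fin.succAbove_last, Fin.val_castSucc, Fin.val_last]
  split_ifs <;> first | rfl | omega

/-- In the factor whose parity is that of n, the index n is a 1 × 1 block; this suffices for the
minor of the product to be the product of the minors. -/
lemma minor_last_realCmv (n : ℕ) (a : ℕ → ℝ) :
    minor (Fin.last n) (realFactor 0 (n + 1) a * realFactor 1 (n + 1) a) =
      realFactor 0 n a * realFactor 1 n a := by
  rcases Nat.mod_two_eq_zero_or_one n with h | h
  · rw [minor_mul_of_col _ _ _ (realFactor_col_last 0 n a h), minor_last_realFactor,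
      minor_last_realFactor]
  · rw [minor_mul_of_row, minor_last_realFactor, minor_last_realFactor]
    intro j
    rw [realFactor, realEntry_symm]
    exact realFactor_col_last 1 n a h j

/-- The last index starts a block here, for either parity of n, so the only nonzero entry its row
can have is the diagonal entry `a n`. -/
lemma realFactor_last_even (n : ℕ) (p : ℕ) (a : ℕ → ℝ) (h : n % 2 = p) :
    realFactor p (n + 1) a =
      (realFactor p (n + 1) (Function.update a n 1)).updateRow (Fin.last n)
        (a n • realFactor p (n + 1) (Function.update a n 1) (Fin.last n)) := by
  ext i j
  rcases Fin.eq_castSucc_or_eq_last i with ⟨i, rfl⟩ | rfl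
  · rw [Matrix.updateRow_ne (Fin.castSucc_lt_last i).ne]
    have hi := i.2
    have hj := j.2
    simp only [realFactor, realEntry, Function.update_apply, Fin.val_castSucc]
    split_ifs <;> first | rfl | omega
  · have hj := j.2
    simp only [Matrix.updateRow_self, Pi.smul_apply, smul_eq_mul, realFactor, realEntry,
      Function.update_apply, Fin.val_last]
    split_ifs <;> first | omega | simp

lemma realFactor_update (n : ℕ) (p : ℕ) (a : ℕ → ℝ) (h : n % 2 ≠ p) :
    realFactor p (n + 1) (Function.update a n 1) = realFactor p (n + 1) a := by
  ext i j
  have hi := i.2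
  have hj := j.2
  simp only [realFactor, realEntry, Function.update_apply]
  split_ifs <;> first | rfl | omega

lemma updateRow_smul_eq_diagonal_mul {n : ℕ} (W : Matrix (Fin n) (Fin n) ℝ) (i : Fin n) (u : ℝ) :
    W.updateRow i (u • W i) = diagonal (Function.update 1 i u) * W := by
  ext j k
  rw [diagonal_mul]
  rcases eq_or_ne j i with rfl | h
  · simp
  · simp [h]

/-- With the last coefficient replaced by 1 the matrix is orthogonal. For even n, `a n` scales the
last row of the left factor. For odd n it scales the last column of the right factor, and cyclic
invariance of the characteristic polynomial turns this into a row scaling. -/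
lemma charpoly_realCmv_succ (n : ℕ) (a : ℕ → ℝ) (ha : ∀ k < n, |a k| ≤ 1) :
    (realFactor 0 (n + 1) a * realFactor 1 (n + 1) a).charpoly =
      X * (realFactor 0 n a * realFactor 1 n a).charpoly -
        C (a n) * reflect n (realFactor 0 n a * realFactor 1 n a).charpoly := by
  set b := Function.update a n 1 with hb
  set W := realFactor 0 (n + 1) b * realFactor 1 (n + 1) b with hW
  have hbk : ∀ k < n, b k = a k := fun k hk => Function.update_of_ne hk.ne _ _
  have hb' : ∀ k < n, |b k| ≤ 1 := fun k hk => by rw [hbk k hk]; exact ha k hk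
  have hbn : b n = 1 := Function.update_self _ _ _
  have h1 : (realFactor 0 (n + 1) a * realFactor 1 (n + 1) a).charpoly =
      (W.updateRow (Fin.last n) (a n • W (Fin.last n))).charpoly := by
    rw [updateRow_smul_eq_diagonal_mul]
    rcases Nat.mod_two_eq_zero_or_one n with h | h
    · rw [realFactor_last_even n 0 a h, ← realFactor_update n 1 a (by omega),
        updateRow_smul_eq_diagonal_mul, Matrix.mul_assoc]
    · rw [← realFactor_transpose 1 (n + 1) a, realFactor_last_even n 1 a h,
        ← realFactor_update n 0 a (by omega), updateRow_smul_eq_diagonal_mul,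
        Matrix.transpose_mul, realFactor_transpose, diagonal_transpose, ← Matrix.mul_assoc,
        Matrix.charpoly_mul_comm]
  rw [h1, charpoly_updateRow_smul_of_orthogonal W (realCmv_orthogonal n b hb' hbn), hW,
    minor_last_realCmv, det_realCmv n b hb' hbn, realFactor_congr 0 hbk, realFactor_congr 1 hbk,
    ← mul_pow]
  simp

lemma charpoly_realCmv (n : ℕ) (a : ℕ → ℝ) (ha : ∀ k < n, |a k| ≤ 1) :
    (realFactor 0 n a * realFactor 1 n a).charpoly = szego a n := by
  induction n with
  | zero => simp [szego]
  | succ n ih =>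
    rw [charpoly_realCmv_succ n a fun k hk => ha k (by omega), szego,
      ih fun k hk => ha k (by omega)]

lemma charpoly_cmv {n : ℕ} (α : Fin n → ℂ) (a : ℕ → ℝ) (h : ∀ k : Fin n, α k = a k)
    (ha : ∀ k < n, |a k| ≤ 1) : (cmv α).charpoly = (szego a n).map Complex.ofRealHom := by
  rw [cmv_ofReal α a h, ← charpoly_realCmv n a ha]
  exact Matrix.charpoly_map _ Complex.ofRealHom

/-- Removing the first row and column of a CMV matrix reverses the Verblunsky coefficients. -/
lemma realFactor_reverse (p n : ℕ) (hp : p < 2) (a b : ℕ → ℝ) (σ : ℝ) (hσ : σ = 1 ∨ σ = -1)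
    (han : a n = σ) (hb : ∀ k < n, b k = -σ * a (n - 1 - k)) :
    (minor 0 (realFactor p (n + 1) a)).submatrix Fin.rev Fin.rev =
      diagonal (fun i : Fin n => σ ^ (i : ℕ)) * realFactor ((n + 1 - p) % 2) n b *
        diagonal (fun i : Fin n => σ ^ ((i : ℕ) + 1)) := by
  have hσ2 : σ * σ = 1 := by rcases hσ with h | h <;> rw [h] <;> norm_num
  have hpow : ∀ i : ℕ, σ ^ i * σ ^ i = 1 := fun i => by rw [← mul_pow, hσ2, one_pow]
  have hbsq : ∀ k < n, b k ^ 2 = a (n - 1 - k) ^ 2 := fun k hk => by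
    rw [hb k hk, mul_pow, neg_sq, sq σ, hσ2, one_mul]
  -- In the numbering before the removal, the reversal is i ↦ n − i. It turns a block [[a, ρ], [ρ,
  -- −a]] into [[−a, ρ], [ρ, a]]. The powers of σ multiply diagonal entries by σ and leave
  -- off-diagonal ones unchanged.
  ext i j
  have hi := i.2
  have hj := j.2
  rw [mul_diagonal, diagonal_mul]
  simp only [minor, Matrix.submatrix_apply, Fin.zero_succAbove, realFactor, Fin.val_succ,
    Fin.val_rev]
  have e1 : n - (i + 1) + 1 = n - (i : ℕ) := by omega
  have e2 : n - (j + 1) + 1 = n - (j : ℕ) := by omega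
  rw [e1, e2]
  have hd : σ ^ (i : ℕ) * σ ^ ((i : ℕ) + 1) = σ := by rw [pow_succ, ← mul_assoc, hpow, one_mul]
  rcases lt_trichotomy (i : ℕ) j with h | h | h
  · rcases eq_or_ne ((i : ℕ) + 1) j with h' | h'
    · have hs : σ ^ (i : ℕ) * σ ^ ((j : ℕ) + 1) = 1 := by
        rw [← h', pow_succ, pow_succ, mul_assoc _ σ σ, hσ2, mul_one, hpow]
      have hk : n - 1 - (i : ℕ) = n - j := by omega
      rw [mul_right_comm, hs, one_mul]
      simp only [realEntry, hbsq i hi, hk]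
      split_ifs <;> first | rfl | omega
    · rw [show realEntry p a (n - i) (n - j) = 0 by
        simp only [realEntry]; split_ifs <;> first | rfl | omega,
        show realEntry ((n + 1 - p) % 2) b i j = 0 by
        simp only [realEntry]; split_ifs <;> first | rfl | omega]
      simp
  · rw [← h, mul_right_comm, hd]
    simp only [realEntry, if_true]
    by_cases hq : (i : ℕ) % 2 = (n + 1 - p) % 2
    · rw [if_pos hq, if_neg (by omega), if_neg (by omega), hb i hi, ← mul_assoc, mul_neg, hσ2,
        show n - 1 - (i : ℕ) = n - i - 1 by omega]
      ring
    · rw [if_neg hq, if_pos (by omega)]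
      split_ifs with h0
      · rw [h0, Nat.sub_zero, han, mul_one]
      · rw [hb _ (by omega), neg_mul, neg_neg, ← mul_assoc, hσ2, one_mul]
        congr 1; omega
  · rcases eq_or_ne ((j : ℕ) + 1) i with h' | h'
    · have hs : σ ^ (i : ℕ) * σ ^ ((j : ℕ) + 1) = 1 := by rw [h', hpow]
      have hk : n - 1 - (j : ℕ) = n - i := by omega
      rw [mul_right_comm, hs, one_mul]
      simp only [realEntry, hbsq j hj, hk]
      split_ifs <;> first | rfl | omega
    · rw [show realEntry p a (n - i) (n - j) = 0 by
        simp only [realEntry]; split_ifs <;> first | rfl | omega,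
        show realEntry ((n + 1 - p) % 2) b i j = 0 by
        simp only [realEntry]; split_ifs <;> first | rfl | omega]
      simp

/-- The sign matrices of `realFactor_reverse` cancel in the product. For even n the reversal
exchanges the two factors, which the characteristic polynomial does not see. -/
lemma charpoly_minor_zero_realCmv (n : ℕ) (a b : ℕ → ℝ) (σ : ℝ) (hσ : σ = 1 ∨ σ = -1)
    (han : a n = σ) (hb : ∀ k < n, b k = -σ * a (n - 1 - k)) :
    (minor 0 (realFactor 0 (n + 1) a * realFactor 1 (n + 1) a)).charpoly =
      (realFactor 0 n b * realFactor 1 n b).charpoly := by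
  have hσ2 : σ * σ = 1 := by rcases hσ with h | h <;> rw [h] <;> norm_num
  have hcol : ∀ j : Fin n, realFactor 1 (n + 1) a 0 ((0 : Fin (n + 1)).succAbove j) = 0 := by
    intro j
    simp [realFactor, realEntry]
  rw [minor_mul_of_row _ _ _ hcol, ← Matrix.charpoly_reindex Fin.revPerm]
  have hsub : (Matrix.reindex Fin.revPerm Fin.revPerm)
      (minor 0 (realFactor 0 (n + 1) a) * minor 0 (realFactor 1 (n + 1) a)) =
      (minor 0 (realFactor 0 (n + 1) a)).submatrix Fin.rev Fin.rev *
      (minor 0 (realFactor 1 (n + 1) a)).submatrix Fin.rev Fin.rev := by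
    rw [Matrix.reindex_apply]
    exact (Matrix.submatrix_mul_equiv _ _ Fin.rev Fin.revPerm Fin.rev).symm
  rw [hsub, realFactor_reverse 0 n (by norm_num) a b σ hσ han hb,
    realFactor_reverse 1 n (by norm_num) a b σ hσ han hb]
  set D : Matrix (Fin n) (Fin n) ℝ := diagonal fun i : Fin n => σ ^ (i : ℕ) with hD
  have hpow : ∀ i : ℕ, σ ^ i * σ ^ i = 1 := fun i => by rw [← mul_pow, hσ2, one_pow]
  have hDD : D * D = 1 := by
    rw [hD, diagonal_mul_diagonal]; simp [hpow]
  have hE : diagonal (fun i : Fin n => σ ^ ((i : ℕ) + 1)) = σ • D := by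
    ext i j
    simp only [hD, Matrix.smul_apply, diagonal_apply, smul_eq_mul]
    split_ifs <;> ring
  rw [hE]
  have key : ∀ A B : Matrix (Fin n) (Fin n) ℝ,
      (D * A * (σ • D) * (D * B * (σ • D))).charpoly = (A * B).charpoly := by
    intro A B
    have : D * A * (σ • D) * (D * B * (σ • D)) = D * (A * B) * D := by
      simp only [Matrix.mul_smul, Matrix.smul_mul, smul_smul, hσ2, one_smul]
      calc D * A * D * (D * B * D) = D * A * (D * D) * B * D := by simp only [Matrix.mul_assoc]
        _ = _ := by rw [hDD]; simp only [Matrix.mul_assoc, Matrix.mul_one]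
    rw [this, Matrix.charpoly_mul_comm, ← Matrix.mul_assoc, hDD, Matrix.one_mul]
  rw [key]
  rcases Nat.mod_two_eq_zero_or_one n with h | h
  · rw [show (n + 1 - 0) % 2 = 1 by omega, show (n + 1 - 1) % 2 = 0 by omega,
      Matrix.charpoly_mul_comm]
  · rw [show (n + 1 - 0) % 2 = 0 by omega, show (n + 1 - 1) % 2 = 1 by omega]

end CMV

/-! ### Szegő polynomials: values at ±1, products over zeros, zeros in the disk -/

section Szego

open Polynomial

/-- One step of the Szegő recursion. -/
def szegoStep {R : Type*} [CommRing R] (n : ℕ) (γ : R) (p : R[X]) : R[X] :=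
  X * p - C γ * reflect n p

section Step

variable {R : Type*} [CommRing R] {n : ℕ} {p : R[X]}

lemma szegoStep_map {S : Type*} [CommRing S] (f : R →+* S) (γ : R) (p : R[X]) :
    (szegoStep n γ p).map f = szegoStep n (f γ) (p.map f) := by
  simp [szegoStep, reflect_map]

lemma natDegree_reflect_le_of_le (h : p.natDegree ≤ n) : (reflect n p).natDegree ≤ n :=
  (natDegree_reflect_le ..).trans (by simp [h])

lemma szegoStep_monic [Nontrivial R] (γ : R) (hp : p.Monic) (hn : p.natDegree = n) :
    (szegoStep n γ p).Monic ∧ (szegoStep n γ p).natDegree = n + 1 := by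
  have h1 : (X * p).Monic := monic_X.mul hp
  have h2 : (X * p).natDegree = n + 1 := by
    rw [monic_X.natDegree_mul hp, natDegree_X, hn, add_comm]
  have h3 : (C γ * reflect n p).natDegree < (X * p).natDegree := by
    rw [h2, Nat.lt_succ_iff]
    exact (natDegree_C_mul_le _ _).trans (natDegree_reflect_le_of_le hn.le)
  have h4 : (C γ * reflect n p).degree < (X * p).degree := by
    apply degree_lt_degree h3
  exact ⟨h1.sub_of_left h4, by rw [szegoStep, natDegree_sub_eq_left_of_natDegree_lt h3, h2]⟩

lemma reflect_succ_X_mul (hn : p.natDegree ≤ n) : reflect (n + 1) (X * p) = reflect n p := by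
  rw [add_comm, reflect_mul (F := 1) (G := n) X p natDegree_X_le hn, reflect_one_X, one_mul]

lemma reflect_succ_of_le (hn : p.natDegree ≤ n) : reflect (n + 1) p = X * reflect n p := by
  have h := reflect_mul (F := 1) (G := n) (1 : R[X]) p (by simp) hn
  rw [one_mul, reflect_one, pow_one, add_comm 1 n] at h
  exact h

lemma reflect_szegoStep (γ : R) (hn : p.natDegree ≤ n) :
    reflect (n + 1) (szegoStep n γ p) = reflect n p - C γ * (X * p) := by
  rw [szegoStep, reflect_sub, reflect_succ_X_mul hn, reflect_C_mul,
    reflect_succ_of_le (natDegree_reflect_le_of_le hn), reflect_reflect]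

lemma eval_one_reflect (hn : p.natDegree ≤ n) : (reflect n p).eval 1 = p.eval 1 := by
  let _ : Invertible (1 : R) := invertibleOne
  have := eval₂_reflect_mul_pow (RingHom.id R) (1 : R) n p hn
  simpa [eval₂_id] using this

lemma eval_neg_one_reflect (hn : p.natDegree ≤ n) :
    (reflect n p).eval (-1) = (-1) ^ n * p.eval (-1) := by
  let _ : Invertible (-1 : R) := ⟨-1, by simp, by simp⟩
  have := eval₂_reflect_mul_pow (RingHom.id R) (-1 : R) n p hn
  rw [eval₂_id, eval₂_id, show ⅟(-1 : R) = -1 from rfl] at this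
  rw [← this, mul_comm, mul_assoc, ← mul_pow]
  simp

end Step

lemma szego_succ (a : ℕ → ℝ) (n : ℕ) : szego a (n + 1) = szegoStep n (a n) (szego a n) := rfl

lemma szego_monic (a : ℕ → ℝ) (n : ℕ) : (szego a n).Monic ∧ (szego a n).natDegree = n := by
  induction n with
  | zero => simp [szego, monic_one]
  | succ n ih => exact szegoStep_monic _ ih.1 ih.2

lemma szego_congr {a b : ℕ → ℝ} {n : ℕ} (h : ∀ k < n, a k = b k) : szego a n = szego b n := by
  induction n with
  | zero => rfl
  | succ n ih => rw [szego_succ, szego_succ, ih fun k hk => h k (by omega), h n (by omega)]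

lemma eval_one_szego (a : ℕ → ℝ) (n : ℕ) : (szego a n).eval 1 = ∏ k ∈ range n, (1 - a k) := by
  induction n with
  | zero => simp [szego]
  | succ n ih =>
    rw [szego_succ, szegoStep, prod_range_succ, ← ih]
    simp only [eval_sub, eval_mul, eval_X, eval_C, eval_one_reflect (szego_monic a n).2.le]
    ring

lemma eval_neg_one_szego (a : ℕ → ℝ) (n : ℕ) :
    (-1) ^ n * (szego a n).eval (-1) = ∏ k ∈ range n, (1 + (-1) ^ k * a k) := by
  induction n with
  | zero => simp [szego]
  | succ n ih =>
    rw [szego_succ, szegoStep, prod_range_succ, ← ih]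
    simp only [eval_sub, eval_mul, eval_X, eval_C, eval_neg_one_reflect (szego_monic a n).2.le]
    ring

/-- The product of `1 - z w` over all ordered pairs of elements of a multiset. -/
def pairProd (s : Multiset ℂ) : ℂ := (s.map fun z => (s.map fun w => 1 - z * w).prod).prod

lemma reflect_prod_X_sub_C (s : Multiset ℂ) :
    reflect (Multiset.card s) (s.map fun w => X - C w).prod = (s.map fun w => 1 - C w * X).prod := by
  induction s using Multiset.induction_on with
  | empty => simp
  | cons w s ih =>
    rw [Multiset.map_cons, Multiset.prod_cons, Multiset.card_cons, add_comm, reflect_mul,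
      Multiset.map_cons, Multiset.prod_cons, ih]
    · congr 1
      rw [reflect_sub, reflect_one_X, reflect_C, pow_one]
    · exact natDegree_X_sub_C_le _
    · rw [natDegree_multiset_prod_X_sub_C_eq_card]

lemma reflect_eq_prod_roots {P : ℂ[X]} (hP : P.Monic) {n : ℕ} (hn : P.natDegree = n) :
    reflect n P = (P.roots.map fun w => 1 - C w * X).prod := by
  have hs := IsAlgClosed.splits P
  have hcard : Multiset.card P.roots = n := by
    rw [← hn]; exact IsAlgClosed.card_roots_eq_natDegree
  conv_lhs => rw [hs.eq_prod_roots_of_monic hP, ← hcard]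
  exact reflect_prod_X_sub_C _

lemma eval_reflect_eq_prod {P : ℂ[X]} (hP : P.Monic) {n : ℕ} (hn : P.natDegree = n) (z : ℂ) :
    (reflect n P).eval z = (P.roots.map fun w => 1 - z * w).prod := by
  rw [reflect_eq_prod_roots hP hn, eval_multiset_prod, Multiset.map_map]
  congr 1
  apply Multiset.map_congr rfl
  intro w _
  simp only [Function.comp_apply, eval_sub, eval_one, eval_mul, eval_C, eval_X, mul_comm w z]

lemma eval_eq_prod {P : ℂ[X]} (hP : P.Monic) (z : ℂ) :
    P.eval z = (P.roots.map fun w => z - w).prod :=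
  (IsAlgClosed.splits P).eval_eq_prod_roots_of_monic hP z

lemma pairProd_roots {P : ℂ[X]} (hP : P.Monic) {n : ℕ} (hn : P.natDegree = n) :
    pairProd P.roots = (P.roots.map fun z => (reflect n P).eval z).prod := by
  simp only [pairProd, eval_reflect_eq_prod hP hn]

/-- Let Q = zP − γP*, so that Q* = P* − γzP. At zeros of Q this gives Q* = (1 − γ²)P*, and at zeros
of P it gives Q* = P*. The product of P* over the zeros of Q and that of Q* over the zeros of P
agree: both are the product of 1 − zw over all zeros z of Q and w of P. -/
lemma pairProd_roots_szegoStep {P : ℂ[X]} (hP : P.Monic) {n : ℕ} (hn : P.natDegree = n) (γ : ℂ) :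
    pairProd (szegoStep n γ P).roots = (1 - γ ^ 2) ^ (n + 1) * pairProd P.roots := by
  obtain ⟨hQ, hQn⟩ := szegoStep_monic γ hP hn
  set Q := szegoStep n γ P with hQdef
  have hcard : Multiset.card Q.roots = n + 1 := by
    rw [← hQn]; exact IsAlgClosed.card_roots_eq_natDegree
  have h1 : ∀ z ∈ Q.roots, (reflect (n + 1) Q).eval z = (1 - γ ^ 2) * (reflect n P).eval z := by
    intro z hz
    have hz0 : Q.eval z = 0 := (mem_roots'.mp hz).2
    rw [hQdef, szegoStep] at hz0
    rw [hQdef, reflect_szegoStep γ hn.le]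
    simp only [eval_sub, eval_mul, eval_X, eval_C] at hz0 ⊢
    linear_combination (-γ) * hz0
  have h2 : ∀ w ∈ P.roots, (reflect (n + 1) Q).eval w = (reflect n P).eval w := by
    intro w hw
    have hw0 : P.eval w = 0 := (mem_roots'.mp hw).2
    rw [hQdef, reflect_szegoStep γ hn.le]
    simp [hw0]
  rw [pairProd_roots hQ hQn, Multiset.map_congr rfl h1, Multiset.prod_map_mul,
    Multiset.map_const', Multiset.prod_replicate, hcard, pairProd_roots hP hn,
    ← Multiset.map_congr rfl h2]
  congr 1
  simp only [eval_reflect_eq_prod hP hn, eval_reflect_eq_prod hQ hQn]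
  rw [Multiset.prod_map_prod_map]
  exact congrArg _ (Multiset.map_congr rfl fun w _ =>
    congrArg _ (Multiset.map_congr rfl fun z _ => by rw [mul_comm]))

lemma pairProd_szego (a : ℕ → ℝ) (n : ℕ) :
    pairProd ((szego a n).map Complex.ofRealHom).roots =
      ((∏ k ∈ range n, (1 - a k ^ 2) ^ (k + 1) : ℝ) : ℂ) := by
  induction n with
  | zero => simp [szego, pairProd]
  | succ n ih =>
    have h := szego_monic a n
    rw [szego_succ, szegoStep_map, pairProd_roots_szegoStep (h.1.map _)
      ((h.1.natDegree_map _).trans h.2), ih, prod_range_succ]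
    push_cast
    simp [mul_comm]

lemma roots_map_conj (p : ℝ[X]) :
    (p.map Complex.ofRealHom).roots.map (starRingEnd ℂ) = (p.map Complex.ofRealHom).roots := by
  have h := (IsAlgClosed.splits (p.map Complex.ofRealHom)).roots_map (starRingEnd ℂ)
  rw [Polynomial.map_map] at h
  have : (starRingEnd ℂ).comp Complex.ofRealHom = Complex.ofRealHom := by
    ext x; simp
  rw [this] at h
  exact h.symm

/-- All complex zeros lie in the open unit disk. -/
def ZerosInDisk (p : ℝ[X]) : Prop := ∀ z : ℂ, (p.map Complex.ofRealHom).eval z = 0 → ‖z‖ < 1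

/-- |z − w|² − |1 − z w̄|² = (|z|² − 1)(1 − |w|²). -/
lemma norm_one_sub_conj_mul_le {z w : ℂ} (hz : 1 ≤ ‖z‖) (hw : ‖w‖ < 1) :
    ‖1 - z * conj w‖ ≤ ‖z - w‖ := by
  rw [← sq_le_sq₀ (norm_nonneg _) (norm_nonneg _), ← Complex.normSq_eq_norm_sq,
    ← Complex.normSq_eq_norm_sq]
  have h1 : 1 ≤ ‖z‖ ^ 2 := one_le_pow₀ hz
  have h2 : ‖w‖ ^ 2 ≤ 1 := pow_le_one₀ (norm_nonneg _) hw.le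
  rw [← Complex.normSq_eq_norm_sq] at h1 h2
  simp only [Complex.normSq_apply, Complex.sub_re, Complex.sub_im, Complex.mul_re, Complex.mul_im,
    Complex.one_re, Complex.one_im, Complex.conj_re, Complex.conj_im] at *
  nlinarith [mul_nonneg (sub_nonneg.mpr h1) (sub_nonneg.mpr h2)]

lemma norm_eval_reflect_le {p : ℝ[X]} (hp : p.Monic) {n : ℕ} (hn : p.natDegree = n)
    (hd : ZerosInDisk p) {z : ℂ} (hz : 1 ≤ ‖z‖) :
    ‖(reflect n (p.map Complex.ofRealHom)).eval z‖ ≤ ‖(p.map Complex.ofRealHom).eval z‖ := by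
  have hP := hp.map Complex.ofRealHom
  rw [eval_reflect_eq_prod hP ((hp.natDegree_map _).trans hn), eval_eq_prod hP,
    ← roots_map_conj, Multiset.map_map, roots_map_conj]
  have hroots : ∀ w ∈ (p.map Complex.ofRealHom).roots, ‖w‖ < 1 := fun w hw =>
    hd w (mem_roots'.mp hw).2
  generalize (p.map Complex.ofRealHom).roots = s at hroots
  induction s using Multiset.induction_on with
  | empty => simp
  | cons w s ih =>
    rw [Multiset.map_cons, Multiset.prod_cons, Multiset.map_cons, Multiset.prod_cons, norm_mul,
      norm_mul]
    apply mul_le_mul (norm_one_sub_conj_mul_le hz (hroots w (by simp)))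
      (ih fun w hw => hroots w (by simp [hw])) (norm_nonneg _) (norm_nonneg _)

lemma eval_ne_zero_of_one_le {p : ℝ[X]} (hd : ZerosInDisk p) {z : ℂ} (hz : 1 ≤ ‖z‖) :
    (p.map Complex.ofRealHom).eval z ≠ 0 := fun h => (hd z h).not_ge hz

/-- A polynomial with all zeros in the disk satisfies |P*| ≤ |P| outside it, which excludes zP = γP*
there. Conversely, at a zero of P outside the disk, Q = zP − γP* has |Q| = |γ||P*| and |Q*| = |P*|,
contradicting |Q*| ≤ |Q| and Q ≠ 0. -/
lemma zerosInDisk_szegoStep_iff {p : ℝ[X]} (hp : p.Monic) {n : ℕ} (hn : p.natDegree = n) {γ : ℝ}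
    (hγ : |γ| < 1) : ZerosInDisk (szegoStep n γ p) ↔ ZerosInDisk p := by
  obtain ⟨hq, hqn⟩ := szegoStep_monic γ hp hn
  have hPn : (p.map Complex.ofRealHom).natDegree = n := (hp.natDegree_map _).trans hn
  have hγ' : ‖(γ : ℂ)‖ < 1 := by simpa using hγ
  have hmap : (szegoStep n γ p).map Complex.ofRealHom =
      szegoStep n (γ : ℂ) (p.map Complex.ofRealHom) := szegoStep_map _ _ _
  constructor
  · intro h z hz0
    by_contra! hz
    have h1 := norm_eval_reflect_le hq hqn h hz
    have h2 := eval_ne_zero_of_one_le h hz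
    rw [hmap] at h1 h2
    rw [reflect_szegoStep _ hPn.le] at h1
    simp only [szegoStep, eval_sub, eval_mul, eval_X, eval_C, hz0, mul_zero, sub_zero,
      zero_sub, norm_neg, norm_mul] at h1 h2
    have h3 : 0 < ‖(reflect n (p.map Complex.ofRealHom)).eval z‖ := by
      rw [norm_pos_iff]; intro h; simp [h] at h2
    nlinarith
  · intro h z hz0
    by_contra! hz
    have h1 := norm_eval_reflect_le hp hn h hz
    have h2 := norm_pos_iff.mpr (eval_ne_zero_of_one_le h hz)
    rw [hmap] at hz0
    simp only [szegoStep, eval_sub, eval_mul, eval_X, eval_C] at hz0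
    have h3 := congrArg norm (sub_eq_zero.mp hz0)
    rw [norm_mul, norm_mul] at h3
    have h4 := mul_le_mul_of_nonneg_left h1 (norm_nonneg (γ : ℂ))
    have h5 := mul_lt_mul_of_pos_right hγ' h2
    have h6 := mul_le_mul_of_nonneg_right hz h2.le
    linarith

/-- Up to sign the constant coefficient is the product of the zeros, and there is at least one. -/
lemma abs_coeff_zero_lt_one {p : ℝ[X]} (hp : p.Monic) (hn : p.natDegree ≠ 0) (hd : ZerosInDisk p) :
    |p.coeff 0| < 1 := by
  have hP := hp.map Complex.ofRealHom
  have h1 : ‖(p.map Complex.ofRealHom).eval 0‖ = |p.coeff 0| := by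
    rw [← coeff_zero_eq_eval_zero, coeff_map]; simp
  rw [← h1, eval_eq_prod hP]
  have hroots : ∀ w ∈ (p.map Complex.ofRealHom).roots, ‖w‖ < 1 := fun w hw =>
    hd w (mem_roots'.mp hw).2
  have hne : (p.map Complex.ofRealHom).roots ≠ 0 := by
    rw [← Multiset.card_pos, IsAlgClosed.card_roots_eq_natDegree, hp.natDegree_map]
    omega
  have hle : ∀ s : Multiset ℂ, (∀ w ∈ s, ‖w‖ < 1) →
      ‖(s.map fun w => 0 - w).prod‖ ≤ 1 := by
    intro s hs
    induction s using Multiset.induction_on with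
    | empty => simp
    | cons w s ih =>
      rw [Multiset.map_cons, Multiset.prod_cons, norm_mul, zero_sub, norm_neg]
      exact mul_le_one₀ (hs w (by simp)).le (norm_nonneg _) (ih fun w hw => hs w (by simp [hw]))
  generalize (p.map Complex.ofRealHom).roots = s at hroots hne
  obtain ⟨w, hw⟩ := Multiset.exists_mem_of_ne_zero hne
  obtain ⟨t, rfl⟩ := Multiset.exists_cons_of_mem hw
  · rw [Multiset.map_cons, Multiset.prod_cons, norm_mul, zero_sub, norm_neg]
    have h2 := hle t fun w hw => hroots w (by simp [hw])
    have h3 := hroots w (by simp)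
    nlinarith [norm_nonneg w, norm_nonneg (t.map fun w => 0 - w).prod]

end Szego

/-! ### The Jacobian of the map from zeros to coefficients -/

section RootCoordinates

open Polynomial Matrix

/-- The index set of `L` real points and `M` conjugate pairs. -/
abbrev RootIndex (L M : ℕ) : Type := Fin L ⊕ (Fin M ⊕ Fin M)

/-- The enumeration of the points used in `config`. -/
def rootIndexFun (n M : ℕ) (h : 2 * M ≤ n) : RootIndex (n - 2 * M) M → Fin n
  | .inl i => ⟨i, by omega⟩
  | .inr (.inl m) => ⟨n - 2 * M + 2 * m, by omega⟩
  | .inr (.inr m) => ⟨n - 2 * M + 2 * m + 1, by omega⟩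

lemma rootIndexFun_bijective (n M : ℕ) (h : 2 * M ≤ n) :
    Function.Bijective (rootIndexFun n M h) := by
  rw [Fintype.bijective_iff_injective_and_card]
  constructor
  · rintro (i | i | i) (j | j | j) hij <;>
      simp only [rootIndexFun, Sum.inl.injEq, Sum.inr.injEq, Fin.ext_iff,
        reduceCtorEq] at hij ⊢ <;> omega
  · simp; omega

/-- The enumeration of the points used in `config`, as an equivalence. -/
def rootIndexEquiv (n M : ℕ) (h : 2 * M ≤ n) : RootIndex (n - 2 * M) M ≃ Fin n :=
  Equiv.ofBijective _ (rootIndexFun_bijective n M h)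

/-- Reads off parameters from a vector. -/
def pack (n M : ℕ) (h : 2 * M ≤ n) (y : Fin n → ℝ) : Params (n - 2 * M) M :=
  (fun i => y (rootIndexEquiv n M h (.inl i)), fun i => y (rootIndexEquiv n M h (.inr (.inl i))),
    fun i => y (rootIndexEquiv n M h (.inr (.inr i))))

lemma measurePreserving_pack (n M : ℕ) (h : 2 * M ≤ n) :
    MeasurePreserving (pack n M h) := by
  have h1 := volume_preserving_arrowCongr' (rootIndexEquiv n M h).symm
    (MeasurableEquiv.refl ℝ) (MeasurePreserving.id _)
  have h2 := volume_measurePreserving_sumPiEquivProdPi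
    (fun _ : RootIndex (n - 2 * M) M => ℝ)
  have h3 := volume_measurePreserving_sumPiEquivProdPi (fun _ : Fin M ⊕ Fin M => ℝ)
  have h4 := (((MeasurePreserving.id (volume : Measure (Fin (n - 2 * M) → ℝ))).prod h3).comp
    h2).comp h1
  exact h4

/-- The matrix that sends `(x, u, v)` to `(x, u + i v, u - i v)`. -/
def rootMatrix (L M : ℕ) : Matrix (RootIndex L M) (RootIndex L M) ℂ :=
  fromBlocks 1 0 0 (fromBlocks 1 (Complex.I • 1) 1 (-Complex.I • 1))

lemma norm_det_rootMatrix (L M : ℕ) : ‖(rootMatrix L M).det‖ = 2 ^ M := by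
  rw [rootMatrix, det_fromBlocks_zero₁₂, det_one, one_mul, det_fromBlocks_one₁₁, one_mul,
    ← sub_smul, det_smul, det_one, mul_one, norm_pow, Fintype.card_fin]
  congr 1
  rw [show -Complex.I - Complex.I = -(2 * Complex.I) by ring, norm_neg, norm_mul]
  simp

/-- The points of the configuration with real coordinates `y`. -/
def rootVec (n M : ℕ) (h : 2 * M ≤ n) (y : Fin n → ℝ) (j : Fin n) : ℂ :=
  (reindex (rootIndexEquiv n M h) (rootIndexEquiv n M h) (rootMatrix (n - 2 * M) M) *ᵥ
    fun k => (y k : ℂ)) j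

section

variable {n M : ℕ} (h : 2 * M ≤ n) (y : Fin n → ℝ)

lemma rootVec_equiv (i : RootIndex (n - 2 * M) M) :
    rootVec n M h y (rootIndexEquiv n M h i) =
      ∑ k, rootMatrix (n - 2 * M) M i k * (y (rootIndexEquiv n M h k) : ℂ) := by
  rw [rootVec, mulVec, dotProduct, ← Equiv.sum_comp (rootIndexEquiv n M h)]
  simp

lemma rootVec_inl (i : Fin (n - 2 * M)) :
    rootVec n M h y (rootIndexEquiv n M h (.inl i)) = ((pack n M h y).1 i : ℂ) := by
  rw [rootVec_equiv, Fintype.sum_sum_type, Fintype.sum_sum_type]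
  simp [rootMatrix, Matrix.one_apply, pack]

lemma rootVec_inr_inl (i : Fin M) :
    rootVec n M h y (rootIndexEquiv n M h (.inr (.inl i))) =
      ⟨(pack n M h y).2.1 i, (pack n M h y).2.2 i⟩ := by
  rw [rootVec_equiv, Fintype.sum_sum_type, Fintype.sum_sum_type]
  apply Complex.ext <;> simp [rootMatrix, Matrix.one_apply, pack]

lemma rootVec_inr_inr (i : Fin M) :
    rootVec n M h y (rootIndexEquiv n M h (.inr (.inr i))) =
      ⟨(pack n M h y).2.1 i, -(pack n M h y).2.2 i⟩ := by
  rw [rootVec_equiv, Fintype.sum_sum_type, Fintype.sum_sum_type]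
  apply Complex.ext <;> simp [rootMatrix, Matrix.one_apply, pack]

lemma config_pack : config n M (pack n M h y) = rootVec n M h y := by
  ext j
  obtain ⟨i, rfl⟩ := (rootIndexEquiv n M h).surjective j
  rcases i with i | i | i
  · rw [rootVec_inl, config, dif_pos (by exact i.2)]
    rfl
  · rw [rootVec_inr_inl]
    have h1 : ((rootIndexEquiv n M h (.inr (.inl i))) : ℕ) = n - 2 * M + 2 * i := rfl
    have h2 : (n - 2 * M + 2 * (i : ℕ) - (n - 2 * M)) / 2 = i := by omega
    have h3 : (n - 2 * M + 2 * (i : ℕ) - (n - 2 * M)) % 2 = 0 := by omega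
    simp only [config, h1, h2, h3]
    rw [dif_neg (by omega)]
    simp
  · rw [rootVec_inr_inr]
    have h1 : ((rootIndexEquiv n M h (.inr (.inr i))) : ℕ) = n - 2 * M + 2 * i + 1 := rfl
    have h2 : (n - 2 * M + 2 * (i : ℕ) + 1 - (n - 2 * M)) / 2 = i := by omega
    have h3 : (n - 2 * M + 2 * (i : ℕ) + 1 - (n - 2 * M)) % 2 = 1 := by omega
    simp only [config, h1, h2, h3]
    rw [dif_neg (by omega)]
    simp

/-- The monic polynomial with the given configuration of zeros. -/
def rootPoly (n M : ℕ) (h : 2 * M ≤ n) (y : Fin n → ℝ) : ℂ[X] :=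
  ∏ j, (X - C (rootVec n M h y j))

/-- The same polynomial with real coefficients. -/
def realRootPoly (n M : ℕ) (h : 2 * M ≤ n) (y : Fin n → ℝ) : ℝ[X] :=
  (∏ i, (X - C ((pack n M h y).1 i))) *
    ∏ i, ((X - C ((pack n M h y).2.1 i)) ^ 2 + C ((pack n M h y).2.2 i ^ 2))

lemma map_realRootPoly :
    (realRootPoly n M h y).map Complex.ofRealHom = rootPoly n M h y := by
  rw [rootPoly, ← Equiv.prod_comp (rootIndexEquiv n M h), Fintype.prod_sum_type,
    Fintype.prod_sum_type, ← prod_mul_distrib]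
  simp only [rootVec_inl, rootVec_inr_inl, rootVec_inr_inr, realRootPoly, Polynomial.map_mul,
    Polynomial.map_prod, Polynomial.map_sub, Polynomial.map_add, Polynomial.map_pow, map_X, map_C]
  congr 1
  apply prod_congr rfl
  intro i _
  have hz : ∀ u v : ℝ, (⟨u, v⟩ : ℂ) = (u : ℂ) + v * Complex.I := fun u v => by
    apply Complex.ext <;> simp
  have hI : (C Complex.I : ℂ[X]) ^ 2 = -1 := by rw [← C_pow, Complex.I_sq]; simp
  rw [hz, hz]
  simp only [Complex.ofRealHom_eq_coe, Complex.ofReal_pow, Complex.ofReal_neg, C_add, C_mul, C_pow,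
    C_neg]
  linear_combination (C ((pack n M h y).2.2 i : ℂ)) ^ 2 * hI

lemma rootPoly_monic : (rootPoly n M h y).Monic := monic_prod_of_monic _ _ fun _ _ => monic_X_sub_C _

lemma rootPoly_natDegree : (rootPoly n M h y).natDegree = n := by
  rw [rootPoly, natDegree_prod_of_monic _ _ fun _ _ => monic_X_sub_C _]
  simp

lemma realRootPoly_monic : (realRootPoly n M h y).Monic := by
  have := rootPoly_monic h y
  rw [← map_realRootPoly] at this
  exact Polynomial.monic_of_injective Complex.ofRealHom.injective this

lemma realRootPoly_natDegree : (realRootPoly n M h y).natDegree = n := by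
  have := rootPoly_natDegree h y
  rwa [← map_realRootPoly, natDegree_map] at this

lemma rootPoly_roots : (rootPoly n M h y).roots = univ.val.map (rootVec n M h y) := by
  rw [← roots_multiset_prod_X_sub_C (univ.val.map (rootVec n M h y)), Multiset.map_map]
  rfl

/-- The coefficients below the leading one. -/
def coeffVec (n : ℕ) (p : ℝ[X]) : Fin n → ℝ := fun i => p.coeff i

/-- From real coordinates of the zeros to coefficients. -/
def rootMap (n M : ℕ) (h : 2 * M ≤ n) (y : Fin n → ℝ) : Fin n → ℝ :=
  coeffVec n (realRootPoly n M h y)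

lemma rootMap_coe (k : Fin n) : ((rootMap n M h y k : ℝ) : ℂ) = (rootPoly n M h y).coeff k := by
  rw [← map_realRootPoly, coeff_map]; rfl

end

lemma differentiable_coeff_prod {E ι : Type*} [NormedAddCommGroup E] [NormedSpace ℝ E]
    (s : Finset ι) (f : ι → E → ℂ) (hf : ∀ i ∈ s, Differentiable ℝ (f i)) (k : ℕ) :
    Differentiable ℝ fun y => (∏ i ∈ s, (X - C (f i y))).coeff k := by
  classical
  induction s using Finset.induction_on generalizing k with
  | empty => simp
  | insert i s hi ih =>
    have ih' := ih fun j hj => hf j (mem_insert_of_mem hj)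
    have hfi := hf i (mem_insert_self _ _)
    simp only [prod_insert hi, sub_mul, coeff_sub, coeff_C_mul]
    rcases k with _ | k
    · simp only [coeff_X_mul_zero]
      exact (differentiable_const _).sub (hfi.mul (ih' 0))
    · simp only [coeff_X_mul]
      exact (ih' k).sub (hfi.mul (ih' _))

variable {n M : ℕ} (h : 2 * M ≤ n)

lemma differentiable_rootVec (j : Fin n) : Differentiable ℝ fun y => rootVec n M h y j := by
  simp only [rootVec, mulVec, dotProduct]
  refine Differentiable.fun_sum fun k _ => Differentiable.const_mul ?_ _
  exact Complex.ofRealCLM.differentiable.comp (differentiable_apply k)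

lemma differentiable_rootMap : Differentiable ℝ (rootMap n M h) := by
  rw [differentiable_pi]
  intro k
  have h1 : (fun y => rootMap n M h y k) = fun y => Complex.reCLM ((rootPoly n M h y).coeff k) := by
    ext y
    rw [← rootMap_coe]; simp
  rw [h1]
  exact Complex.reCLM.differentiable.comp
    (differentiable_coeff_prod univ _ (fun j _ => differentiable_rootVec h j) k)

lemma eval_rootPoly_eq_sum (y : Fin n → ℝ) (ζ : ℂ) :
    (rootPoly n M h y).eval ζ = ζ ^ n + ∑ k : Fin n, (rootMap n M h y k : ℂ) * ζ ^ (k : ℕ) := by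
  have hd := rootPoly_natDegree h y
  have hm := rootPoly_monic h y
  rw [eval_eq_sum_range, hd, sum_range_succ]
  have : (rootPoly n M h y).coeff n = 1 := by
    have := hm.coeff_natDegree
    rwa [hd] at this
  rw [this, one_mul, add_comm, sum_range]
  simp only [rootMap_coe]

/-- The Jacobian matrix of `rootMap`. -/
def rootJac (n M : ℕ) (h : 2 * M ≤ n) (y : Fin n → ℝ) : Matrix (Fin n) (Fin n) ℝ :=
  LinearMap.toMatrix' (fderiv ℝ (rootMap n M h) y : (Fin n → ℝ) →ₗ[ℝ] (Fin n → ℝ))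

lemma hasDerivAt_line_rootVec (y d : Fin n → ℝ) (j : Fin n) :
    HasDerivAt (fun t : ℝ => rootVec n M h (y + t • d) j) (rootVec n M h d j) 0 := by
  have h1 : (fun t : ℝ => rootVec n M h (y + t • d) j) =
      fun t : ℝ => rootVec n M h y j + (t : ℂ) * rootVec n M h d j := by
    ext t
    simp only [rootVec, mulVec, dotProduct, mul_sum, ← sum_add_distrib]
    refine sum_congr rfl fun k _ => ?_
    simp; ring
  rw [h1]
  have h2 : HasDerivAt (fun t : ℝ => (t : ℂ)) 1 0 := Complex.ofRealCLM.hasDerivAt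
  simpa using (h2.mul_const (rootVec n M h d j)).const_add (rootVec n M h y j)

/-- The polynomial at y + td, evaluated at the fixed point ζ = z_j, is differentiated in t in two
ways. Through the coefficients this gives a row of the Vandermonde matrix times the Jacobian.
Through the linear factors only the j-th term survives, since that factor vanishes at t = 0. -/
lemma vandermonde_mul_deriv (y d : Fin n → ℝ) (j : Fin n) :
    ∑ k : Fin n, rootVec n M h y j ^ (k : ℕ) * ((fderiv ℝ (rootMap n M h) y d k : ℝ) : ℂ) =
      -(∏ i ∈ univ.erase j, (rootVec n M h y j - rootVec n M h y i)) * rootVec n M h d j := by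
  set ζ := rootVec n M h y j with hζ
  have hline : HasDerivAt (fun t : ℝ => y + t • d) d 0 := by
    simpa using ((hasDerivAt_id (0 : ℝ)).smul_const d).const_add y
  have hF : HasDerivAt (fun t : ℝ => rootMap n M h (y + t • d)) (fderiv ℝ (rootMap n M h) y d) 0 := by
    have h1 := (differentiable_rootMap h y).hasFDerivAt
    have h2 : HasFDerivAt (rootMap n M h) (fderiv ℝ (rootMap n M h) y) (y + (0 : ℝ) • d) := by
      simpa using h1
    exact h2.comp_hasDerivAt (0 : ℝ) hline
  have hL : HasDerivAt (fun t : ℝ => (rootPoly n M h (y + t • d)).eval ζ)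
      (∑ k : Fin n, ζ ^ (k : ℕ) * ((fderiv ℝ (rootMap n M h) y d k : ℝ) : ℂ)) 0 := by
    simp only [eval_rootPoly_eq_sum]
    refine HasDerivAt.const_add _ (HasDerivAt.fun_sum fun k _ => ?_)
    have h3 := (hasDerivAt_pi.mp hF k).ofReal_comp
    rw [mul_comm]
    exact h3.mul_const _
  have hR : HasDerivAt (fun t : ℝ => (rootPoly n M h (y + t • d)).eval ζ)
      (∑ l, (∏ i ∈ univ.erase l, (ζ - rootVec n M h (y + (0 : ℝ) • d) i)) • -(rootVec n M h d l))
      0 := by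
    simp only [rootPoly, eval_prod, eval_sub, eval_X, eval_C]
    exact HasDerivAt.fun_finsetProd fun l _ => (hasDerivAt_line_rootVec h y d l).const_sub ζ
  rw [hL.unique hR, sum_eq_single_of_mem j (mem_univ _)]
  · simp
  · intro l _ hl
    rw [prod_eq_zero (i := j) (mem_erase.mpr ⟨hl.symm, mem_univ _⟩), zero_smul]
    simp [hζ]

lemma prod_erase_sub_norm (z : Fin n → ℂ) :
    ∏ j, ‖∏ i ∈ univ.erase j, (z j - z i)‖ = ‖(vandermonde z).det‖ ^ 2 := by
  have h1 : ∀ j : Fin n, ∏ i ∈ univ.erase j, ‖z j - z i‖ =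
      (∏ i ∈ Iio j, ‖z j - z i‖) * ∏ i ∈ Ioi j, ‖z i - z j‖ := by
    intro j
    have hd : Disjoint (Iio j) (Ioi j) := by
      rw [disjoint_left]; intro i hi hi'
      exact lt_asymm (mem_Iio.mp hi) (mem_Ioi.mp hi')
    have hu : univ.erase j = Iio j ∪ Ioi j := by
      ext i; simp
    rw [hu, prod_union hd]
    congr 1
    exact prod_congr rfl fun i _ => norm_sub_rev _ _
  have h2 : ∏ j, ∏ i ∈ Iio j, ‖z j - z i‖ = ∏ i, ∏ j ∈ Ioi i, ‖z j - z i‖ := by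
    apply prod_comm'
    simp
  simp only [norm_prod, h1]
  rw [prod_mul_distrib, h2, det_vandermonde, sq]
  simp only [norm_prod]

/-- With V the Vandermonde matrix and J the Jacobian, VJ is a diagonal matrix with entries
−∏_{i≠j}(z_j − z_i) times `rootMatrix`. These two have determinants of modulus |det V|² and 2^M, and
one factor |det V| cancels because the zeros are distinct. -/
lemma abs_det_rootMap (y : Fin n → ℝ) (hy : Function.Injective (rootVec n M h y)) :
    |(fderiv ℝ (rootMap n M h) y).det| =
      2 ^ M * ∏ j, ∏ k ∈ Ioi j, ‖rootVec n M h y k - rootVec n M h y j‖ := by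
  have h1 : (vandermonde (rootVec n M h y)) * (rootJac n M h y).map Complex.ofRealHom =
      diagonal (fun j => -(∏ i ∈ univ.erase j, (rootVec n M h y j - rootVec n M h y i))) *
      reindex (rootIndexEquiv n M h) (rootIndexEquiv n M h) (rootMatrix (n - 2 * M) M) := by
    ext j l
    have := vandermonde_mul_deriv h y (Pi.single l 1) j
    rw [Matrix.mul_apply, diagonal_mul]
    convert this using 1
    · refine sum_congr rfl fun k _ => ?_
      simp [vandermonde_apply, rootJac, LinearMap.toMatrix'_apply]
    · congr 1
      rw [rootVec, mulVec, dotProduct, sum_eq_single_of_mem l (mem_univ _)]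
      · simp
      · intro k _ hk; simp [hk]
  have h2 := congrArg (fun A => ‖Matrix.det A‖) h1
  simp only [det_mul, det_diagonal, norm_mul, norm_prod, norm_neg, det_reindex_self,
    norm_det_rootMatrix] at h2
  simp only [← norm_prod (univ.erase _)] at h2
  rw [prod_erase_sub_norm, show (rootJac n M h y).map Complex.ofRealHom = Complex.ofRealHom.mapMatrix (rootJac n M h y)
    from rfl, ← RingHom.map_det] at h2
  have h3 : (fderiv ℝ (rootMap n M h) y).det = (rootJac n M h y).det := by
    rw [rootJac, LinearMap.det_toMatrix']
  have hV : ‖(vandermonde (rootVec n M h y)).det‖ ≠ 0 := by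
    rw [norm_ne_zero_iff]; exact det_vandermonde_ne_zero_iff.mpr hy
  have h4 : ‖(vandermonde (rootVec n M h y)).det‖ =
      ∏ j, ∏ k ∈ Ioi j, ‖rootVec n M h y k - rootVec n M h y j‖ := by
    rw [det_vandermonde]; simp only [norm_prod]
  rw [h3, ← h4]
  have h5 : ‖Complex.ofRealHom (rootJac n M h y).det‖ = |(rootJac n M h y).det| := by simp
  rw [h5] at h2
  have h6 : ‖(vandermonde (rootVec n M h y)).det‖ *
      (|(rootJac n M h y).det| - 2 ^ M * ‖(vandermonde (rootVec n M h y)).det‖) = 0 := by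
    rw [mul_sub, h2]; ring
  rcases mul_eq_zero.mp h6 with h7 | h7
  · exact absurd h7 hV
  · linarith

end RootCoordinates

/-! ### Decomposition of the coefficient space by the number of real zeros -/

section RootSets

open Polynomial

/-- The monic polynomial with given lower coefficients. -/
def monicPoly {n : ℕ} (c : Fin n → ℝ) : ℝ[X] := X ^ n + ∑ i, C (c i) * X ^ (i : ℕ)

lemma degree_sum_C_mul_X_pow_lt {n : ℕ} (c : Fin n → ℝ) :
    (∑ i, C (c i) * X ^ (i : ℕ) : ℝ[X]).degree < n := by
  refine (degree_sum_le _ _).trans_lt ?_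
  refine (Finset.sup_lt_iff (WithBot.bot_lt_coe n)).mpr fun i _ => ?_
  exact (degree_C_mul_X_pow_le _ _).trans_lt (WithBot.coe_lt_coe.mpr (by simp))

lemma monicPoly_monic {n : ℕ} (c : Fin n → ℝ) : (monicPoly c).Monic :=
  monic_X_pow_add (degree_sum_C_mul_X_pow_lt c)

lemma monicPoly_natDegree {n : ℕ} (c : Fin n → ℝ) : (monicPoly c).natDegree = n := by
  apply natDegree_eq_of_degree_eq_some
  rw [monicPoly, degree_add_eq_left_of_degree_lt, degree_X_pow]
  rw [degree_X_pow]
  exact degree_sum_C_mul_X_pow_lt c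

lemma coeffVec_monicPoly {n : ℕ} (c : Fin n → ℝ) : coeffVec n (monicPoly c) = c := by
  ext k
  have hk : (k : ℕ) ≠ n := k.2.ne
  simp only [coeffVec, monicPoly, coeff_add, coeff_X_pow, hk, if_false, zero_add, finsetSum_coeff,
    coeff_C_mul]
  rw [sum_eq_single_of_mem k (mem_univ _)]
  · simp
  · intro i _ hi
    rw [if_neg (fun h => hi (Fin.ext h.symm)), mul_zero]

lemma monicPoly_coeffVec {n : ℕ} {p : ℝ[X]} (hp : p.Monic) (hn : p.natDegree = n) :
    monicPoly (coeffVec n p) = p := by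
  conv_rhs => rw [hp.as_sum, hn, sum_range]
  rfl

lemma card_roots_monicPoly {n : ℕ} (c : Fin n → ℝ) :
    Multiset.card ((monicPoly c).map Complex.ofRealHom).roots = n := by
  rw [IsAlgClosed.card_roots_eq_natDegree, (monicPoly_monic c).natDegree_map,
    monicPoly_natDegree]

/-- The complex zeros of a real monic polynomial, given by its coefficients. -/
def rootsSym {n : ℕ} (c : Fin n → ℝ) : Sym ℂ n :=
  ⟨((monicPoly c).map Complex.ofRealHom).roots, card_roots_monicPoly c⟩

lemma eigenvalues_eq_rootsSym {n : ℕ} (A : Matrix (Fin n) (Fin n) ℂ) {p : ℝ[X]} (hp : p.Monic)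
    (hn : p.natDegree = n) (h : A.charpoly = p.map Complex.ofRealHom) :
    eigenvalues A = rootsSym (coeffVec n p) := by
  apply Subtype.ext
  simp only [eigenvalues, rootsSym, h, monicPoly_coeffVec hp hn]

/-- Coefficients of the monic polynomials with all zeros in the open unit disk. -/
def diskSet (n : ℕ) : Set (Fin n → ℝ) := {c | ZerosInDisk (monicPoly c)}

/-- Coordinates of generic configurations. -/
def regSet (n M : ℕ) (h : 2 * M ≤ n) : Set (Fin n → ℝ) := pack n M h ⁻¹' paramSet (n - 2 * M) M

section

variable {n M : ℕ} (h : 2 * M ≤ n)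

lemma monicPoly_rootMap (y : Fin n → ℝ) : monicPoly (rootMap n M h y) = realRootPoly n M h y :=
  monicPoly_coeffVec (realRootPoly_monic h y) (realRootPoly_natDegree h y)

lemma rootsSym_rootMap (y : Fin n → ℝ) :
    rootsSym (rootMap n M h y) = unordered (rootVec n M h y) := by
  apply Subtype.ext
  simp only [rootsSym, monicPoly_rootMap, map_realRootPoly, rootPoly_roots, unordered]

lemma range_rootVec_eq {M' : ℕ} (h' : 2 * M' ≤ n) {y y' : Fin n → ℝ}
    (he : rootMap n M h y = rootMap n M' h' y') :
    Set.range (rootVec n M h y) = Set.range (rootVec n M' h' y') := by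
  have h1 : (univ.val.map (rootVec n M h y)) = univ.val.map (rootVec n M' h' y') := by
    rw [← rootPoly_roots, ← rootPoly_roots, ← map_realRootPoly, ← map_realRootPoly,
      ← monicPoly_rootMap, ← monicPoly_rootMap, he]
  ext z
  have h2 : z ∈ (univ.val.map (rootVec n M h y)) ↔ z ∈ univ.val.map (rootVec n M' h' y') := by
    rw [h1]
  simpa using h2

lemma exists_rootVec_iff (y : Fin n → ℝ) (P : ℂ → Prop) :
    (∃ j, P (rootVec n M h y j)) ↔ (∃ i, P ((pack n M h y).1 i : ℝ)) ∨
      (∃ i, P ⟨(pack n M h y).2.1 i, (pack n M h y).2.2 i⟩) ∨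
      ∃ i, P ⟨(pack n M h y).2.1 i, -(pack n M h y).2.2 i⟩ := by
  rw [← (rootIndexEquiv n M h).exists_congr_right, Sum.exists, Sum.exists]
  simp only [rootVec_inl, rootVec_inr_inl, rootVec_inr_inr]

lemma forall_rootVec_iff (y : Fin n → ℝ) (P : ℂ → Prop) :
    (∀ j, P (rootVec n M h y j)) ↔ (∀ i, P ((pack n M h y).1 i : ℝ)) ∧
      (∀ i, P ⟨(pack n M h y).2.1 i, (pack n M h y).2.2 i⟩) ∧
      ∀ i, P ⟨(pack n M h y).2.1 i, -(pack n M h y).2.2 i⟩ := by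
  rw [← (rootIndexEquiv n M h).forall_congr_right, Sum.forall, Sum.forall]
  simp only [rootVec_inl, rootVec_inr_inl, rootVec_inr_inr]

variable {h}

lemma range_real {y : Fin n → ℝ} (hy : y ∈ regSet n M h) :
    {r : ℝ | (r : ℂ) ∈ Set.range (rootVec n M h y)} = Set.range (pack n M h y).1 := by
  obtain ⟨-, -, -, hv, -⟩ := hy
  ext r
  simp only [Set.mem_range, Set.mem_ofPred_eq]
  rw [exists_rootVec_iff h y fun z => z = (r : ℂ)]
  constructor
  · rintro (⟨i, hi⟩ | ⟨i, hi⟩ | ⟨i, hi⟩)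
    · exact ⟨i, by exact_mod_cast hi⟩
    · have := congrArg Complex.im hi
      exact absurd this (hv i).ne'
    · have := congrArg Complex.im hi
      exact absurd (neg_eq_zero.mp this) (hv i).ne'
  · rintro ⟨i, hi⟩
    exact Or.inl ⟨i, by exact_mod_cast hi⟩

lemma range_upper {y : Fin n → ℝ} (hy : y ∈ regSet n M h) :
    {z : ℂ | z ∈ Set.range (rootVec n M h y) ∧ 0 < z.im} =
      Set.range fun i => (⟨(pack n M h y).2.1 i, (pack n M h y).2.2 i⟩ : ℂ) := by
  obtain ⟨-, -, -, hv, -⟩ := hy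
  ext z
  simp only [Set.mem_range, Set.mem_ofPred_eq]
  rw [exists_rootVec_iff h y fun w => w = z]
  constructor
  · rintro ⟨⟨i, hi⟩ | ⟨i, hi⟩ | ⟨i, hi⟩, hz⟩
    · rw [← hi] at hz; simp at hz
    · exact ⟨i, hi⟩
    · rw [← hi] at hz
      have := hv i
      simp at hz; linarith
  · rintro ⟨i, hi⟩
    exact ⟨Or.inr (Or.inl ⟨i, hi⟩), by rw [← hi]; exact hv i⟩

lemma pack_injective : Function.Injective (pack n M h) := by
  intro y y' he
  ext j
  obtain ⟨i, rfl⟩ := (rootIndexEquiv n M h).surjective j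
  simp only [pack, Prod.mk.injEq] at he
  rcases i with i | i | i
  · exact congrFun he.1 i
  · exact congrFun he.2.1 i
  · exact congrFun he.2.2 i

lemma continuous_pack : Continuous (pack n M h) := by
  unfold pack
  fun_prop

lemma upper_injective {y : Fin n → ℝ} (hy : y ∈ regSet n M h) :
    Function.Injective fun i => (⟨(pack n M h y).2.1 i, (pack n M h y).2.2 i⟩ : ℂ) := by
  intro i j hij
  exact hy.2.2.1.injective (congrArg Complex.re hij)

/-- The real zeros and the zeros in the upper half-plane are determined by the polynomial, and the
strict orderings fix their numbering. -/
lemma rootMap_injOn : Set.InjOn (rootMap n M h) (regSet n M h) := by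
  intro y hy y' hy' he
  have hr := range_rootVec_eq h h he
  have h1 : (pack n M h y).1 = (pack n M h y').1 :=
    (hy.2.1.range_inj hy'.2.1).mp (by rw [← range_real hy, ← range_real hy', hr])
  have h2 := range_upper hy
  rw [hr, range_upper hy'] at h2
  have h3 : (pack n M h y).2.1 = (pack n M h y').2.1 := by
    apply (hy.2.2.1.range_inj hy'.2.2.1).mp
    have := congrArg (fun s => Complex.re '' s) h2
    simp only [← Set.range_comp, Function.comp_def] at this
    exact this.symm
  have h4 : (pack n M h y).2.2 = (pack n M h y').2.2 := by
    ext i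
    have : (⟨(pack n M h y).2.1 i, (pack n M h y).2.2 i⟩ : ℂ) ∈
        Set.range fun i => (⟨(pack n M h y').2.1 i, (pack n M h y').2.2 i⟩ : ℂ) := by
      rw [h2]; exact ⟨i, rfl⟩
    obtain ⟨j, hj⟩ := this
    have hre := congrArg Complex.re hj
    have him := congrArg Complex.im hj
    simp only at hre him
    rw [← h3] at hre
    rw [hy.2.2.1.injective hre] at him
    exact him.symm
  exact pack_injective (Prod.ext h1 (Prod.ext h3 h4))

/-- M is the number of zeros in the upper half-plane. -/
lemma rootMap_image_disjoint {M' : ℕ} {h' : 2 * M' ≤ n} (hM : M ≠ M') :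
    Disjoint (rootMap n M h '' regSet n M h) (rootMap n M' h' '' regSet n M' h') := by
  rw [Set.disjoint_left]
  rintro c ⟨y, hy, rfl⟩ ⟨y', hy', he⟩
  have h2 := range_upper hy
  rw [range_rootVec_eq h h' he.symm, range_upper hy'] at h2
  have h3 := congrArg Nat.card (congrArg Set.Elem h2)
  have e1 := Nat.card_range_of_injective (upper_injective hy)
  have e2 := Nat.card_range_of_injective (upper_injective hy')
  rw [e1, e2] at h3
  simp at h3
  exact hM h3.symm

lemma rootVec_injective {y : Fin n → ℝ} (hy : y ∈ regSet n M h) :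
    Function.Injective (rootVec n M h y) := by
  obtain ⟨-, hx, hu, hv, -⟩ := hy
  have : Function.Injective (rootVec n M h y ∘ rootIndexEquiv n M h) := by
    rintro (i | i | i) (j | j | j) hij <;>
      simp only [Function.comp_apply, rootVec_inl, rootVec_inr_inl, rootVec_inr_inr] at hij <;>
      have hre := congrArg Complex.re hij <;> have him := congrArg Complex.im hij <;>
      simp only [Complex.ofReal_re, Complex.ofReal_im] at hre him
    · rw [hx.injective hre]
    · have := hv j; linarith
    · have := hv j; linarith
    · have := hv i; linarith
    · rw [hu.injective hre]
    · have := hv i; have := hv j; linarith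
    · have := hv i; linarith
    · have := hv i; have := hv j; linarith
    · rw [hu.injective hre]
  intro i j hij
  obtain ⟨i, rfl⟩ := (rootIndexEquiv n M h).surjective i
  obtain ⟨j, rfl⟩ := (rootIndexEquiv n M h).surjective j
  rw [this hij]

lemma norm_mk_lt_one_iff (u v : ℝ) : ‖(⟨u, v⟩ : ℂ)‖ < 1 ↔ u ^ 2 + v ^ 2 < 1 := by
  rw [← sq_lt_one_iff₀ (norm_nonneg _), ← Complex.normSq_eq_norm_sq, Complex.normSq_mk, ← sq, ← sq]

lemma zerosInDisk_realRootPoly_iff {y : Fin n → ℝ} :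
    ZerosInDisk (realRootPoly n M h y) ↔ (∀ i, |(pack n M h y).1 i| < 1) ∧
      ∀ i, (pack n M h y).2.1 i ^ 2 + (pack n M h y).2.2 i ^ 2 < 1 := by
  have h1 : ZerosInDisk (realRootPoly n M h y) ↔ ∀ j, ‖rootVec n M h y j‖ < 1 := by
    rw [ZerosInDisk, map_realRootPoly]
    constructor
    · intro hz j
      apply hz
      rw [rootPoly, eval_prod]
      exact prod_eq_zero (mem_univ j) (by simp)
    · intro hz z hz0
      rw [rootPoly, eval_prod, prod_eq_zero_iff] at hz0
      obtain ⟨j, -, hj⟩ := hz0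
      simp only [eval_sub, eval_X, eval_C, sub_eq_zero] at hj
      rw [hj]; exact hz j
  rw [h1, forall_rootVec_iff h y fun z => ‖z‖ < 1]
  simp only [norm_mk_lt_one_iff, Complex.norm_real, Real.norm_eq_abs, neg_sq, and_self]

lemma rootMap_image_subset : rootMap n M h '' regSet n M h ⊆ diskSet n := by
  rintro c ⟨y, hy, rfl⟩
  rw [diskSet, Set.mem_ofPred_eq, monicPoly_rootMap, zerosInDisk_realRootPoly_iff]
  exact ⟨fun i => abs_lt.mpr (hy.1 i), hy.2.2.2.2⟩

lemma measurableSet_paramSet (L M : ℕ) : MeasurableSet (paramSet L M) := by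
  have : paramSet L M = {p | ∀ i, -1 < p.1 i ∧ p.1 i < 1} ∩ ({p | ∀ i j, i < j → p.1 i < p.1 j} ∩
      ({p | ∀ i j, i < j → p.2.1 i < p.2.1 j} ∩ ({p | ∀ i, 0 < p.2.2 i} ∩
      {p | ∀ i, p.2.1 i ^ 2 + p.2.2 i ^ 2 < 1}))) := by
    ext p; rfl
  rw [this]
  simp only [Set.ofPred_forall, Set.ofPred_and]
  refine MeasurableSet.inter ?_ (MeasurableSet.inter ?_ (MeasurableSet.inter ?_
    (MeasurableSet.inter ?_ ?_)))
  · exact MeasurableSet.iInter fun i => (measurableSet_lt (by fun_prop) (by fun_prop)).inter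
      (measurableSet_lt (by fun_prop) (by fun_prop))
  · exact MeasurableSet.iInter fun i => MeasurableSet.iInter fun j => MeasurableSet.iInter fun _ =>
      measurableSet_lt (by fun_prop) (by fun_prop)
  · exact MeasurableSet.iInter fun i => MeasurableSet.iInter fun j => MeasurableSet.iInter fun _ =>
      measurableSet_lt (by fun_prop) (by fun_prop)
  · exact MeasurableSet.iInter fun i => measurableSet_lt (by fun_prop) (by fun_prop)
  · exact MeasurableSet.iInter fun i => measurableSet_lt (by fun_prop) (by fun_prop)

lemma measurableSet_regSet : MeasurableSet (regSet n M h) :=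
  (measurePreserving_pack n M h).measurable (measurableSet_paramSet _ _)

lemma measurableSet_rootMap_image : MeasurableSet (rootMap n M h '' regSet n M h) :=
  measurableSet_regSet.image_of_continuousOn_injOn (differentiable_rootMap h).continuous.continuousOn
    rootMap_injOn

end

lemma exists_fin_map_eq {α : Type*} {k : ℕ} (s : Multiset α) (hs : Multiset.card s = k) :
    ∃ f : Fin k → α, univ.val.map f = s := by
  obtain ⟨l, rfl⟩ : ∃ l : List α, (l : Multiset α) = s := ⟨s.toList, s.coe_toList⟩
  obtain rfl : l.length = k := hs
  exact ⟨l.get, by rw [Fin.univ_val_map, List.ofFn_get]⟩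

lemma exists_monotone_fin_map_eq {α : Type*} {k : ℕ} (s : Multiset α) (hs : Multiset.card s = k)
    (g : α → ℝ) : ∃ f : Fin k → α, univ.val.map f = s ∧ Monotone (g ∘ f) := by
  obtain ⟨f, hf⟩ := exists_fin_map_eq s hs
  refine ⟨f ∘ Tuple.sort (g ∘ f), ?_, Tuple.monotone_sort (g ∘ f)⟩
  rw [← hf, ← Multiset.map_map]
  congr 1
  exact congrArg Finset.val (Finset.map_univ_equiv (Tuple.sort (g ∘ f)))

/-- The multiset of zeros is invariant under conjugation, so its lower half is the conjugate of its
upper half. Sorting by real parts gives only weak monotonicity, because zeros may share a real part.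
-/
lemma exists_rootMap_eq {n : ℕ} (c : Fin n → ℝ) : ∃ (M : ℕ) (h : 2 * M ≤ n) (y : Fin n → ℝ),
    rootMap n M h y = c ∧ Monotone (pack n M h y).1 ∧ Monotone (pack n M h y).2.1 ∧
      ∀ i, 0 < (pack n M h y).2.2 i := by
  classical
  set s := ((monicPoly c).map Complex.ofRealHom).roots with hs
  have hcard : Multiset.card s = n := card_roots_monicPoly c
  have hconj : s.map (starRingEnd ℂ) = s := roots_map_conj _
  set sr := s.filter fun z => z.im = 0 with hsr
  set su := s.filter fun z => 0 < z.im with hsu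
  set sl := s.filter fun z => z.im < 0 with hsl
  have hsplit : s = sr + (su + sl) := by
    ext z
    rw [Multiset.count_add, Multiset.count_add, hsr, hsu, hsl, Multiset.count_filter,
      Multiset.count_filter, Multiset.count_filter]
    rcases lt_trichotomy z.im 0 with hz | hz | hz
    · simp [hz, hz.ne, hz.le]
    · simp [hz]
    · simp [hz, hz.ne', hz.le]
  have hsl' : sl = su.map (starRingEnd ℂ) := by
    rw [hsl]
    conv_lhs => rw [← hconj]
    rw [Multiset.filter_map, hsu]
    congr 1
    refine Multiset.filter_congr fun z _ => ?_
    simp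
  set M := Multiset.card su with hM
  have hcards : Multiset.card sr + 2 * M = n := by
    rw [← hcard]
    conv_rhs => rw [hsplit]
    rw [Multiset.card_add, Multiset.card_add, hsl', Multiset.card_map]; ring
  have h : 2 * M ≤ n := by omega
  obtain ⟨fx, hfx, hfxm⟩ := exists_monotone_fin_map_eq (k := n - 2 * M) sr (by omega) Complex.re
  obtain ⟨fu, hfu, hfum⟩ := exists_monotone_fin_map_eq (k := M) su rfl Complex.re
  have hfx0 : ∀ i, (fx i).im = 0 := fun i => by
    have : fx i ∈ sr := by rw [← hfx]; exact Multiset.mem_map_of_mem _ (mem_univ i)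
    exact (Multiset.mem_filter.mp this).2
  have hfu0 : ∀ i, 0 < (fu i).im := fun i => by
    have : fu i ∈ su := by rw [← hfu]; exact Multiset.mem_map_of_mem _ (mem_univ i)
    exact (Multiset.mem_filter.mp this).2
  set y : Fin n → ℝ := fun j => Sum.elim (fun i => (fx i).re)
    (Sum.elim (fun i => (fu i).re) fun i => (fu i).im) ((rootIndexEquiv n M h).symm j) with hy
  have hp1 : (pack n M h y).1 = fun i => (fx i).re := by ext i; simp [pack, hy]
  have hp2 : (pack n M h y).2.1 = fun i => (fu i).re := by ext i; simp [pack, hy]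
  have hp3 : (pack n M h y).2.2 = fun i => (fu i).im := by ext i; simp [pack, hy]
  refine ⟨M, h, y, ?_, ?_, ?_, ?_⟩
  · have h1 : rootPoly n M h y = (monicPoly c).map Complex.ofRealHom := by
      have h2 := (IsAlgClosed.splits ((monicPoly c).map Complex.ofRealHom)).eq_prod_roots_of_monic
        ((monicPoly_monic c).map _)
      rw [h2, ← hs, hsplit, hsl', ← hfx, ← hfu]
      rw [rootPoly, ← Equiv.prod_comp (rootIndexEquiv n M h), Fintype.prod_sum_type,
        Fintype.prod_sum_type]
      simp only [rootVec_inl, rootVec_inr_inl, rootVec_inr_inr, hp1, hp2, hp3, Multiset.map_add,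
        Multiset.map_map, Multiset.prod_add]
      congr 1
      · refine prod_congr rfl fun i _ => ?_
        have : ((fx i).re : ℂ) = fx i := by apply Complex.ext <;> simp [hfx0 i]
        rw [this]; rfl
    rw [← map_realRootPoly] at h1
    rw [rootMap, Polynomial.map_injective _ Complex.ofRealHom.injective h1, coeffVec_monicPoly]
  · rw [hp1]; exact hfxm
  · rw [hp2]; exact hfum
  · rw [hp3]; exact hfu0

/-- Vectors with two equal coordinates. -/
def diagSet (n : ℕ) : Set (Fin n → ℝ) := {y | ∃ i j, i ≠ j ∧ y i = y j}

lemma volume_diagSet (n : ℕ) : volume (diagSet n) = 0 := by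
  have : diagSet n = ⋃ i, ⋃ j, ⋃ (_ : i ≠ j), {y : Fin n → ℝ | y i = y j} := by
    ext y; simp [diagSet]
  rw [this]
  simp only [measure_iUnion_null_iff]
  intro i j hij
  let S : Submodule ℝ (Fin n → ℝ) :=
    LinearMap.ker (LinearMap.proj (R := ℝ) (φ := fun _ => ℝ) i - LinearMap.proj j)
  have hS : (S : Set (Fin n → ℝ)) = {y | y i = y j} := by
    ext y; simp [S, sub_eq_zero]
  rw [← hS]
  apply Measure.addHaar_submodule
  intro htop
  have : (Pi.single i 1 : Fin n → ℝ) ∈ S := by rw [htop]; trivial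
  simp [S, hij] at this

lemma diskSet_subset (n : ℕ) :
    diskSet n ⊆ (⋃ (M : ℕ) (h : 2 * M ≤ n), rootMap n M h '' regSet n M h) ∪
      ⋃ (M : ℕ) (h : 2 * M ≤ n), rootMap n M h '' diagSet n := by
  intro c hc
  obtain ⟨M, h, y, rfl, hx, hu, hv⟩ := exists_rootMap_eq c
  rw [diskSet, Set.mem_ofPred_eq, monicPoly_rootMap, zerosInDisk_realRootPoly_iff] at hc
  by_cases hy : y ∈ diagSet n
  · exact Or.inr (Set.mem_iUnion₂.mpr ⟨M, h, y, hy, rfl⟩)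
  · left
    refine Set.mem_iUnion₂.mpr ⟨M, h, y, ⟨fun i => abs_lt.mp (hc.1 i), ?_, ?_, hv, hc.2⟩, rfl⟩
    · apply hx.strictMono_of_injective
      intro i j hij
      by_contra hne
      exact hy ⟨_, _, fun he => hne (by simpa using (rootIndexEquiv n M h).injective he), hij⟩
    · apply hu.strictMono_of_injective
      intro i j hij
      by_contra hne
      exact hy ⟨_, _, fun he => hne (by simpa using (rootIndexEquiv n M h).injective he), hij⟩

/-- The polynomials missed come from vectors with two equal coordinates. These vectors lie in
finitely many hyperplanes, and the differentiable map `rootMap` takes null sets to null sets. -/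
lemma diskSet_ae_eq (n : ℕ) :
    diskSet n =ᵐ[volume] ⋃ (M : ℕ) (h : 2 * M ≤ n), rootMap n M h '' regSet n M h := by
  have hnull : volume (⋃ (M : ℕ) (h : 2 * M ≤ n), rootMap n M h '' diagSet n) = 0 := by
    simp only [measure_iUnion_null_iff]
    intro M h
    exact addHaar_image_eq_zero_of_differentiableOn_of_addHaar_eq_zero _
      (differentiable_rootMap h).differentiableOn (volume_diagSet n)
  refine Filter.EventuallyLE.antisymm ?_ ?_
  · rw [ae_le_set]
    refine measure_mono_null ?_ hnull
    rintro c ⟨hc, hc'⟩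
    exact (diskSet_subset n hc).resolve_left hc'
  · exact (Set.iUnion₂_subset fun M h => rootMap_image_subset).eventuallyLE

lemma measurable_unordered (n : ℕ) : Measurable (unordered : (Fin n → ℂ) → Sym ℂ n) :=
  fun _ hs => hs

/-- On each piece `rootsSym` is the inverse of `rootMap` followed by `unordered ∘ rootVec`; a
continuous injective map on a Borel set is a measurable embedding, so this inverse is measurable. -/
lemma aemeasurable_rootsSym (n : ℕ) :
    AEMeasurable (rootsSym : (Fin n → ℝ) → Sym ℂ n) (volume.restrict (diskSet n)) := by
  rw [Measure.restrict_congr_set (diskSet_ae_eq n), aemeasurable_iUnion_iff]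
  intro M
  by_cases h : 2 * M ≤ n
  swap
  · simp [h]
  rw [show (⋃ (h : 2 * M ≤ n), rootMap n M h '' regSet n M h) =
    rootMap n M h '' regSet n M h from iSup_pos h]
  have hemb : MeasurableEmbedding ((regSet n M h).domRestrict (rootMap n M h)) :=
    (differentiable_rootMap h).continuous.continuousOn.measurableEmbedding measurableSet_regSet
      rootMap_injOn
  have hmeas : Measurable fun y : regSet n M h => unordered (rootVec n M h y) :=
    (measurable_unordered n).comp ((measurable_pi_lambda _ fun j =>
      (differentiable_rootVec h j).continuous.measurable).comp measurable_subtype_coe)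
  obtain ⟨g, hg, hg'⟩ := hemb.exists_measurable_extend hmeas fun _ => ⟨rootsSym 0⟩
  refine ⟨g, hg, ?_⟩
  refine (ae_restrict_iff' measurableSet_rootMap_image).mpr (Filter.Eventually.of_forall ?_)
  rintro c ⟨y, hy, rfl⟩
  rw [rootsSym_rootMap]
  exact (congrFun hg' ⟨y, hy⟩).symm

/-- Change of variables on each of the disjoint pieces. The Jacobian supplies both the weights 2^M
of `wedgeMeasure` and the Vandermonde factor of `density`. -/
lemma lintegral_diskSet_rootsSym (n : ℕ) (f : Sym ℂ n → ℝ≥0∞) :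
    ∫⁻ c in diskSet n, f (rootsSym c) =
      ∑ M ∈ range (n / 2 + 1), (2 : ℝ≥0∞) ^ M * ∫⁻ p in paramSet (n - 2 * M) M,
        ENNReal.ofReal (∏ j, ∏ k ∈ Ioi j, ‖config n M p k - config n M p j‖) *
          f (unordered (config n M p)) := by
  have hunion : (⋃ (M : ℕ) (h : 2 * M ≤ n), rootMap n M h '' regSet n M h) =
      ⋃ M ∈ range (n / 2 + 1), if h : 2 * M ≤ n then rootMap n M h '' regSet n M h else ∅ := by
    ext c
    simp only [Set.mem_iUnion, mem_range]
    constructor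
    · rintro ⟨M, h, hc⟩
      exact ⟨M, by omega, by rwa [dif_pos h]⟩
    · rintro ⟨M, h, hc⟩
      have h' : 2 * M ≤ n := by omega
      rw [dif_pos h'] at hc
      exact ⟨M, h', hc⟩
  rw [Measure.restrict_congr_set (diskSet_ae_eq n), hunion, lintegral_biUnion_finset]
  · refine sum_congr rfl fun M hM => ?_
    have h : 2 * M ≤ n := by have := mem_range.mp hM; omega
    rw [dif_pos h, lintegral_image_eq_lintegral_abs_det_fderiv_mul volume measurableSet_regSet
      (fun y _ => (differentiable_rootMap h y).hasFDerivAt.hasFDerivWithinAt) rootMap_injOn,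
      ← (measurePreserving_pack n M h).setLIntegral_comp_preimage_emb
        (continuous_pack.measurableEmbedding pack_injective),
      ← lintegral_const_mul' _ _ (by simp)]
    refine setLIntegral_congr_fun measurableSet_regSet fun y hy => ?_
    rw [abs_det_rootMap h y (rootVec_injective hy), config_pack, rootsSym_rootMap,
      ENNReal.ofReal_mul (by positivity), mul_assoc]
    congr 1
    rw [ENNReal.ofReal_pow (by norm_num)]
    simp
  · intro M hM M' hM' hne
    have h : 2 * M ≤ n := by have := mem_range.mp hM; omega
    have h' : 2 * M' ≤ n := by have := mem_range.mp hM'; omega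
    simp only [Function.onFun, dif_pos h, dif_pos h']
    exact rootMap_image_disjoint hne
  · intro M hM
    have h : 2 * M ≤ n := by have := mem_range.mp hM; omega
    rw [dif_pos h]
    exact measurableSet_rootMap_image

end RootSets

/-! ### The beta laws on (−1, 1) -/

section BetaLaw

/-- The density of `betaLaw`. -/
def betaDensity (s t x : ℝ) : ℝ :=
  (2 : ℝ) ^ (1 - s - t) * Real.Gamma (s + t) / (Real.Gamma s * Real.Gamma t) *
    ((1 - x) ^ (s - 1) * (1 + x) ^ (t - 1))

lemma measurable_betaDensity (s t : ℝ) : Measurable (betaDensity s t) := by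
  unfold betaDensity; fun_prop

lemma betaLaw_eq (s t : ℝ) : betaLaw s t =
    (volume.restrict (Set.Ioo (-1 : ℝ) 1)).withDensity fun x => ENNReal.ofReal (betaDensity s t x) :=
  rfl

/-- The substitution 1 − 2x reduces the law to the standard beta law on (0, 1); the factor 2 is its
Jacobian. -/
lemma betaDensity_one_sub_two_mul {s t : ℝ} {x : ℝ} (hx : x ∈ Set.Ioo (0 : ℝ) 1) :
    2 * betaDensity s t (1 - 2 * x) = 1 / beta s t * x ^ (s - 1) * (1 - x) ^ (t - 1) := by
  have h1 : (1 : ℝ) - (1 - 2 * x) = 2 * x := by ring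
  have h2 : (1 : ℝ) + (1 - 2 * x) = 2 * (1 - x) := by ring
  rw [betaDensity, h1, h2, Real.mul_rpow (by norm_num) hx.1.le,
    Real.mul_rpow (by norm_num) (by linarith [hx.2]), beta, one_div_div]
  have h3 : (2 : ℝ) * (2 ^ (1 - s - t) * 2 ^ (s - 1) * 2 ^ (t - 1)) = 1 := by
    rw [← Real.rpow_add two_pos, ← Real.rpow_add two_pos]
    nth_rewrite 1 [← Real.rpow_one 2]
    rw [← Real.rpow_add two_pos]
    ring_nf
    simp
  linear_combination (Real.Gamma (s + t) / (Real.Gamma s * Real.Gamma t) *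
    (x ^ (s - 1) * (1 - x) ^ (t - 1))) * h3

lemma isProbabilityMeasure_betaLaw {s t : ℝ} (hs : 0 < s) (ht : 0 < t) :
    IsProbabilityMeasure (betaLaw s t) where
  measure_univ := by
    have himg : (fun x : ℝ => 1 - 2 * x) '' Set.Ioo 0 1 = Set.Ioo (-1 : ℝ) 1 := by
      ext x
      constructor
      · rintro ⟨y, hy, rfl⟩
        constructor <;> linarith [hy.1, hy.2]
      · intro hx
        exact ⟨(1 - x) / 2, ⟨by linarith [hx.2], by linarith [hx.1]⟩, by simp; ring⟩
    have hderiv : ∀ x ∈ Set.Ioo (0 : ℝ) 1,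
        HasDerivWithinAt (fun x : ℝ => 1 - 2 * x) (-2) (Set.Ioo 0 1) x := fun x _ => by
      simpa using (((hasDerivAt_id x).const_mul 2).const_sub 1).hasDerivWithinAt
    rw [betaLaw_eq, withDensity_apply _ MeasurableSet.univ, Measure.restrict_univ, ← himg,
      lintegral_image_eq_lintegral_abs_deriv_mul measurableSet_Ioo hderiv
        (fun x _ y _ h => by simpa using h),
      ← lintegral_betaPDF_eq_one hs ht, lintegral_betaPDF]
    refine setLIntegral_congr_fun measurableSet_Ioo fun x hx => ?_
    rw [← betaDensity_one_sub_two_mul hx, ENNReal.ofReal_mul two_pos.le]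
    simp

end BetaLaw

/-! ### From Verblunsky coefficients to polynomial coefficients -/

section SzegoCoefficients

open Polynomial

/-- One step of the Szegő recursion on the level of coefficients. -/
def coeffStep {n : ℕ} (γ : ℝ) (c : Fin n → ℝ) : Fin (n + 1) → ℝ :=
  Fin.cons (-γ) fun j => c j - γ * c (Fin.rev j)

lemma coeffVec_szegoStep {n : ℕ} (γ : ℝ) {p : ℝ[X]} (hp : p.Monic) (hn : p.natDegree = n) :
    coeffVec (n + 1) (szegoStep n γ p) = coeffStep γ (coeffVec n p) := by
  ext k
  refine Fin.cases ?_ (fun j => ?_) k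
  · have h1 : p.coeff n = 1 := by rw [← hn]; exact hp
    simp [coeffVec, szegoStep, coeffStep, coeff_reflect, revAt_le (Nat.zero_le n), h1]
  · have hj : (j : ℕ) + 1 ≤ n := j.2
    simp only [coeffVec, szegoStep, coeffStep, coeff_sub, Fin.val_succ, coeff_X_mul, coeff_C_mul,
      coeff_reflect, revAt_le hj, Fin.cons_succ, Fin.val_rev]

lemma monicPoly_coeffStep {n : ℕ} (γ : ℝ) (c : Fin n → ℝ) :
    monicPoly (coeffStep γ c) = szegoStep n γ (monicPoly c) := by
  obtain ⟨h1, h2⟩ := szegoStep_monic γ (monicPoly_monic c) (monicPoly_natDegree c)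
  rw [← monicPoly_coeffVec h1 h2, coeffVec_szegoStep γ (monicPoly_monic c) (monicPoly_natDegree c),
    coeffVec_monicPoly]

lemma coeffStep_mem_diskSet_iff {n : ℕ} {γ : ℝ} (hγ : |γ| < 1) (c : Fin n → ℝ) :
    coeffStep γ c ∈ diskSet (n + 1) ↔ c ∈ diskSet n := by
  rw [diskSet, diskSet, Set.mem_ofPred_eq, Set.mem_ofPred_eq, monicPoly_coeffStep]
  exact zerosInDisk_szegoStep_iff (monicPoly_monic c) (monicPoly_natDegree c) hγ

lemma abs_zero_lt_one_of_mem_diskSet {n : ℕ} {c : Fin (n + 1) → ℝ} (hc : c ∈ diskSet (n + 1)) :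
    |c 0| < 1 := by
  have h := abs_coeff_zero_lt_one (monicPoly_monic c) (by rw [monicPoly_natDegree]; omega) hc
  have h2 : coeffVec (n + 1) (monicPoly c) 0 = c 0 := by rw [coeffVec_monicPoly]
  rw [← h2]; exact h

/-- The inverse of `coeffStep`. -/
def coeffStepInv {n : ℕ} (c : Fin (n + 1) → ℝ) : Fin n → ℝ := fun j =>
  (c j.succ - c 0 * c (Fin.rev j).succ) / (1 - c 0 ^ 2)

lemma coeffStepInv_coeffStep {n : ℕ} {γ : ℝ} (hγ : |γ| < 1) (c : Fin n → ℝ) :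
    coeffStepInv (coeffStep γ c) = c := by
  ext j
  have h : 1 - γ ^ 2 ≠ 0 := by
    have := (sq_lt_one_iff_abs_lt_one γ).mpr hγ
    linarith
  simp only [coeffStepInv, coeffStep, Fin.cons_succ, Fin.cons_zero, Fin.rev_rev, neg_sq]
  field_simp
  ring

lemma coeffStep_coeffStepInv {n : ℕ} {c : Fin (n + 1) → ℝ} (hc : |c 0| < 1) :
    coeffStep (-c 0) (coeffStepInv c) = c := by
  ext k
  have h : 1 - c 0 ^ 2 ≠ 0 := by
    have := (sq_lt_one_iff_abs_lt_one (c 0)).mpr hc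
    linarith
  refine Fin.cases (by simp [coeffStep]) (fun j => ?_) k
  simp only [coeffStepInv, coeffStep, Fin.cons_succ, Fin.rev_rev]
  field_simp
  ring

lemma measurable_coeffStepInv (n : ℕ) : Measurable (coeffStepInv : (Fin (n + 1) → ℝ) → _) := by
  unfold coeffStepInv; fun_prop

lemma continuous_coeffStep (n : ℕ) :
    Continuous fun q : ℝ × (Fin n → ℝ) => coeffStep q.1 q.2 := by
  unfold coeffStep
  refine continuous_pi fun k => ?_
  refine Fin.cases ?_ (fun j => ?_) k
  · simp only [Fin.cons_zero]; fun_prop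
  · simp only [Fin.cons_succ]; fun_prop

/-- The constant coefficient of zP − γP* is −γ, so γ can be read off and the step undone, and the
step respects the location of the zeros. -/
lemma diskSet_succ (n : ℕ) :
    diskSet (n + 1) = {c | |c 0| < 1} ∩ coeffStepInv ⁻¹' diskSet n := by
  ext c
  constructor
  · intro hc
    have h0 := abs_zero_lt_one_of_mem_diskSet hc
    refine ⟨h0, ?_⟩
    rw [← coeffStep_coeffStepInv h0] at hc
    exact (coeffStep_mem_diskSet_iff (by rwa [abs_neg]) _).mp hc
  · rintro ⟨h0, hc⟩
    rw [← coeffStep_coeffStepInv h0]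
    exact (coeffStep_mem_diskSet_iff (by rwa [abs_neg]) _).mpr hc

lemma diskSet_zero : diskSet 0 = Set.univ := by
  ext c
  simp only [diskSet, Set.mem_ofPred_eq, Set.mem_univ, iff_true]
  intro z hz
  simp [monicPoly] at hz

lemma measurableSet_diskSet (n : ℕ) : MeasurableSet (diskSet n) := by
  induction n with
  | zero => rw [diskSet_zero]; exact MeasurableSet.univ
  | succ n ih =>
    rw [diskSet_succ]
    exact (measurableSet_lt (by fun_prop) (by fun_prop)).inter (measurable_coeffStepInv n ih)

/-- The matrix of `c ↦ c - γ c ∘ rev`. -/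
def revMatrix (n : ℕ) (γ : ℝ) : Matrix (Fin n) (Fin n) ℝ :=
  1 - γ • Matrix.of fun i j => if Fin.rev i = j then 1 else 0

lemma revMatrix_mulVec (n : ℕ) (γ : ℝ) (c : Fin n → ℝ) (j : Fin n) :
    (revMatrix n γ).mulVec c j = c j - γ * c (Fin.rev j) := by
  rw [revMatrix, Matrix.sub_mulVec, Matrix.one_mulVec, Matrix.smul_mulVec, Pi.sub_apply,
    Pi.smul_apply, smul_eq_mul, Matrix.mulVec, dotProduct]
  simp

/-- The Jacobian factor of `coeffStep`. -/
def stepJac (n : ℕ) (γ : ℝ) : ℝ := (1 - γ) ^ ((n + 1) / 2) * (1 + γ) ^ (n / 2)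

/-- Pairs opposite indices. -/
def revIndexFun (n : ℕ) : (Fin (n / 2) ⊕ Fin (n / 2)) ⊕ Fin (n % 2) → Fin n
  | .inl (.inl i) => ⟨i, by omega⟩
  | .inl (.inr i) => ⟨n - 1 - i, by omega⟩
  | .inr i => ⟨n / 2, by have := i.2; omega⟩

lemma revIndexFun_bijective (n : ℕ) : Function.Bijective (revIndexFun n) := by
  rw [Fintype.bijective_iff_injective_and_card]
  constructor
  · rintro ((i | i) | i) ((j | j) | j) hij <;>
      simp only [revIndexFun, Sum.inl.injEq, Sum.inr.injEq, Fin.ext_iff, reduceCtorEq] at hij ⊢ <;>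
      have hi := i.2 <;> have hj := j.2 <;> omega
  · simp; omega

/-- Pairing i with n − 1 − i splits the matrix into ⌊n/2⌋ blocks [[1, −γ], [−γ, 1]] and, for odd n,
the middle entry 1 − γ. -/
lemma det_revMatrix (n : ℕ) (γ : ℝ) : (revMatrix n γ).det = stepJac n γ := by
  have h : (revMatrix n γ).submatrix (revIndexFun n) (revIndexFun n) =
      Matrix.fromBlocks (Matrix.fromBlocks 1 (-γ • (1 : Matrix _ _ ℝ)) (-γ • 1) 1) 0 0
        ((1 - γ) • (1 : Matrix (Fin (n % 2)) (Fin (n % 2)) ℝ)) := by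
    ext i j
    rcases i with (i | i) | i <;> rcases j with (j | j) | j <;>
      simp only [revMatrix, revIndexFun, Matrix.submatrix_apply, Matrix.sub_apply,
        Matrix.smul_apply, Matrix.one_apply, Matrix.of_apply, Matrix.fromBlocks_apply₁₁,
        Matrix.fromBlocks_apply₁₂, Matrix.fromBlocks_apply₂₁, Matrix.fromBlocks_apply₂₂,
        Matrix.zero_apply, Fin.ext_iff, Fin.val_rev, smul_eq_mul] <;>
      have hi := i.2 <;> have hj := j.2 <;> split_ifs <;> first | omega | simp
  have h2 := Matrix.det_submatrix_equiv_self (Equiv.ofBijective _ (revIndexFun_bijective n))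
    (revMatrix n γ)
  rw [← h2]
  change ((revMatrix n γ).submatrix (revIndexFun n) (revIndexFun n)).det = _
  rw [h, Matrix.det_fromBlocks_zero₂₁, Matrix.det_fromBlocks_one₁₁, Matrix.det_smul,
    Matrix.det_one, mul_one, Fintype.card_fin]
  have h3 : (1 : Matrix (Fin (n / 2)) (Fin (n / 2)) ℝ) -
      (-γ • (1 : Matrix (Fin (n / 2)) (Fin (n / 2)) ℝ)) * (-γ • 1) =
      ((1 - γ) * (1 + γ)) • (1 : Matrix (Fin (n / 2)) (Fin (n / 2)) ℝ) := by
    rw [Matrix.smul_mul, Matrix.one_mul, smul_smul]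
    ext i j
    simp only [Matrix.sub_apply, Matrix.smul_apply, smul_eq_mul]
    rcases eq_or_ne i j with rfl | hij
    · simp; ring
    · simp [hij]
  rw [h3, Matrix.det_smul, Matrix.det_one, mul_one, Fintype.card_fin, stepJac, mul_pow,
    show (n + 1) / 2 = n / 2 + n % 2 by omega, pow_add]
  ring

lemma stepJac_pos (n : ℕ) {γ : ℝ} (hγ : |γ| < 1) : 0 < stepJac n γ := by
  obtain ⟨h1, h2⟩ := abs_lt.mp hγ
  exact mul_pos (pow_pos (by linarith) _) (pow_pos (by linarith) _)

lemma lintegral_revMatrix (n : ℕ) {γ : ℝ} (hγ : |γ| < 1) (g : (Fin n → ℝ) → ℝ≥0∞)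
    (hg : Measurable g) :
    ∫⁻ c, g c = ENNReal.ofReal (stepJac n γ) * ∫⁻ c : Fin n → ℝ, g fun j => c j - γ * c (Fin.rev j) := by
  have hpos := stepJac_pos n hγ
  have hmap := Real.map_matrix_volume_pi_eq_smul_volume_pi (M := revMatrix n γ)
    (by rw [det_revMatrix]; exact hpos.ne')
  have hcont : Measurable (Matrix.toLin' (revMatrix n γ)) :=
    (LinearMap.continuous_of_finiteDimensional _).measurable
  have h1 : ∫⁻ c : Fin n → ℝ, g (fun j => c j - γ * c (Fin.rev j)) =
      ∫⁻ c, g c ∂(Measure.map (Matrix.toLin' (revMatrix n γ)) volume) := by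
    rw [lintegral_map hg hcont]
    refine lintegral_congr fun c => ?_
    congr 1
    ext j
    rw [Matrix.toLin'_apply, revMatrix_mulVec]
  rw [h1, hmap, lintegral_smul_measure, det_revMatrix, abs_of_pos (inv_pos.mpr hpos), smul_eq_mul,
    ← mul_assoc, ← ENNReal.ofReal_mul hpos.le, mul_inv_cancel₀ hpos.ne', ENNReal.ofReal_one,
    one_mul]

/-- The constant coefficient −γ is integrated separately. For fixed γ the remaining coefficients are
a linear image of c with determinant `stepJac n γ`, and they stay in the disk region exactly when c
does. -/
lemma lintegral_diskSet_succ (n : ℕ) (g : (Fin (n + 1) → ℝ) → ℝ≥0∞) (hg : Measurable g) :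
    ∫⁻ c in diskSet (n + 1), g c = ∫⁻ γ in Set.Ioo (-1 : ℝ) 1,
      ENNReal.ofReal (stepJac n γ) * ∫⁻ c in diskSet n, g (coeffStep γ c) := by
  set G : (Fin (n + 1) → ℝ) → ℝ≥0∞ := (diskSet (n + 1)).indicator g with hG
  have hGm : Measurable G := hg.indicator (measurableSet_diskSet _)
  have hmp := (volume_preserving_piFinSuccAbove (fun _ : Fin (n + 1) => ℝ) 0).symm
  have hcons : ∀ (x : ℝ) (c : Fin n → ℝ),
      (MeasurableEquiv.piFinSuccAbove (fun _ : Fin (n + 1) => ℝ) 0).symm (x, c) =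
        Fin.cons x c := fun x c => by
    change Fin.insertNth (α := fun _ => ℝ) 0 x c = _
    exact Fin.insertNth_zero' x c
  have hconsm : Measurable fun q : ℝ × (Fin n → ℝ) => (Fin.cons q.1 q.2 : Fin (n + 1) → ℝ) := by
    have := (MeasurableEquiv.piFinSuccAbove (fun _ : Fin (n + 1) => ℝ) 0).symm.measurable
    convert this using 1
    ext1 q
    exact (hcons q.1 q.2).symm
  rw [← lintegral_indicator (measurableSet_diskSet _), ← hG,
    ← hmp.lintegral_comp_emb (MeasurableEquiv.measurableEmbedding _)]
  simp only [Measure.volume_eq_prod]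
  rw [lintegral_prod (fun a => G ((MeasurableEquiv.piFinSuccAbove (fun _ => ℝ) 0).symm a))
      (hGm.comp (MeasurableEquiv.measurable _)).aemeasurable,
    ← lintegral_neg_eq_self, ← lintegral_indicator measurableSet_Ioo]
  refine lintegral_congr fun γ => ?_
  simp only [hcons]
  by_cases hγ : γ ∈ Set.Ioo (-1 : ℝ) 1
  · rw [Set.indicator_of_mem hγ]
    have hγ' : |γ| < 1 := abs_lt.mpr hγ
    rw [lintegral_revMatrix n hγ' (fun c => G (Fin.cons (-γ) c))
      (hGm.comp (hconsm.comp measurable_prodMk_left)), ← lintegral_indicator (measurableSet_diskSet n)]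
    congr 1
    refine lintegral_congr fun c => ?_
    change G (coeffStep γ c) = _
    by_cases hc : c ∈ diskSet n
    · rw [Set.indicator_of_mem hc, hG,
        Set.indicator_of_mem ((coeffStep_mem_diskSet_iff hγ' c).mpr hc)]
    · rw [Set.indicator_of_notMem hc, hG,
        Set.indicator_of_notMem fun h => hc ((coeffStep_mem_diskSet_iff hγ' c).mp h)]
  · rw [Set.indicator_of_notMem hγ]
    rw [← lintegral_zero (μ := (volume : Measure (Fin n → ℝ)))]
    refine lintegral_congr fun c => ?_
    rw [hG, Set.indicator_of_notMem]
    intro hc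
    have := abs_zero_lt_one_of_mem_diskSet hc
    rw [Fin.cons_zero, abs_neg, abs_lt] at this
    exact hγ this

/-- The law of the coefficients of the `n`-th Szegő polynomial whose Verblunsky coefficients are
independent with laws `ν 0, ν 1, …`. -/
def szegoLaw (ν : ℕ → Measure ℝ) : ∀ n, Measure (Fin n → ℝ)
  | 0 => Measure.dirac 0
  | n + 1 => ((ν n).prod (szegoLaw ν n)).map fun q => coeffStep q.1 q.2

instance instSFiniteSzegoLaw (ν : ℕ → Measure ℝ) [∀ k, SFinite (ν k)] (n : ℕ) :
    SFinite (szegoLaw ν n) := by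
  induction n with
  | zero => unfold szegoLaw; infer_instance
  | succ n ih => unfold szegoLaw; infer_instance

/-- Extends a finite sequence by zeros. -/
def extendSeq {n : ℕ} (α : Fin n → ℝ) (k : ℕ) : ℝ := if h : k < n then α ⟨k, h⟩ else 0

lemma extendSeq_apply {n : ℕ} (α : Fin n → ℝ) (k : Fin n) : extendSeq α k = α k := by
  simp [extendSeq]

/-- The coefficients of the Szegő polynomial with given Verblunsky coefficients. -/
def szegoCoeff {n : ℕ} (α : Fin n → ℝ) : Fin n → ℝ := coeffVec n (szego (extendSeq α) n)

lemma szegoCoeff_succ {n : ℕ} (α : Fin (n + 1) → ℝ) :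
    szegoCoeff α = coeffStep (α (Fin.last n)) (szegoCoeff fun k => α k.castSucc) := by
  have h1 : szego (extendSeq α) n = szego (extendSeq fun k : Fin n => α k.castSucc) n :=
    szego_congr fun k hk => by simp [extendSeq, hk, Nat.lt_succ_of_lt hk]
  have h2 : extendSeq α n = α (Fin.last n) := extendSeq_apply α (Fin.last n)
  obtain ⟨h3, h4⟩ := szego_monic (extendSeq fun k : Fin n => α k.castSucc) n
  rw [szegoCoeff, szego_succ, h1, h2, coeffVec_szegoStep _ h3 h4]
  rfl

lemma continuous_szegoCoeff (n : ℕ) : Continuous (szegoCoeff : (Fin n → ℝ) → _) := by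
  induction n with
  | zero => exact continuous_of_const fun _ _ => Subsingleton.elim _ _
  | succ n ih =>
    have : (szegoCoeff : (Fin (n + 1) → ℝ) → _) = fun α =>
        coeffStep (α (Fin.last n)) (szegoCoeff fun k => α k.castSucc) := funext szegoCoeff_succ
    rw [this]
    have h2 : Continuous fun α : Fin (n + 1) → ℝ =>
        (α (Fin.last n), szegoCoeff fun k : Fin n => α k.castSucc) :=
      (continuous_apply _).prodMk (ih.comp (continuous_pi fun k => continuous_apply _))
    exact (continuous_coeffStep n).comp h2

lemma map_szegoCoeff_pi (ν : ℕ → Measure ℝ) [∀ k, SigmaFinite (ν k)] (n : ℕ) :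
    (Measure.pi fun k : Fin n => ν k).map szegoCoeff = szegoLaw ν n := by
  induction n with
  | zero =>
    rw [Measure.pi_of_empty _ 0, Measure.map_dirac' (continuous_szegoCoeff 0).measurable, szegoLaw]
    congr 1
    exact Subsingleton.elim _ _
  | succ n ih =>
    have hmp := measurePreserving_piFinSuccAbove (fun k : Fin (n + 1) => ν k) (Fin.last n)
    have h1 : (szegoCoeff : (Fin (n + 1) → ℝ) → _) =
        ((fun q : ℝ × (Fin n → ℝ) => coeffStep q.1 q.2) ∘ Prod.map id szegoCoeff) ∘
          MeasurableEquiv.piFinSuccAbove (fun _ => ℝ) (Fin.last n) := by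
      ext1 α
      rw [szegoCoeff_succ]
      simp only [Function.comp_apply, Prod.map, id]
      congr 2
      ext k
      change _ = α ((Fin.last n).succAbove k)
      rw [Fin.succAbove_last]
    have hprod : ((ν n).prod (Measure.pi fun k : Fin n => ν k)).map (Prod.map id szegoCoeff) =
        (ν n).prod (szegoLaw ν n) := by
      rw [← ih, ← Measure.map_prod_map _ _ measurable_id (continuous_szegoCoeff n).measurable,
        Measure.map_id]
    have hm := hmp.map_eq
    simp only [Fin.succAbove_last, Fin.val_castSucc, Fin.val_last] at hm
    rw [h1, ← Measure.map_map ((continuous_coeffStep n).measurable.comp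
      (measurable_id.prodMap (continuous_szegoCoeff n).measurable)) (MeasurableEquiv.measurable _),
      hm, ← Measure.map_map (continuous_coeffStep n).measurable
      (measurable_id.prodMap (continuous_szegoCoeff n).measurable), hprod, szegoLaw]

/-- The density of `szegoLaw` on `diskSet` in terms of the densities of the Verblunsky coefficients
relative to `stepJac`. -/
def coeffDensity (w : ℕ → ℝ → ℝ) : ∀ n, (Fin n → ℝ) → ℝ
  | 0, _ => 1
  | n + 1, c => w n (-c 0) * coeffDensity w n (coeffStepInv c)

lemma measurable_coeffDensity {w : ℕ → ℝ → ℝ} (hw : ∀ k, Measurable (w k)) (n : ℕ) :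
    Measurable (coeffDensity w n) := by
  induction n with
  | zero => exact measurable_const
  | succ n ih =>
    exact ((hw n).comp (by fun_prop)).mul (ih.comp (measurable_coeffStepInv n))

/-- Writing the density of the k-th Verblunsky coefficient as `w k * stepJac k` lets the Jacobian of
each step absorb the second factor, so the polynomial coefficients have the plain product of the `w
k` as density. -/
lemma szegoLaw_eq_withDensity {w : ℕ → ℝ → ℝ} (hw : ∀ k, Measurable (w k))
    (hpos : ∀ k, ∀ x ∈ Set.Ioo (-1 : ℝ) 1, 0 ≤ w k x) (ν : ℕ → Measure ℝ) (n : ℕ)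
    (hν : ∀ k < n, ν k = (volume.restrict (Set.Ioo (-1 : ℝ) 1)).withDensity fun x =>
      ENNReal.ofReal (w k x * stepJac k x)) [∀ k, SFinite (ν k)] :
    szegoLaw ν n = (volume.restrict (diskSet n)).withDensity fun c =>
      ENNReal.ofReal (coeffDensity w n c) := by
  induction n with
  | zero =>
    simp only [szegoLaw, coeffDensity, ENNReal.ofReal_one, diskSet_zero, Measure.restrict_univ]
    rw [← Pi.one_def, withDensity_one, volume_pi, Measure.pi_of_empty _ 0]
  | succ n ih =>
    refine Measure.ext_of_lintegral _ fun f hf => ?_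
    have hstep := (continuous_coeffStep n).measurable
    have hD := measurable_coeffDensity hw
    have hJm : Measurable fun x => stepJac n x := by unfold stepJac; fun_prop
    have hm1 : Measurable fun x => ENNReal.ofReal (w n x * stepJac n x) :=
      ((hw n).mul hJm).ennreal_ofReal
    have hm2 : Measurable fun x => ∫⁻ c, f (coeffStep x c) ∂((volume.restrict
        (diskSet n)).withDensity fun c => ENNReal.ofReal (coeffDensity w n c)) :=
      Measurable.lintegral_prod_right' (f := fun q => f (coeffStep q.1 q.2)) (hf.comp hstep)
    have hm3 : ∀ γ, Measurable fun c : Fin n → ℝ => f (coeffStep γ c) := fun γ =>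
      hf.comp (hstep.comp measurable_prodMk_left)
    rw [szegoLaw, lintegral_map hf hstep,
      lintegral_prod (fun a => f (coeffStep a.1 a.2)) (hf.comp hstep).aemeasurable]
    dsimp only
    rw [ih fun k hk => hν k (by omega), hν n (by omega),
      lintegral_withDensity_eq_lintegral_mul _ hm1 hm2,
      lintegral_withDensity_eq_lintegral_mul _ (hD (n + 1)).ennreal_ofReal hf,
      lintegral_diskSet_succ n _ ((hD (n + 1)).ennreal_ofReal.mul hf)]
    refine setLIntegral_congr_fun measurableSet_Ioo fun γ hγ => ?_
    have hγ' : |γ| < 1 := abs_lt.mpr hγ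
    simp only [Pi.mul_apply]
    rw [lintegral_withDensity_eq_lintegral_mul _ (hD n).ennreal_ofReal (hm3 γ), ENNReal.ofReal_mul (hpos n γ hγ), mul_comm
      (ENNReal.ofReal (w n γ)), mul_assoc, ← lintegral_const_mul _
      ((hD n).ennreal_ofReal.mul (hm3 γ))]
    congr 1
    refine lintegral_congr fun c => ?_
    rw [coeffDensity, coeffStepInv_coeffStep hγ']
    simp only [Pi.mul_apply, coeffStep, Fin.cons_zero, neg_neg]
    rw [ENNReal.ofReal_mul (hpos n γ hγ), mul_assoc]

end SzegoCoefficients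

/-! ### Matching the densities and the normalization constants -/

section EigenvalueLaw

open Polynomial

/-- First parameter of the law of the `k`-th Verblunsky coefficient. -/
def paramS (β a b : ℝ) (k : ℕ) : ℝ :=
  if Even k then β * k / 4 + a + 1 else β * ((k : ℝ) - 1) / 4 + a + b + 2

/-- Second parameter of the law of the `k`-th Verblunsky coefficient. -/
def paramT (β b : ℝ) (k : ℕ) : ℝ :=
  if Even k then β * k / 4 + b + 1 else β * ((k : ℝ) + 1) / 4

variable {β a b : ℝ}

lemma paramS_pos (hβ : 0 < β) (ha : -1 < a) (hb : -1 < b) (k : ℕ) : 0 < paramS β a b k := by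
  unfold paramS
  split_ifs with h
  · have : 0 ≤ β * k / 4 := by positivity
    linarith
  · have h1 : (1 : ℝ) ≤ k := by
      exact_mod_cast Nat.one_le_iff_ne_zero.mpr fun h0 => h (by simp [h0])
    have : 0 ≤ β * ((k : ℝ) - 1) / 4 := by
      have := mul_nonneg hβ.le (sub_nonneg.mpr h1); linarith
    linarith

lemma paramT_pos (hβ : 0 < β) (hb : -1 < b) (k : ℕ) : 0 < paramT β b k := by
  unfold paramT
  split_ifs with h
  · have : 0 ≤ β * k / 4 := by positivity
    linarith
  · positivity

/-- The normalization of the law of the `k`-th Verblunsky coefficient. -/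
def betaConst (β a b : ℝ) (k : ℕ) : ℝ :=
  (2 : ℝ) ^ (1 - paramS β a b k - paramT β b k) *
    Real.Gamma (paramS β a b k + paramT β b k) /
      (Real.Gamma (paramS β a b k) * Real.Gamma (paramT β b k))

lemma betaConst_pos (hβ : 0 < β) (ha : -1 < a) (hb : -1 < b) (k : ℕ) : 0 < betaConst β a b k := by
  have h1 := paramS_pos hβ ha hb k
  have h2 := paramT_pos hβ hb k
  have h3 := Real.Gamma_pos_of_pos h1
  have h4 := Real.Gamma_pos_of_pos h2
  have h5 := Real.Gamma_pos_of_pos (add_pos h1 h2)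
  unfold betaConst
  positivity

lemma normConst_pos (n : ℕ) (hβ : 0 < β) (ha : -1 < a) (hb : -1 < b) : 0 < normConst n β a b := by
  unfold normConst
  refine mul_pos (mul_pos (by positivity) (prod_pos fun j _ => ?_)) (prod_pos fun j hj => ?_)
  · have hj : 0 ≤ β / 2 * j := by positivity
    have hj' : 0 ≤ β / 2 * (((n / 2 : ℕ) : ℝ) + j) := by positivity
    exact div_pos (mul_pos (Real.Gamma_pos_of_pos (by linarith))
      (Real.Gamma_pos_of_pos (by linarith))) (Real.Gamma_pos_of_pos (by linarith))
  · have : (0 : ℝ) < j := by exact_mod_cast (mem_Icc.mp hj).1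
    exact Real.Gamma_pos_of_pos (by positivity)

/-- Passing from n to n + 1 with n = 2m adds the index j = m to the first product. With n = 2m + 1
it adds a factor to the last product and raises ⌊n/2⌋, which shifts the denominators by one index;
`htel` reduces that shift to its end factors. -/
lemma normConst_succ (n : ℕ) (hβ : 0 < β) (ha : -1 < a) (hb : -1 < b) :
    normConst (n + 1) β a b * betaConst β a b n = normConst n β a b := by
  have hG : ∀ x : ℝ, 0 ≤ x → Real.Gamma (a + b + 2 + x) ≠ 0 := fun x hx =>
    (Real.Gamma_pos_of_pos (by linarith)).ne'
  have hA : ∀ x : ℝ, 0 ≤ x → Real.Gamma (a + 1 + x) ≠ 0 := fun x hx =>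
    (Real.Gamma_pos_of_pos (by linarith)).ne'
  have hB : ∀ x : ℝ, 0 ≤ x → Real.Gamma (b + 1 + x) ≠ 0 := fun x hx =>
    (Real.Gamma_pos_of_pos (by linarith)).ne'
  have h2 : (2 : ℝ) ^ (((n + 1 : ℕ) : ℝ) * (a + b + 1) + β / 4 * (n + 1 : ℕ) *
      (((n + 1 : ℕ) : ℝ) - 1)) * 2 ^ (1 - paramS β a b n - paramT β b n) =
      2 ^ ((n : ℝ) * (a + b + 1) + β / 4 * n * ((n : ℝ) - 1)) := by
    rw [← Real.rpow_add two_pos]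
    congr 1
    unfold paramS paramT
    push_cast
    split_ifs <;> ring
  unfold normConst betaConst
  rw [← h2]
  rcases Nat.even_or_odd' n with ⟨m, rfl | rfl⟩
  · have e1 : (2 * m + 1 + 1) / 2 = m + 1 := by omega
    have e2 : (2 * m + 1) / 2 = m := by omega
    have e3 : 2 * m / 2 = m := by omega
    have hS : paramS β a b (2 * m) = a + 1 + β / 2 * m := by
      rw [paramS, if_pos (even_two_mul m)]; push_cast; ring
    have hT : paramT β b (2 * m) = b + 1 + β / 2 * m := by
      rw [paramT, if_pos (even_two_mul m)]; push_cast; ring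
    have hST : paramS β a b (2 * m) + paramT β b (2 * m) = a + b + 2 + β / 2 * ((m : ℝ) + m) := by
      rw [hS, hT]; ring
    rw [e1, e2, e3, prod_range_succ, hST, hS, hT]
    have g1 := hG (β / 2 * ((m : ℝ) + m)) (by positivity)
    have g2 := hA (β / 2 * m) (by positivity)
    have g3 := hB (β / 2 * m) (by positivity)
    generalize Real.Gamma (a + b + 2 + β / 2 * ((m : ℝ) + m)) = G at g1 ⊢
    generalize Real.Gamma (a + 1 + β / 2 * m) = A at g2 ⊢
    generalize Real.Gamma (b + 1 + β / 2 * m) = B at g3 ⊢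
    generalize (∏ j ∈ range m, _ : ℝ) = Q
    generalize (∏ j ∈ Icc 1 m, _ : ℝ) = R
    generalize (2 : ℝ) ^ (_ : ℝ) = c1
    generalize (2 : ℝ) ^ (_ : ℝ) = c2
    field_simp
  · have e1 : (2 * m + 1 + 1 + 1) / 2 = m + 1 := by omega
    have e2 : (2 * m + 1 + 1) / 2 = m + 1 := by omega
    have e3 : (2 * m + 1) / 2 = m := by omega
    have hodd : ¬Even (2 * m + 1) := by simp
    have hS : paramS β a b (2 * m + 1) = a + b + 2 + β / 2 * ((m : ℝ) + (0 : ℕ)) := by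
      rw [paramS, if_neg hodd]; push_cast; ring
    have hT : paramT β b (2 * m + 1) = β / 2 * ((m + 1 : ℕ) : ℝ) := by
      rw [paramT, if_neg hodd]; push_cast; ring
    have hST : paramS β a b (2 * m + 1) + paramT β b (2 * m + 1) =
        a + b + 2 + β / 2 * (((m + 1 : ℕ) : ℝ) + (m : ℕ)) := by
      rw [hS, hT]; push_cast; ring
    have htel : (∏ j ∈ range (m + 1), Real.Gamma (a + b + 2 + β / 2 * (((m + 1 : ℕ) : ℝ) + j))) *
        Real.Gamma (a + b + 2 + β / 2 * ((m : ℝ) + (0 : ℕ))) =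
        (∏ j ∈ range (m + 1), Real.Gamma (a + b + 2 + β / 2 * ((m : ℝ) + j))) *
        Real.Gamma (a + b + 2 + β / 2 * (((m + 1 : ℕ) : ℝ) + (m : ℕ))) := by
      rw [prod_range_succ, prod_range_succ']
      have : ∀ j : ℕ, Real.Gamma (a + b + 2 + β / 2 * ((m : ℝ) + (j + 1 : ℕ))) =
          Real.Gamma (a + b + 2 + β / 2 * (((m + 1 : ℕ) : ℝ) + j)) := fun j => by
        congr 1; push_cast; ring
      simp only [this]
      ring
    have g1 := hG (β / 2 * (((m + 1 : ℕ) : ℝ) + (m : ℕ))) (by positivity)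
    have g2 := hG (β / 2 * ((m : ℝ) + (0 : ℕ))) (by positivity)
    have g3 : Real.Gamma (β / 2 * ((m + 1 : ℕ) : ℝ)) ≠ 0 :=
      (Real.Gamma_pos_of_pos (by positivity)).ne'
    have g4 : ∏ j ∈ range (m + 1), Real.Gamma (a + b + 2 + β / 2 * (((m + 1 : ℕ) : ℝ) + j)) ≠ 0 :=
      prod_ne_zero_iff.mpr fun j _ => hG _ (by positivity)
    have g5 : ∏ j ∈ range (m + 1), Real.Gamma (a + b + 2 + β / 2 * ((m : ℝ) + j)) ≠ 0 :=
      prod_ne_zero_iff.mpr fun j _ => hG _ (by positivity)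
    rw [e1, e2, e3, hST, hS, hT, prod_div_distrib, prod_div_distrib,
      Finset.prod_Icc_succ_top (by omega : 1 ≤ m + 1)]
    generalize Real.Gamma (a + b + 2 + β / 2 * (((m + 1 : ℕ) : ℝ) + (m : ℕ))) = G1 at g1 htel ⊢
    generalize Real.Gamma (a + b + 2 + β / 2 * ((m : ℝ) + (0 : ℕ))) = G2 at g2 htel ⊢
    generalize Real.Gamma (β / 2 * ((m + 1 : ℕ) : ℝ)) = G3 at g3 ⊢
    generalize ∏ j ∈ range (m + 1), Real.Gamma (a + b + 2 + β / 2 * (((m + 1 : ℕ) : ℝ) + j)) = Q1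
      at g4 htel ⊢
    generalize ∏ j ∈ range (m + 1), Real.Gamma (a + b + 2 + β / 2 * ((m : ℝ) + j)) = Q2
      at g5 htel ⊢
    generalize (∏ j ∈ range (m + 1), _ : ℝ) = Q
    generalize (∏ j ∈ Icc 1 m, _ : ℝ) = R
    generalize (2 : ℝ) ^ (_ : ℝ) = c1
    generalize (2 : ℝ) ^ (_ : ℝ) = c2
    field_simp
    linear_combination -(c1 * Q * R * c2) * htel

lemma prod_betaConst (n : ℕ) (hβ : 0 < β) (ha : -1 < a) (hb : -1 < b) :
    ∏ k ∈ range n, betaConst β a b k = 1 / normConst n β a b := by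
  induction n with
  | zero => simp [normConst]
  | succ n ih =>
    rw [prod_range_succ, ih, ← normConst_succ n hβ ha hb]
    have h1 := (normConst_pos (n + 1) hβ ha hb).ne'
    have h2 := (betaConst_pos hβ ha hb n).ne'
    field_simp

/-- The density of the law of a Verblunsky coefficient relative to `stepJac`. -/
def weight (β a b : ℝ) (k : ℕ) (x : ℝ) : ℝ :=
  betaConst β a b k * (((1 - x ^ 2) ^ (k + 1)) ^ (β / 4 - 1 / 2) * (1 - x) ^ (a + 1 / 2 - β / 4) *
    (1 + (-1) ^ k * x) ^ (b + 1 / 2 - β / 4))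

lemma measurable_weight (k : ℕ) : Measurable (weight β a b k) := by
  unfold weight; fun_prop

lemma weight_nonneg (hβ : 0 < β) (ha : -1 < a) (hb : -1 < b) (k : ℕ) {x : ℝ}
    (hx : x ∈ Set.Ioo (-1 : ℝ) 1) : 0 ≤ weight β a b k x := by
  have h0 := (betaConst_pos hβ ha hb k).le
  have h1 : 0 ≤ 1 - x := by linarith [hx.2]
  have h2 : 0 ≤ 1 - x ^ 2 := by nlinarith [hx.1, hx.2]
  have h3 : 0 ≤ 1 + (-1) ^ k * x := by
    rcases neg_one_pow_eq_or ℝ k with h | h <;> rw [h] <;> linarith [hx.1, hx.2]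
  unfold weight
  positivity

/-- The exponents of 1 − x and 1 + x are compared. For odd k the value at −1 contributes 1 − x
instead of 1 + x, which is how b enters the first parameter. -/
lemma betaDensity_eq_weight (k : ℕ) {x : ℝ} (hx : x ∈ Set.Ioo (-1 : ℝ) 1) :
    betaDensity (paramS β a b k) (paramT β b k) x = weight β a b k x * stepJac k x := by
  have h1 : 0 < 1 - x := by linarith [hx.2]
  have h2 : 0 < 1 + x := by linarith [hx.1]
  have h3 : (1 - x ^ 2) ^ (k + 1) = (1 - x) ^ (((k + 1 : ℕ) : ℝ)) * (1 + x) ^ ((k + 1 : ℕ) : ℝ) := by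
    rw [Real.rpow_natCast, Real.rpow_natCast, ← mul_pow]; ring
  unfold betaDensity weight stepJac
  rw [h3, Real.mul_rpow (by positivity) (by positivity), ← Real.rpow_mul h1.le,
    ← Real.rpow_mul h2.le, ← Real.rpow_natCast (1 - x), ← Real.rpow_natCast (1 + x), mul_assoc]
  change betaConst β a b k * _ = _
  congr 1
  rcases Nat.even_or_odd' k with ⟨m, rfl | rfl⟩
  · have e1 : (2 * m + 1) / 2 = m := by omega
    have e2 : 2 * m / 2 = m := by omega
    rw [e1, e2, pow_mul, neg_one_sq, one_pow, one_mul]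
    have : paramS β a b (2 * m) - 1 = ((2 * m + 1 : ℕ) : ℝ) * (β / 4 - 1 / 2) +
        (a + 1 / 2 - β / 4) + m := by
      rw [paramS, if_pos (even_two_mul m)]; push_cast; ring
    rw [this]
    have : paramT β b (2 * m) - 1 = ((2 * m + 1 : ℕ) : ℝ) * (β / 4 - 1 / 2) +
        (b + 1 / 2 - β / 4) + m := by
      rw [paramT, if_pos (even_two_mul m)]; push_cast; ring
    rw [this]
    simp only [Real.rpow_add h1, Real.rpow_add h2]
    ring
  · have hodd : ¬Even (2 * m + 1) := by simp
    have e1 : (2 * m + 1 + 1) / 2 = m + 1 := by omega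
    have e2 : (2 * m + 1) / 2 = m := by omega
    rw [e1, e2, pow_succ, pow_mul, neg_one_sq, one_pow, one_mul, neg_one_mul, ← sub_eq_add_neg]
    have : paramS β a b (2 * m + 1) - 1 = ((2 * m + 1 + 1 : ℕ) : ℝ) * (β / 4 - 1 / 2) +
        (a + 1 / 2 - β / 4) + (b + 1 / 2 - β / 4) + (m + 1 : ℕ) := by
      rw [paramS, if_neg hodd]; push_cast; ring
    rw [this]
    have : paramT β b (2 * m + 1) - 1 = ((2 * m + 1 + 1 : ℕ) : ℝ) * (β / 4 - 1 / 2) + m := by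
      rw [paramT, if_neg hodd]; push_cast; ring
    rw [this]
    simp only [Real.rpow_add h1, Real.rpow_add h2]
    ring

lemma betaLaw_eq_weight (k : ℕ) : betaLaw (paramS β a b k) (paramT β b k) =
    (volume.restrict (Set.Ioo (-1 : ℝ) 1)).withDensity fun x =>
      ENNReal.ofReal (weight β a b k x * stepJac k x) := by
  rw [betaLaw_eq]
  refine withDensity_congr_ae ?_
  refine (ae_restrict_iff' measurableSet_Ioo).mpr (Filter.Eventually.of_forall fun x hx => ?_)
  simp only [betaDensity_eq_weight k hx]

/-- The factor of the density that depends only on the coefficients of the polynomial. -/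
def rootDensity (n : ℕ) (β a b : ℝ) (s : Multiset ℂ) : ℝ :=
  1 / normConst n β a b *
    ((s.map fun z => (s.map fun w => 1 - z * conj w).prod).prod).re ^ (β / 4 - 1 / 2) *
    ((s.map fun z => 1 - z).prod).re ^ (a + 1 / 2 - β / 4) *
    ((s.map fun z => 1 + z).prod).re ^ (b + 1 / 2 - β / 4)

lemma density_eq_rootDensity (n : ℕ) (z : Fin n → ℂ) :
    density n β a b z = (∏ j, ∏ k ∈ Ioi j, ‖z k - z j‖) *
      rootDensity n β a b (unordered z : Multiset ℂ) := by
  rw [density, rootDensity, mul_comm]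
  simp only [unordered, Sym.coe_mk, Multiset.map_map, Function.comp_def]
  rfl

lemma exists_szegoCoeff_eq {n : ℕ} {c : Fin n → ℝ} (hc : c ∈ diskSet n) :
    ∃ α : Fin n → ℝ, (∀ k, |α k| < 1) ∧ szegoCoeff α = c ∧ ∀ w : ℕ → ℝ → ℝ,
      coeffDensity w n c = ∏ k : Fin n, w k (α k) := by
  induction n with
  | zero => exact ⟨c, fun k => k.elim0, Subsingleton.elim _ _, fun w => by simp [coeffDensity]⟩
  | succ n ih =>
    rw [diskSet_succ] at hc
    obtain ⟨α, h1, h2, h3⟩ := ih hc.2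
    refine ⟨Fin.snoc α (-c 0), fun k => ?_, ?_, fun w => ?_⟩
    · refine Fin.lastCases ?_ (fun k => ?_) k
      · simpa using hc.1
      · simpa using h1 k
    · rw [szegoCoeff_succ]
      simp only [Fin.snoc_last, Fin.snoc_castSucc, h2]
      exact coeffStep_coeffStepInv hc.1
    · rw [coeffDensity, h3 w, Fin.prod_univ_castSucc]
      simp [mul_comm]

/-- The pair product and the values at ±1 are products over the Verblunsky coefficients; w̄ may be
replaced by w because the zeros are closed under conjugation. All factors are nonnegative, so the
real powers distribute. -/
lemma coeffDensity_weight {n : ℕ} (hβ : 0 < β) (ha : -1 < a) (hb : -1 < b) {c : Fin n → ℝ}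
    (hc : c ∈ diskSet n) :
    coeffDensity (weight β a b) n c = rootDensity n β a b (rootsSym c : Multiset ℂ) := by
  obtain ⟨α, hα, rfl, hw⟩ := exists_szegoCoeff_eq hc
  set e := extendSeq α with he
  have hαe : ∀ k : Fin n, α k = e k := fun k => (extendSeq_apply α k).symm
  have hek : ∀ k ∈ range n, |e k| < 1 := fun k hk => by
    have := hα ⟨k, mem_range.mp hk⟩
    rwa [hαe] at this
  obtain ⟨hm, hd⟩ := szego_monic e n
  have hr : ((rootsSym (szegoCoeff α) : Sym ℂ n) : Multiset ℂ) =
      ((szego e n).map Complex.ofRealHom).roots := by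
    simp only [rootsSym, szegoCoeff, Sym.coe_mk, ← he, monicPoly_coeffVec hm hd]
  have hP := hm.map Complex.ofRealHom
  set s := ((szego e n).map Complex.ofRealHom).roots with hs
  have hcard : Multiset.card s = n := by
    rw [hs, IsAlgClosed.card_roots_eq_natDegree, hm.natDegree_map, hd]
  have h1 : (s.map fun z => (s.map fun w => 1 - z * conj w).prod).prod =
      ((∏ k ∈ range n, (1 - e k ^ 2) ^ (k + 1) : ℝ) : ℂ) := by
    rw [← pairProd_szego, ← hs, pairProd]
    refine congrArg _ (Multiset.map_congr rfl fun z _ => ?_)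
    have hconj : s.map (starRingEnd ℂ) = s := roots_map_conj _
    conv_rhs => rw [← hconj, Multiset.map_map]
    rfl
  have h2 : (s.map fun z => 1 - z).prod = ((∏ k ∈ range n, (1 - e k) : ℝ) : ℂ) := by
    rw [← eval_one_szego, hs, ← eval_eq_prod hP]
    exact (eval_one_map Complex.ofRealHom (szego e n))
  have h3 : (s.map fun z => 1 + z).prod =
      ((∏ k ∈ range n, (1 + (-1) ^ k * e k) : ℝ) : ℂ) := by
    rw [← eval_neg_one_szego]
    have h4 := eval_eq_prod hP (-1)
    have h5 : (s.map fun w => -1 - w).prod = (-1) ^ n * (s.map fun z => 1 + z).prod := by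
      rw [← hcard, ← Multiset.card_map (fun z => 1 + z) s, ← Multiset.prod_map_neg,
        Multiset.map_map]
      refine congrArg _ (Multiset.map_congr rfl fun z _ => ?_)
      simp; ring
    rw [← hs, h5] at h4
    have h6 : ((szego e n).map Complex.ofRealHom).eval (-1) = (((szego e n).eval (-1) : ℝ) : ℂ) := by
      have := eval_map_apply Complex.ofRealHom (p := szego e n) (-1)
      simpa using this
    rw [h6] at h4
    push_cast
    rw [h4, ← mul_assoc, ← mul_pow]
    simp
  rw [hw, hr, rootDensity, h1, h2, h3, Complex.ofReal_re, Complex.ofReal_re, Complex.ofReal_re,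
    ← prod_betaConst n hβ ha hb]
  have hb1 : ∀ k ∈ range n, 0 ≤ 1 - e k := fun k hk => by linarith [(abs_lt.mp (hek k hk)).2]
  have hb2 : ∀ k ∈ range n, 0 ≤ (1 - e k ^ 2) ^ (k + 1) := fun k hk => by
    have := (sq_lt_one_iff_abs_lt_one _).mpr (hek k hk)
    exact pow_nonneg (by linarith) _
  have hb3 : ∀ k ∈ range n, 0 ≤ 1 + (-1) ^ k * e k := fun k hk => by
    have := abs_lt.mp (hek k hk)
    rcases neg_one_pow_eq_or ℝ k with h | h <;> rw [h] <;> linarith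
  rw [← Real.finsetProd_rpow _ _ hb2, ← Real.finsetProd_rpow _ _ hb1,
    ← Real.finsetProd_rpow _ _ hb3, ← prod_mul_distrib, ← prod_mul_distrib, ← prod_mul_distrib,
    prod_range]
  refine prod_congr rfl fun k _ => ?_
  rw [hαe, weight]
  ring

lemma measurable_config (n M : ℕ) : Measurable (config n M) := by
  refine measurable_pi_lambda _ fun j => ?_
  unfold config
  have hmk : ∀ (f g : Params (n - 2 * M) M → ℝ), Measurable f → Measurable g →
      Measurable fun p => (⟨f p, g p⟩ : ℂ) := fun f g hf hg => by
    have : (fun p => (⟨f p, g p⟩ : ℂ)) = fun p => (f p : ℂ) + g p * Complex.I := by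
      ext p; apply Complex.ext <;> simp
    rw [this]
    fun_prop
  split_ifs
  · fun_prop
  · exact hmk _ _ (by fun_prop) (by fun_prop)
  · exact hmk _ _ (by fun_prop) (by fun_prop)

lemma measurable_density (n : ℕ) : Measurable (density n β a b) := by
  unfold density
  fun_prop

lemma eigenvalueLaw_apply (n : ℕ) {T : Set (Sym ℂ n)} (hT : MeasurableSet T) :
    eigenvalueLaw n β a b T = ∑ M ∈ range (n / 2 + 1), (2 : ℝ≥0∞) ^ M *
      ∫⁻ p in paramSet (n - 2 * M) M, ENNReal.ofReal (density n β a b (config n M p)) *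
        T.indicator 1 (unordered (config n M p)) := by
  have hT' := measurable_unordered n hT
  have hdm : Measurable fun z => ENNReal.ofReal (density n β a b z) :=
    (measurable_density n).ennreal_ofReal
  rw [eigenvalueLaw, Measure.map_apply (measurable_unordered n) hT, withDensity_apply _ hT',
    ← lintegral_indicator hT', wedgeMeasure, lintegral_finsetSum_measure]
  refine sum_congr rfl fun M _ => ?_
  rw [lintegral_smul_measure, lintegral_map (hdm.indicator hT') (measurable_config n M), smul_eq_mul]
  congr 1
  refine lintegral_congr fun p => ?_
  by_cases hp : unordered (config n M p) ∈ T
  · rw [Set.indicator_of_mem (show config n M p ∈ unordered ⁻¹' T from hp),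
      Set.indicator_of_mem hp]
    simp
  · rw [Set.indicator_of_notMem (show config n M p ∉ unordered ⁻¹' T from hp),
      Set.indicator_of_notMem hp]
    simp

/-- The law of the zeros of the random Szegő polynomial. -/
lemma hasLaw_rootsSym (n : ℕ) (hβ : 0 < β) (ha : -1 < a) (hb : -1 < b) (ν : ℕ → Measure ℝ)
    [∀ k, SFinite (ν k)] (hν : ∀ k < n, ν k = betaLaw (paramS β a b k) (paramT β b k)) :
    HasLaw rootsSym (eigenvalueLaw n β a b) (szegoLaw ν n) := by
  have hL := szegoLaw_eq_withDensity (w := weight β a b) measurable_weight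
    (fun k x hx => weight_nonneg hβ ha hb k hx) ν n
    fun k hk => (hν k hk).trans (betaLaw_eq_weight k)
  have hae : AEMeasurable (rootsSym : (Fin n → ℝ) → Sym ℂ n) (szegoLaw ν n) := by
    rw [hL]
    exact (aemeasurable_rootsSym n).mono_ac (withDensity_absolutelyContinuous _ _)
  have hDm : Measurable fun c => ENNReal.ofReal (coeffDensity (weight β a b) n c) :=
    (measurable_coeffDensity measurable_weight n).ennreal_ofReal
  refine ⟨hae, Measure.ext fun T hT => ?_⟩
  have hm : AEMeasurable (fun c => T.indicator (1 : Sym ℂ n → ℝ≥0∞) (rootsSym c))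
      (volume.restrict (diskSet n)) :=
    (measurable_one.indicator hT).comp_aemeasurable (aemeasurable_rootsSym n)
  have h1 : (szegoLaw ν n).map rootsSym T =
      ∫⁻ c, T.indicator 1 (rootsSym c) ∂(szegoLaw ν n) := by
    rw [← lintegral_map' (measurable_one.indicator hT).aemeasurable hae, lintegral_indicator_one hT]
  rw [h1, hL, lintegral_withDensity_eq_lintegral_mul₀ hDm.aemeasurable
    hm,
    eigenvalueLaw_apply n hT,
    setLIntegral_congr_fun (measurableSet_diskSet n) (g := fun c =>
      (fun s : Sym ℂ n => ENNReal.ofReal (rootDensity n β a b (s : Multiset ℂ)) *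
        T.indicator 1 s) (rootsSym c))]
  · refine (lintegral_diskSet_rootsSym n (fun s : Sym ℂ n =>
      ENNReal.ofReal (rootDensity n β a b (s : Multiset ℂ)) * T.indicator 1 s)).trans ?_
    refine sum_congr rfl fun M _ => ?_
    congr 1
    refine lintegral_congr fun p => ?_
    rw [density_eq_rootDensity, ENNReal.ofReal_mul (by positivity), mul_assoc]
  · intro c hc
    simp only [Pi.mul_apply, coeffDensity_weight hβ ha hb hc]

end EigenvalueLaw

/-! ### CMV matrices with independent coefficients and their truncations -/

section BetaEnsembles

open Polynomial

lemma map_neg_betaLaw (s t : ℝ) : (betaLaw s t).map (fun x => -x) = betaLaw t s := by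
  refine Measure.ext fun T hT => ?_
  have hm : MeasurableSet ((fun x : ℝ => -x) ⁻¹' T) := measurable_neg hT
  rw [Measure.map_apply measurable_neg hT, betaLaw_eq, betaLaw_eq, withDensity_apply _ hm,
    withDensity_apply _ hT, Measure.restrict_restrict hm, Measure.restrict_restrict hT,
    ← lintegral_indicator (hm.inter measurableSet_Ioo),
    ← lintegral_indicator (hT.inter measurableSet_Ioo), ← lintegral_neg_eq_self]
  refine lintegral_congr fun x => ?_
  by_cases hx : x ∈ T ∩ Set.Ioo (-1 : ℝ) 1
  · have hx' : -x ∈ (fun x : ℝ => -x) ⁻¹' T ∩ Set.Ioo (-1 : ℝ) 1 := by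
      refine ⟨by simpa using hx.1, ?_, ?_⟩ <;> linarith [hx.2.1, hx.2.2]
    rw [Set.indicator_of_mem hx, Set.indicator_of_mem hx']
    congr 1
    unfold betaDensity
    rw [sub_neg_eq_add, ← sub_eq_add_neg, add_comm t s, sub_right_comm 1 t s]
    ring
  · have hx' : -x ∉ (fun x : ℝ => -x) ⁻¹' T ∩ Set.Ioo (-1 : ℝ) 1 := fun h => hx
      ⟨by simpa using h.1, by linarith [h.2.2], by linarith [h.2.1]⟩
    rw [Set.indicator_of_notMem hx, Set.indicator_of_notMem hx']

lemma hasLaw_const_mul_of_sq_eq_one {Ω : Type*} [MeasurableSpace Ω] {P : Measure Ω} {X : Ω → ℝ}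
    {s : ℝ} (h : HasLaw X (betaLaw s s) P) {κ : ℝ} (hκ : κ = 1 ∨ κ = -1) :
    HasLaw (fun ω => κ * X ω) (betaLaw s s) P := by
  rcases hκ with rfl | rfl
  · simpa using h
  · simp only [neg_one_mul]
    exact HasLaw.fun_comp ⟨measurable_neg.aemeasurable, map_neg_betaLaw s s⟩ h

lemma ae_abs_le_one_betaLaw (s t : ℝ) : ∀ᵐ x ∂betaLaw s t, |x| ≤ 1 := by
  rw [betaLaw_eq]
  refine (withDensity_absolutelyContinuous _ _).ae_le ?_
  exact (ae_restrict_iff' measurableSet_Ioo).mpr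
    (Filter.Eventually.of_forall fun x hx => abs_le.mpr ⟨hx.1.le, hx.2.le⟩)

variable {Ω : Type*} [MeasurableSpace Ω] {P : Measure Ω} {n : ℕ} {β a b : ℝ}

lemma hasLaw_szegoCoeff (ν : ℕ → Measure ℝ) [∀ k, IsProbabilityMeasure (ν k)]
    {α : Fin n → Ω → ℝ} (hind : iIndepFun α P) (hlaw : ∀ k, HasLaw (α k) (ν k) P) :
    HasLaw (fun ω => szegoCoeff fun k => α k ω) (szegoLaw ν n) P := by
  have h1 : HasLaw (fun ω k => α k ω) (Measure.pi fun k : Fin n => ν k) P :=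
    hind.hasLaw_pi hlaw
  exact HasLaw.fun_comp ⟨(continuous_szegoCoeff n).aemeasurable, map_szegoCoeff_pi ν n⟩ h1

/-- Common core of the three CMV statements: the matrix enters only through its characteristic
polynomial, and only on the almost sure event that all coefficients lie in [−1, 1]. -/
lemma hasLaw_eigenvalues (hβ : 0 < β) (ha : -1 < a) (hb : -1 < b) {α : Fin n → Ω → ℝ}
    (hind : iIndepFun α P)
    (hlaw : ∀ k, HasLaw (α k) (betaLaw (paramS β a b (k : ℕ)) (paramT β b (k : ℕ))) P)
    (A : Ω → Matrix (Fin n) (Fin n) ℂ)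
    (hA : ∀ ω, (∀ k, |α k ω| ≤ 1) →
      (A ω).charpoly = (szego (extendSeq fun k => α k ω) n).map Complex.ofRealHom) :
    HasLaw (fun ω => eigenvalues (A ω)) (eigenvalueLaw n β a b) P := by
  set ν : ℕ → Measure ℝ := fun k => betaLaw (paramS β a b k) (paramT β b k) with hν
  have hprob : ∀ k, IsProbabilityMeasure (ν k) := fun k =>
    isProbabilityMeasure_betaLaw (paramS_pos hβ ha hb k) (paramT_pos hβ hb k)
  have h1 := hasLaw_szegoCoeff ν hind hlaw
  have h2 := (hasLaw_rootsSym n hβ ha hb ν fun k _ => rfl).fun_comp h1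
  refine h2.congr ?_
  have h3 : ∀ᵐ ω ∂P, ∀ k, |α k ω| ≤ 1 := ae_all_iff.mpr fun k => by
    have h4 := ae_abs_le_one_betaLaw (paramS β a b (k : ℕ)) (paramT β b (k : ℕ))
    rw [← (hlaw k).map_eq] at h4
    exact ae_of_ae_map (hlaw k).aemeasurable h4
  filter_upwards [h3] with ω hω
  obtain ⟨hm, hd⟩ := szego_monic (extendSeq fun k => α k ω) n
  exact eigenvalues_eq_rootsSym _ hm hd (hA ω hω)

/-- The eigenvalues of the random CMV matrix. -/
theorem hasLaw_eigenvalues_cmv (hβ : 0 < β) (ha : -1 < a) (hb : -1 < b) {α : Fin n → Ω → ℝ}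
    (h : IndepBeta P α (paramS β a b) (paramT β b)) :
    HasLaw (fun ω => eigenvalues (cmv fun k => (α k ω : ℂ))) (eigenvalueLaw n β a b) P := by
  refine hasLaw_eigenvalues hβ ha hb h.indep h.law _ fun ω hω => ?_
  refine charpoly_cmv _ _ (fun k => by rw [extendSeq_apply]) fun k hk => ?_
  have := hω ⟨k, hk⟩
  rwa [← extendSeq_apply (fun k => α k ω) ⟨k, hk⟩] at this

lemma charpoly_minor_zero_cmv (α : Fin n → ℝ) {σ : ℝ} (hσ : σ = 1 ∨ σ = -1)
    (hα : ∀ k, |α k| ≤ 1) :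
    (minor 0 (cmv (Fin.snoc (fun k => (α k : ℂ)) (σ : ℂ) : Fin (n + 1) → ℂ))).charpoly =
      (szego (extendSeq fun k => -σ * α k.rev) n).map Complex.ofRealHom := by
  set e : ℕ → ℝ := extendSeq (Fin.snoc α σ : Fin (n + 1) → ℝ) with he
  set b : ℕ → ℝ := extendSeq (fun k => -σ * α k.rev) with hb
  have h1 : ∀ k : Fin (n + 1),
      (Fin.snoc (fun k => (α k : ℂ)) (σ : ℂ) : Fin (n + 1) → ℂ) k = (e k : ℂ) := by
    intro k
    rw [he, extendSeq_apply]
    refine Fin.lastCases ?_ (fun k => ?_) k <;> simp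
  have h2 : e n = σ := by
    have := extendSeq_apply (Fin.snoc α σ : Fin (n + 1) → ℝ) (Fin.last n)
    simpa using this
  have h3 : ∀ k : Fin n, e k = α k := fun k => by
    have := extendSeq_apply (Fin.snoc α σ : Fin (n + 1) → ℝ) k.castSucc
    simpa using this
  have h4 : ∀ k < n, b k = -σ * e (n - 1 - k) := by
    intro k hk
    have h5 : b k = -σ * α (Fin.rev ⟨k, hk⟩) := extendSeq_apply _ (⟨k, hk⟩ : Fin n)
    have h6 : ((Fin.rev ⟨k, hk⟩ : Fin n) : ℕ) = n - 1 - k := by rw [Fin.val_rev]; simp; omega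
    rw [h5, ← h3, h6]
  have h7 : ∀ k < n, |b k| ≤ 1 := by
    intro k hk
    have h5 : b k = -σ * α (Fin.rev ⟨k, hk⟩) := extendSeq_apply _ (⟨k, hk⟩ : Fin n)
    have h6 : |-σ| = 1 := by rcases hσ with h | h <;> simp [h]
    rw [h5, abs_mul, h6, one_mul]
    exact hα _
  rw [cmv_ofReal _ e h1]
  have h8 : minor 0 ((realFactor 0 (n + 1) e * realFactor 1 (n + 1) e).map Complex.ofReal) =
      (minor 0 (realFactor 0 (n + 1) e * realFactor 1 (n + 1) e)).map Complex.ofRealHom := rfl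
  rw [h8, Matrix.charpoly_map, charpoly_minor_zero_realCmv n e b σ hσ h2 h4,
    charpoly_realCmv n b h7]

lemma hasLaw_eigenvalues_minor_cmv (hβ : 0 < β) (ha : -1 < a) (hb : -1 < b) {σ : ℝ}
    (hσ : σ = 1 ∨ σ = -1) {α : Fin n → Ω → ℝ} (hind : iIndepFun α P)
    (hlaw : ∀ k : Fin n, HasLaw (fun ω => -σ * α k.rev ω)
      (betaLaw (paramS β a b (k : ℕ)) (paramT β b (k : ℕ))) P) :
    HasLaw (fun ω => eigenvalues (minor 0
      (cmv (Fin.snoc (fun k => (α k ω : ℂ)) (σ : ℂ) : Fin (n + 1) → ℂ))))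
      (eigenvalueLaw n β a b) P := by
  have hind' : iIndepFun (fun (k : Fin n) ω => -σ * α k.rev ω) P :=
    (hind.precomp (g := Fin.rev) Fin.rev_injective).comp (fun _ x => -σ * x)
      fun _ => measurable_const_mul _
  refine hasLaw_eigenvalues hβ ha hb hind' hlaw _ fun ω hω => ?_
  refine charpoly_minor_zero_cmv (fun k => α k ω) hσ fun k => ?_
  have h1 := hω k.rev
  have h6 : |-σ| = 1 := by rcases hσ with h | h <;> simp [h]
  rwa [Fin.rev_rev, abs_mul, h6, one_mul] at h1

/-- Truncations of the real orthogonal `β`-ensemble of even size and determinant one. -/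
theorem hasLaw_eigenvalues_minor_cmv_of_odd (hn : Odd n) (hβ : 0 < β) (ha : -1 < a) (hb : -1 < b)
    {α : Fin n → Ω → ℝ}
    (h : IndepBeta P α
      (fun k => if Even k then ((n : ℝ) - 1 - k) / 4 * β + a + 1
        else ((n : ℝ) - 2 - k) / 4 * β + a + b + 2)
      (fun k => if Even k then ((n : ℝ) - 1 - k) / 4 * β + b + 1 else ((n : ℝ) - k) / 4 * β)) :
    HasLaw (fun ω => eigenvalues (minor 0
      (cmv (Fin.snoc (fun k => (α k ω : ℂ)) (-1) : Fin (n + 1) → ℂ))))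
      (eigenvalueLaw n β a b) P := by
  have key := hasLaw_eigenvalues_minor_cmv hβ ha hb (σ := -1) (Or.inr rfl) h.indep fun k => by
    have h1 := h.law k.rev
    have h2 : ((k.rev : ℕ) : ℝ) = (n : ℝ) - 1 - k := by
      have : (k.rev : ℕ) + k + 1 = n := by rw [Fin.val_rev]; omega
      have h3 : ((k.rev : ℕ) : ℝ) + k + 1 = n := by exact_mod_cast this
      linarith
    -- For odd n the reversal k ↦ n − 1 − k preserves parity, so it does not interchange the even
    -- and the odd family of laws.
    have h3 : Even (k.rev : ℕ) ↔ Even (k : ℕ) := by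
      obtain ⟨m, rfl⟩ := hn
      rw [Fin.val_rev, Nat.even_sub (by omega)]
      have : ¬ Even (k + 1 : ℕ) ↔ Even (k : ℕ) := by rw [Nat.even_add_one, not_not]
      have h4 : ¬ Even (2 * m + 1) := by simp
      tauto
    simp only [h2, h3] at h1
    have e1 : paramS β a b (k : ℕ) = if Even (k : ℕ) then
        ((n : ℝ) - 1 - ((n : ℝ) - 1 - k)) / 4 * β + a + 1
        else ((n : ℝ) - 2 - ((n : ℝ) - 1 - k)) / 4 * β + a + b + 2 := by
      unfold paramS; split_ifs <;> ring
    have e2 : paramT β b (k : ℕ) = if Even (k : ℕ) then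
        ((n : ℝ) - 1 - ((n : ℝ) - 1 - k)) / 4 * β + b + 1
        else ((n : ℝ) - ((n : ℝ) - 1 - k)) / 4 * β := by
      unfold paramT; split_ifs <;> ring
    rw [e1, e2]
    simpa using h1
  simpa using key

/-- For these a = b the formulas for even and odd k coincide, so the reversal needs no condition on
the parity of n. -/
lemma betaLaw_params_eq_of_eq (β : ℝ) (k : ℕ) :
    paramS β (-1 + β / 4) (-1 + β / 4) k = ((k : ℝ) + 1) / 4 * β ∧
      paramT β (-1 + β / 4) k = ((k : ℝ) + 1) / 4 * β := by
  unfold paramS paramT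
  constructor <;> split_ifs <;> ring

/-- Truncations of the real orthogonal `β`-ensembles. -/
theorem hasLaw_eigenvalues_minor_cmv_of_eq (hβ : 0 < β) {σ : ℝ} (hσ : σ = 1 ∨ σ = -1)
    {α : Fin n → Ω → ℝ}
    (h : IndepBeta P α (fun k => ((n : ℝ) - k) / 4 * β) (fun k => ((n : ℝ) - k) / 4 * β)) :
    HasLaw (fun ω => eigenvalues (minor 0
      (cmv (Fin.snoc (fun k => (α k ω : ℂ)) (σ : ℂ) : Fin (n + 1) → ℂ))))
      (eigenvalueLaw n β (-1 + β / 4) (-1 + β / 4)) P := by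
  refine hasLaw_eigenvalues_minor_cmv hβ (by linarith) (by linarith) hσ h.indep fun k => ?_
  have h1 := h.law k.rev
  have h2 : (n : ℝ) - (k.rev : ℕ) = (k : ℝ) + 1 := by
    have : (k.rev : ℕ) + k + 1 = n := by rw [Fin.val_rev]; omega
    have h3 : ((k.rev : ℕ) : ℝ) + k + 1 = n := by exact_mod_cast this
    linarith
  simp only [h2] at h1
  rw [(betaLaw_params_eq_of_eq β k).1, (betaLaw_params_eq_of_eq β k).2]
  exact hasLaw_const_mul_of_sq_eq_one h1 (by rcases hσ with h | h <;> simp [h])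

end BetaEnsembles

/-! ### Truncations of orthogonal matrices by reflections -/

section Householder

open Matrix Polynomial

variable {N n : ℕ}

/-- The reflection in the hyperplane orthogonal to the unit vector `w`. -/
def householder (w : Fin N → ℝ) : Matrix (Fin N) (Fin N) ℝ := 1 - (2 : ℝ) • vecMulVec w w

lemma householder_transpose (w : Fin N → ℝ) : (householder w)ᵀ = householder w := by
  simp [householder, transpose_vecMulVec]

lemma householder_mul_self {w : Fin N → ℝ} (hw : w ⬝ᵥ w = 1) :
    householder w * householder w = 1 := by
  have h : vecMulVec w w * vecMulVec w w = vecMulVec w w := by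
    rw [vecMulVec_mul_vecMulVec, hw]; simp
  simp only [householder, sub_mul, mul_sub, one_mul, mul_one, smul_mul_smul_comm, h]
  module

lemma det_householder {w : Fin N → ℝ} (hw : w ⬝ᵥ w = 1) : (householder w).det = -1 := by
  have h : householder w = 1 + replicateCol Unit ((-2 : ℝ) • w) * replicateRow Unit w := by
    ext i j
    simp [householder, vecMulVec_apply, Matrix.mul_apply]
    ring
  rw [h, det_one_add_replicateCol_mul_replicateRow, dotProduct_smul, hw]
  norm_num

lemma householder_mulVec (w v : Fin N → ℝ) :
    householder w *ᵥ v = v - (2 * (w ⬝ᵥ v)) • w := by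
  rw [householder, sub_mulVec, one_mulVec, smul_mulVec, vecMulVec_mulVec]
  ext i
  simp
  ring

/-- The reflection exchanging e_0 and x has normal e_0 − x, of squared length 2(1 − x_0). -/
lemma exists_householder {x : Fin (n + 1) → ℝ} (hx : x ⬝ᵥ x = 1) (hne : x ≠ Pi.single 0 1) :
    ∃ w : Fin (n + 1) → ℝ, w ⬝ᵥ w = 1 ∧ householder w *ᵥ Pi.single 0 1 = x := by
  set y : Fin (n + 1) → ℝ := Pi.single 0 1 - x with hy
  have hyy : y ⬝ᵥ y = 2 * (1 - x 0) := by
    simp [hy, sub_dotProduct, dotProduct_sub, hx]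
    ring
  have hy0 : 0 < y ⬝ᵥ y := by
    refine lt_of_le_of_ne (sum_nonneg fun i _ => mul_self_nonneg (y i)) fun h => hne ?_
    have := dotProduct_self_eq_zero.mp h.symm
    exact (sub_eq_zero.mp this).symm
  have hsq : √(y ⬝ᵥ y) * √(y ⬝ᵥ y) = y ⬝ᵥ y := Real.mul_self_sqrt hy0.le
  have hs : √(y ⬝ᵥ y) ≠ 0 := (Real.sqrt_pos.mpr hy0).ne'
  refine ⟨(√(y ⬝ᵥ y))⁻¹ • y, ?_, ?_⟩
  · rw [smul_dotProduct, dotProduct_smul, smul_eq_mul, smul_eq_mul]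
    field_simp
    rw [sq, hsq]
  · have h1 : y ⬝ᵥ Pi.single 0 1 = 1 - x 0 := by simp [hy]
    rw [householder_mulVec, smul_dotProduct, h1, smul_smul, smul_eq_mul]
    have h2 : 2 * ((√(y ⬝ᵥ y))⁻¹ * (1 - x 0)) * (√(y ⬝ᵥ y))⁻¹ = 1 := by
      field_simp
      rw [sq, hsq, hyy]
    rw [h2, one_smul, hy]
    abel

/-- A sign change of the second coordinate fixes e_0 and corrects the determinant −1 of the
reflection. -/
lemma exists_rotation {x : Fin (n + 2) → ℝ} (hx : x ⬝ᵥ x = 1) :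
    ∃ R : Matrix (Fin (n + 2)) (Fin (n + 2)) ℝ,
      Rᵀ * R = 1 ∧ R.det = 1 ∧ R *ᵥ Pi.single 0 1 = x := by
  by_cases hne : x = Pi.single 0 1
  · exact ⟨1, by simp, by simp, by rw [one_mulVec, hne]⟩
  · obtain ⟨w, hw, h⟩ := exists_householder hx hne
    set d : Fin (n + 2) → ℝ := Function.update 1 1 (-1) with hd
    have hdd : diagonal d * diagonal d = 1 := by
      rw [diagonal_mul_diagonal, ← diagonal_one]
      congr 1
      ext i
      by_cases hi : i = 1 <;> simp [hd, hi]
    refine ⟨householder w * diagonal d, ?_, ?_, ?_⟩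
    · rw [transpose_mul, diagonal_transpose, householder_transpose, Matrix.mul_assoc,
        ← Matrix.mul_assoc (householder w), householder_mul_self hw, Matrix.one_mul, hdd]
    · rw [det_mul, det_householder hw, det_diagonal, hd, Finset.prod_update_of_mem (mem_univ _)]
      simp
    · rw [← mulVec_mulVec, ← h]
      congr 1
      ext i
      rw [mulVec_diagonal]
      by_cases hi : i = 0
      · simp [hd, hi]
      · simp [hi]

/-- In dimension one the identity is the only rotation, so `s` must be allowed to carry a sign. -/
lemma exists_rotation_smul (x : Fin (n + 1) → ℝ) :
    ∃ R : Matrix (Fin (n + 1)) (Fin (n + 1)) ℝ, ∃ s : ℝ,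
      Rᵀ * R = 1 ∧ R.det = 1 ∧ x = s • R *ᵥ Pi.single 0 1 := by
  rcases n with _ | n
  · refine ⟨1, x 0, by simp, by simp, ?_⟩
    ext i
    fin_cases i
    simp
  · by_cases hx : x = 0
    · exact ⟨1, 0, by simp, by simp, by simp [hx]⟩
    · have h0 : 0 < x ⬝ᵥ x := lt_of_le_of_ne (sum_nonneg fun i _ => mul_self_nonneg (x i)) fun h =>
        hx (dotProduct_self_eq_zero.mp h.symm)
      have hs : √(x ⬝ᵥ x) ≠ 0 := (Real.sqrt_pos.mpr h0).ne'
      have hsq : √(x ⬝ᵥ x) * √(x ⬝ᵥ x) = x ⬝ᵥ x := Real.mul_self_sqrt h0.le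
      obtain ⟨R, h1, h2, h3⟩ := exists_rotation (x := (√(x ⬝ᵥ x))⁻¹ • x) (by
        rw [smul_dotProduct, dotProduct_smul, smul_eq_mul, smul_eq_mul]
        field_simp
        rw [sq, hsq])
      exact ⟨R, √(x ⬝ᵥ x), h1, h2, by rw [h3, smul_smul, mul_inv_cancel₀ hs, one_smul]⟩

/-- Let H be a reflection taking e_0 to the first row of A. Then AH is orthogonal with first row
e_0, hence of the form 1 ⊕ W, and A = (AH)H expresses the minor through W and the truncation of H.
-/
lemma exists_minor_eq_mul {A : Matrix (Fin (n + 2)) (Fin (n + 2)) ℝ} (hA : Aᵀ * A = 1) :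
    ∃ (w : Fin (n + 2) → ℝ) (W : Matrix (Fin (n + 1)) (Fin (n + 1)) ℝ), w ⬝ᵥ w = 1 ∧
      Wᵀ * W = 1 ∧ W.det = -A.det ∧ A 0 0 = 1 - 2 * w 0 ^ 2 ∧
      minor 0 A = W * householder fun i => w i.succ := by
  have hA' : A * Aᵀ = 1 := mul_eq_one_comm.mp hA
  have hx : A 0 ⬝ᵥ A 0 = 1 := by
    have := congrFun (congrFun hA' 0) 0
    simpa [Matrix.mul_apply, dotProduct] using this
  obtain ⟨w, hw, hH⟩ : ∃ w : Fin (n + 2) → ℝ, w ⬝ᵥ w = 1 ∧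
      householder w *ᵥ Pi.single 0 1 = A 0 := by
    by_cases hne : A 0 = Pi.single 0 1
    -- If the row is already e_0, a reflection fixing e_0 is taken instead of the identity, so that
    -- the determinant still changes sign.
    · refine ⟨Pi.single 1 1, by simp, ?_⟩
      rw [householder_mulVec, hne]
      simp
    · exact exists_householder hx hne
  have hHH := householder_mul_self hw
  set H := householder w with hHdef
  have hHt : Hᵀ = H := householder_transpose w
  set B := A * H with hB
  have hAB : A = B * H := by rw [hB, Matrix.mul_assoc, hHH, Matrix.mul_one]
  have hBB : Bᵀ * B = 1 := by
    rw [hB, transpose_mul, hHt, Matrix.mul_assoc, ← Matrix.mul_assoc Aᵀ, hA, Matrix.one_mul, hHH]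
  have hrow : B 0 = Pi.single 0 1 := by
    have h1 : B 0 = H *ᵥ A 0 := by
      have : B 0 = A 0 ᵥ* H := rfl
      rw [this, ← hHt, vecMul_transpose, hHt]
    rw [h1, ← hH, mulVec_mulVec, hHH, one_mulVec]
  have hcol : ∀ i : Fin (n + 1), B i.succ 0 = 0 := by
    have h1 : ∑ i, B i 0 * B i 0 = 1 := by
      have := congrFun (congrFun hBB 0) 0
      simpa [Matrix.mul_apply] using this
    rw [Fin.sum_univ_succ, hrow] at h1
    have h2 : ∑ i : Fin (n + 1), B i.succ 0 * B i.succ 0 = 0 := by simpa using h1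
    intro i
    have := (sum_eq_zero_iff_of_nonneg fun i _ => mul_self_nonneg _).mp h2 i (mem_univ _)
    simpa using this
  refine ⟨w, minor 0 B, hw, ?_, ?_, ?_, ?_⟩
  · ext i j
    have h1 := congrFun (congrFun hBB i.succ) j.succ
    rw [Matrix.mul_apply, Fin.sum_univ_succ] at h1
    simpa [hrow, minor, Matrix.mul_apply, Matrix.one_apply] using h1
  · have h1 : B.det = -A.det := by rw [hB, det_mul, det_householder hw]; ring
    have h2 := det_succ_row_zero B
    rw [Fin.sum_univ_succ, hrow] at h2
    rw [← h1, h2]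
    simp [minor]
  · have h1 := congrFun hH 0
    rw [← h1, hHdef, householder_mulVec]
    simp
    ring
  · conv_lhs => rw [hAB]
    rw [minor_mul_of_col _ _ _ (fun i => by simpa using hcol i)]
    congr 1
    ext i j
    simp [minor, hHdef, householder, vecMulVec_apply, Matrix.one_apply]

/-- The characteristic polynomial of a rotated truncation of an orthogonal matrix. -/
lemma exists_charpoly_mul_minor_zero {A : Matrix (Fin (n + 2)) (Fin (n + 2)) ℝ}
    (hA : Aᵀ * A = 1) :
    ∃ R O : Matrix (Fin (n + 1)) (Fin (n + 1)) ℝ, Rᵀ * R = 1 ∧ R.det = 1 ∧ Oᵀ * O = 1 ∧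
      ∀ V : Matrix (Fin (n + 1)) (Fin (n + 1)) ℝ, Vᵀ * V = 1 → V.det = 1 →
        (V * minor 0 A).charpoly =
          szegoStep n ((-1) ^ n * (A.det * A 0 0)) (minor 0 (Rᵀ * V * O)).charpoly := by
  obtain ⟨w, W, hw, hW, hdet, hu, hmin⟩ := exists_minor_eq_mul hA
  obtain ⟨R, s, hR, hRdet, hs⟩ := exists_rotation_smul fun i => w i.succ
  have hR' : R * Rᵀ = 1 := mul_eq_one_comm.mp hR
  have hO : (W * R)ᵀ * (W * R) = 1 := by
    rw [transpose_mul, Matrix.mul_assoc, ← Matrix.mul_assoc Wᵀ, hW, Matrix.one_mul, hR]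
  refine ⟨R, W * R, hR, hRdet, hO, fun V hV hVdet => ?_⟩
  set e : Fin (n + 1) → ℝ := Pi.single 0 1 with he
  have hee : e ⬝ᵥ e = 1 := by simp [he]
  have hs2 : 1 - 2 * s ^ 2 = -A 0 0 := by
    have h1 : w ⬝ᵥ w = w 0 ^ 2 + (fun i : Fin (n + 1) => w i.succ) ⬝ᵥ (fun i => w i.succ) := by
      rw [dotProduct, Fin.sum_univ_succ, dotProduct, sq]
    have h2 : (R *ᵥ e) ⬝ᵥ (R *ᵥ e) = 1 := by
      rw [dotProduct_mulVec, ← mulVec_transpose, mulVec_mulVec, hR, one_mulVec, hee]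
    rw [hw, hs, smul_dotProduct, dotProduct_smul, h2, smul_eq_mul, smul_eq_mul] at h1
    rw [hu]
    linarith
  -- In coordinates rotated by R the truncated reflection only scales the first coordinate, by 1 −
  -- 2s²; since w is a unit vector this is −A_00.
  have hE : householder (fun i : Fin (n + 1) => w i.succ) =
      R * diagonal (Function.update 1 0 (-A 0 0)) * Rᵀ := by
    have h1 : (diagonal (Function.update (1 : Fin (n + 1) → ℝ) 0 (-A 0 0))) =
        1 - (2 * s ^ 2) • vecMulVec e e := by
      rw [← hs2]
      ext i j
      rcases eq_or_ne i j with rfl | hij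
      · by_cases hi : i = 0 <;> simp [he, hi, vecMulVec_apply]
      · have : e i * e j = 0 := by
          by_cases hi : i = 0
          · have hj : j ≠ 0 := fun h => hij (hi.trans h.symm)
            simp [he, hj]
          · simp [he, hi]
        simp [hij, vecMulVec_apply, this]
    rw [h1, Matrix.mul_sub, Matrix.sub_mul, Matrix.mul_one, hR', Matrix.mul_smul, Matrix.smul_mul,
      mul_vecMulVec, vecMulVec_mul, vecMul_transpose, householder, hs, smul_vecMulVec,
      vecMulVec_smul, smul_smul, smul_smul]
    congr 2
    ring
  have hB : (Rᵀ * V * (W * R))ᵀ * (Rᵀ * V * (W * R)) = 1 := by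
    rw [transpose_mul (Rᵀ * V), transpose_mul Rᵀ V, transpose_transpose]
    calc (W * R)ᵀ * (Vᵀ * R) * (Rᵀ * V * (W * R))
        = (W * R)ᵀ * (Vᵀ * (R * Rᵀ) * V) * (W * R) := by simp only [Matrix.mul_assoc]
      _ = 1 := by rw [hR', Matrix.mul_one, hV, Matrix.mul_one, hO]
  have hBdet : (Rᵀ * V * (W * R)).det = -A.det := by
    rw [det_mul, det_mul, det_mul, det_transpose, hRdet, hVdet, hdet]; ring
  -- By cyclic invariance, V times the minor has the characteristic polynomial of RᵀVWR with row 0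
  -- scaled by −A_00. That orthogonal matrix has determinant −det A, so the two signs cancel in γ.
  have key := charpoly_updateRow_smul_of_orthogonal _ hB 0 (-A 0 0)
  rw [updateRow_smul_eq_diagonal_mul, hBdet] at key
  rw [hmin, hE, show V * (W * (R * diagonal (Function.update 1 0 (-A 0 0)) * Rᵀ)) =
    (V * (W * R)) * (diagonal (Function.update 1 0 (-A 0 0)) * Rᵀ) by
      simp only [Matrix.mul_assoc], charpoly_mul_comm,
    show diagonal (Function.update 1 0 (-A 0 0)) * Rᵀ * (V * (W * R)) =
      diagonal (Function.update 1 0 (-A 0 0)) * (Rᵀ * V * (W * R)) by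
      simp only [Matrix.mul_assoc], key, szegoStep]
  congr 3
  ring

end Householder

/-! ### A coordinate of a uniformly distributed direction -/

section Direction

variable {n : ℕ}

/-- The Euclidean norm. -/
def euclNorm (y : Fin n → ℝ) : ℝ := √(∑ i, y i ^ 2)

lemma euclNorm_nonneg (y : Fin n → ℝ) : 0 ≤ euclNorm y := Real.sqrt_nonneg _

lemma euclNorm_sq (y : Fin n → ℝ) : euclNorm y ^ 2 = ∑ i, y i ^ 2 :=
  Real.sq_sqrt (sum_nonneg fun _ _ => sq_nonneg _)

lemma continuous_euclNorm : Continuous (euclNorm : (Fin n → ℝ) → ℝ) := by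
  unfold euclNorm; fun_prop

lemma euclNorm_smul (c : ℝ) (y : Fin n → ℝ) : euclNorm (c • y) = |c| * euclNorm y := by
  have : ∑ i, (c • y) i ^ 2 = c ^ 2 * ∑ i, y i ^ 2 := by
    rw [mul_sum]
    exact sum_congr rfl fun i _ => by simp [mul_pow]
  rw [euclNorm, this, Real.sqrt_mul (sq_nonneg c), Real.sqrt_sq_eq_abs, euclNorm]

lemma euclNorm_pos {y : Fin n → ℝ} (hy : y ≠ 0) : 0 < euclNorm y := by
  obtain ⟨i, hi⟩ := Function.ne_iff.mp hy
  exact Real.sqrt_pos.mpr (lt_of_lt_of_le (pow_pos (abs_pos.mpr hi) 2 |>.trans_eq (sq_abs _))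
    (single_le_sum (f := fun i => y i ^ 2) (fun _ _ => sq_nonneg _) (mem_univ i)))

lemma sqrt_one_sub_sq_pos {t : ℝ} (ht : t ∈ Set.Ioo (-1 : ℝ) 1) : 0 < √(1 - t ^ 2) :=
  Real.sqrt_pos.mpr (by nlinarith [ht.1, ht.2])

lemma sq_sqrt_one_sub_sq {t : ℝ} (ht : t ∈ Set.Ioo (-1 : ℝ) 1) : √(1 - t ^ 2) ^ 2 = 1 - t ^ 2 :=
  Real.sq_sqrt (by nlinarith [ht.1, ht.2])

lemma div_sqrt_add_sq {r t : ℝ} (hr : 0 < r) (ht : t ∈ Set.Ioo (-1 : ℝ) 1) :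
    √((r * t / √(1 - t ^ 2)) ^ 2 + r ^ 2) = r / √(1 - t ^ 2) := by
  have h1 := sqrt_one_sub_sq_pos ht
  have h2 := sq_sqrt_one_sub_sq ht
  have h3 : (r * t / √(1 - t ^ 2)) ^ 2 + r ^ 2 = (r / √(1 - t ^ 2)) ^ 2 := by
    field_simp
    rw [h2]; ring
  rw [h3, Real.sqrt_sq (by positivity)]

/-- The substitution `x = r t / √(1 - t²)`. -/
lemma lintegral_eq_lintegral_Ioo {r : ℝ} (hr : 0 < r) (h : ℝ → ℝ≥0∞) :
    ∫⁻ x, h x = ∫⁻ t in Set.Ioo (-1 : ℝ) 1,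
      ENNReal.ofReal (r / √(1 - t ^ 2) ^ 3) * h (r * t / √(1 - t ^ 2)) := by
  set f : ℝ → ℝ := fun t => r * t / √(1 - t ^ 2) with hf
  have hback : ∀ t ∈ Set.Ioo (-1 : ℝ) 1, f t / √(f t ^ 2 + r ^ 2) = t := fun t ht => by
    have h1 := sqrt_one_sub_sq_pos ht
    rw [hf]
    simp only
    rw [div_sqrt_add_sq hr ht]
    field_simp
  have himg : f '' Set.Ioo (-1 : ℝ) 1 = Set.univ := by
    refine Set.eq_univ_of_forall fun x => ?_
    have h1 : 0 < x ^ 2 + r ^ 2 := by positivity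
    have h2 : √(x ^ 2 + r ^ 2) ^ 2 = x ^ 2 + r ^ 2 := Real.sq_sqrt h1.le
    have h3 : 0 < √(x ^ 2 + r ^ 2) := Real.sqrt_pos.mpr h1
    have h4 : 1 - (x / √(x ^ 2 + r ^ 2)) ^ 2 = (r / √(x ^ 2 + r ^ 2)) ^ 2 := by
      field_simp
      rw [h2]; ring
    refine ⟨x / √(x ^ 2 + r ^ 2), ?_, ?_⟩
    · have h5 : 0 < (r / √(x ^ 2 + r ^ 2)) ^ 2 := by positivity
      exact abs_lt.mp ((sq_lt_one_iff_abs_lt_one _).mp (by linarith))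
    · simp only [hf]
      rw [h4, Real.sqrt_sq (by positivity)]
      field_simp
  have hinj : Set.InjOn f (Set.Ioo (-1 : ℝ) 1) := fun s hs t ht hst => by
    rw [← hback s hs, ← hback t ht, hst]
  have hderiv : ∀ t ∈ Set.Ioo (-1 : ℝ) 1,
      HasDerivWithinAt f (r / √(1 - t ^ 2) ^ 3) (Set.Ioo (-1 : ℝ) 1) t := fun t ht => by
    have h1 := sqrt_one_sub_sq_pos ht
    have h2 := sq_sqrt_one_sub_sq ht
    have h3 : HasDerivAt (fun t : ℝ => 1 - t ^ 2) (-(2 * t)) t := by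
      simpa using (hasDerivAt_pow 2 t).const_sub 1
    have h4 := h3.sqrt (by nlinarith [ht.1, ht.2])
    have h5 : HasDerivAt (fun t : ℝ => r * t) r t := by simpa using (hasDerivAt_id t).const_mul r
    have h6 := h5.div h4 h1.ne'
    refine (h6.congr_deriv ?_).hasDerivWithinAt
    field_simp
    rw [h2]; ring
  have key := lintegral_image_eq_lintegral_abs_deriv_mul measurableSet_Ioo hderiv hinj h
  rw [himg, Measure.restrict_univ] at key
  rw [key]
  refine setLIntegral_congr_fun measurableSet_Ioo fun t ht => ?_
  have h1 := sqrt_one_sub_sq_pos ht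
  rw [abs_of_pos (by positivity)]

/-- The open Euclidean unit ball. -/
def euclBall (n : ℕ) : Set (Fin n → ℝ) := {y | euclNorm y < 1}

lemma isOpen_euclBall (n : ℕ) : IsOpen (euclBall n) :=
  isOpen_lt continuous_euclNorm continuous_const

lemma volume_euclBall_ne_zero (n : ℕ) : volume (euclBall n) ≠ 0 :=
  ((isOpen_euclBall n).measure_pos volume ⟨0, by simp [euclBall, euclNorm]⟩).ne'

lemma volume_euclBall_ne_top (n : ℕ) : volume (euclBall n) ≠ ∞ := by
  refine ne_top_of_le_ne_top (isCompact_Icc (a := fun _ : Fin n => (-1 : ℝ))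
    (b := fun _ => 1)).measure_lt_top.ne (measure_mono fun y hy => ?_)
  have h1 : ∀ i, |y i| ≤ 1 := fun i => by
    rw [← sq_le_one_iff_abs_le_one]
    have h2 := single_le_sum (f := fun i => y i ^ 2) (fun _ _ => sq_nonneg _) (mem_univ i)
    have h3 : euclNorm y < 1 := hy
    have h4 := euclNorm_sq y
    have h5 := euclNorm_nonneg y
    nlinarith
  exact ⟨fun i => (abs_le.mp (h1 i)).1, fun i => (abs_le.mp (h1 i)).2⟩

/-- Dilation by ρ contributes ρ^n from the volume and one more ρ from the integrand. -/
lemma lintegral_euclNorm_scale {ρ : ℝ} (hρ : 0 < ρ) :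
    ∫⁻ y in {y : Fin n → ℝ | euclNorm y < ρ}, ENNReal.ofReal (euclNorm y) =
      ENNReal.ofReal (ρ ^ (n + 1)) * ∫⁻ y in euclBall n, ENNReal.ofReal (euclNorm y) := by
  have hm : MeasurableSet {y : Fin n → ℝ | euclNorm y < ρ} :=
    (isOpen_lt continuous_euclNorm continuous_const).measurableSet
  have hmap := Measure.map_addHaar_smul (volume : Measure (Fin n → ℝ)) hρ.ne'
  rw [Module.finrank_fin_fun, abs_of_pos (by positivity)] at hmap
  have hvol : (volume : Measure (Fin n → ℝ)) =
      ENNReal.ofReal (ρ ^ n) • Measure.map (ρ • ·) (volume : Measure (Fin n → ℝ)) := by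
    rw [hmap, smul_smul, ← ENNReal.ofReal_mul (by positivity),
      mul_inv_cancel₀ (by positivity), ENNReal.ofReal_one, one_smul]
  have hfm : Measurable (fun y : Fin n → ℝ =>
      {y : Fin n → ℝ | euclNorm y < ρ}.indicator (fun y => ENNReal.ofReal (euclNorm y)) y) :=
    (continuous_euclNorm.measurable.ennreal_ofReal).indicator hm
  rw [← lintegral_indicator hm, ← lintegral_indicator (isOpen_euclBall n).measurableSet]
  conv_lhs => rw [hvol]
  rw [lintegral_smul_measure, lintegral_map hfm (measurable_const_smul ρ), smul_eq_mul, pow_succ,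
    ENNReal.ofReal_mul (by positivity), mul_assoc]
  congr 1
  rw [← lintegral_const_mul' _ _ ENNReal.ofReal_ne_top]
  refine lintegral_congr fun y => ?_
  have h1 : euclNorm (ρ • y) = ρ * euclNorm y := by rw [euclNorm_smul, abs_of_pos hρ]
  by_cases hy : y ∈ euclBall n
  · have : ρ • y ∈ {y : Fin n → ℝ | euclNorm y < ρ} := by
      change euclNorm (ρ • y) < ρ
      rw [h1]
      have : euclNorm y < 1 := hy
      nlinarith
    rw [Set.indicator_of_mem this, Set.indicator_of_mem hy, h1, ENNReal.ofReal_mul hρ.le]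
  · have : ρ • y ∉ {y : Fin n → ℝ | euclNorm y < ρ} := fun h => hy (by
      change euclNorm (ρ • y) < ρ at h
      rw [h1] at h
      change euclNorm y < 1
      nlinarith)
    rw [Set.indicator_of_notMem this, Set.indicator_of_notMem hy, mul_zero]

lemma euclNorm_cons (x : ℝ) (y : Fin n → ℝ) :
    euclNorm (Fin.cons x y : Fin (n + 1) → ℝ) = √(x ^ 2 + euclNorm y ^ 2) := by
  rw [euclNorm, Fin.sum_univ_succ, euclNorm_sq]
  simp

lemma measurable_finCons (n : ℕ) :
    Measurable fun q : ℝ × (Fin n → ℝ) => (Fin.cons q.1 q.2 : Fin (n + 1) → ℝ) := by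
  refine measurable_pi_lambda _ fun i => ?_
  refine Fin.cases ?_ (fun i => ?_) i
  · simpa using measurable_fst
  · simp only [Fin.cons_succ]; fun_prop

lemma lintegral_finCons (g : (Fin (n + 1) → ℝ) → ℝ≥0∞) (hg : Measurable g) :
    ∫⁻ y, g y = ∫⁻ y : Fin n → ℝ, ∫⁻ x : ℝ, g (Fin.cons x y) := by
  have hmp := (volume_preserving_piFinSuccAbove (fun _ : Fin (n + 1) => ℝ) 0).symm
  have hcons : ∀ q : ℝ × (Fin n → ℝ),
      (MeasurableEquiv.piFinSuccAbove (fun _ : Fin (n + 1) => ℝ) 0).symm q =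
        Fin.cons q.1 q.2 := fun q => by
    change Fin.insertNth (α := fun _ => ℝ) 0 q.1 q.2 = _
    exact Fin.insertNth_zero' q.1 q.2
  rw [← hmp.lintegral_comp_emb (MeasurableEquiv.measurableEmbedding _)]
  simp only [hcons, Measure.volume_eq_prod]
  exact lintegral_prod_symm (fun q : ℝ × (Fin n → ℝ) => g (Fin.cons q.1 q.2))
    (hg.comp (measurable_finCons n)).aemeasurable

/-- For y = (x, y') with |y'| = r, the substitution x = rt/√(1 − t²) makes t the direction
coordinate, and |y| < 1 becomes r < √(1 − t²). Integrating the Jacobian r/√(1 − t²)³ over y' leaves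
a multiple of (1 − t²)^{(n−1)/2}. The constant is not computed; F = 1 determines it later. -/
lemma exists_lintegral_direction (n : ℕ) : ∃ K : ℝ≥0∞, ∀ F : ℝ → ℝ≥0∞, Measurable F →
    ∫⁻ y in euclBall (n + 2), F (y 0 / euclNorm y) =
      K * ∫⁻ x, F x ∂betaLaw (((n : ℝ) + 1) / 2) (((n : ℝ) + 1) / 2) := by
  set J : ℝ≥0∞ := ∫⁻ y in euclBall (n + 1), ENNReal.ofReal (euclNorm y) with hJ
  set s : ℝ := ((n : ℝ) + 1) / 2 with hs
  set c : ℝ := (2 : ℝ) ^ (1 - s - s) * Real.Gamma (s + s) / (Real.Gamma s * Real.Gamma s) with hc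
  have hs0 : 0 < s := by positivity
  have hcpos : 0 < c := by
    have := Real.Gamma_pos_of_pos hs0
    have := Real.Gamma_pos_of_pos (add_pos hs0 hs0)
    positivity
  refine ⟨J * ENNReal.ofReal c⁻¹, fun F hF => ?_⟩
  have hBm := (isOpen_euclBall (n + 2)).measurableSet
  set f : (Fin (n + 2) → ℝ) → ℝ≥0∞ :=
    (euclBall (n + 2)).indicator fun y => F (y 0 / euclNorm y) with hf
  have hfm : Measurable f := (hF.comp (by
    have := (continuous_euclNorm (n := n + 2)).measurable
    fun_prop)).indicator hBm
  set k : (Fin (n + 1) → ℝ) → ℝ → ℝ≥0∞ := fun y t =>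
    ENNReal.ofReal (1 / √(1 - t ^ 2) ^ 3) * F t *
      ({y : Fin (n + 1) → ℝ | euclNorm y < √(1 - t ^ 2)}.indicator
        (fun y => ENNReal.ofReal (euclNorm y)) y) with hk
  have hkm : Measurable (Function.uncurry k) := by
    have h1 : Measurable fun q : (Fin (n + 1) → ℝ) × ℝ => euclNorm q.1 :=
      continuous_euclNorm.measurable.comp measurable_fst
    have h2 : MeasurableSet {q : (Fin (n + 1) → ℝ) × ℝ | euclNorm q.1 < √(1 - q.2 ^ 2)} :=
      measurableSet_lt h1 (by fun_prop)
    have h3 := h1.ennreal_ofReal.indicator h2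
    have h4 : Measurable fun q : (Fin (n + 1) → ℝ) × ℝ =>
        ENNReal.ofReal (1 / √(1 - q.2 ^ 2) ^ 3) * F q.2 :=
      Measurable.mul (by fun_prop) (hF.comp measurable_snd)
    exact h4.mul h3
  have step1 : ∀ y : Fin (n + 1) → ℝ, y ≠ 0 →
      ∫⁻ x : ℝ, f (Fin.cons x y) = ∫⁻ t in Set.Ioo (-1 : ℝ) 1, k y t := by
    intro y hy
    have hr := euclNorm_pos hy
    rw [lintegral_eq_lintegral_Ioo hr]
    refine setLIntegral_congr_fun measurableSet_Ioo fun t ht => ?_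
    have h1 := sqrt_one_sub_sq_pos ht
    set r := euclNorm y with hrdef
    have h2 : euclNorm (Fin.cons (r * t / √(1 - t ^ 2)) y : Fin (n + 2) → ℝ) =
        r / √(1 - t ^ 2) := by rw [euclNorm_cons, ← hrdef, div_sqrt_add_sq hr ht]
    have h3 : r * t / √(1 - t ^ 2) / (r / √(1 - t ^ 2)) = t := by field_simp
    simp only [hk]
    by_cases hlt : r < √(1 - t ^ 2)
    · have hmem : (Fin.cons (r * t / √(1 - t ^ 2)) y : Fin (n + 2) → ℝ) ∈ euclBall (n + 2) := by
        change euclNorm _ < 1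
        rw [h2]; exact (div_lt_one h1).mpr hlt
      rw [hf, Set.indicator_of_mem hmem, Set.indicator_of_mem (show y ∈ {y : Fin (n + 1) → ℝ | euclNorm y < √(1 - t ^ 2)} from hlt), h2,
        Fin.cons_zero, h3, mul_right_comm, ← ENNReal.ofReal_mul (by positivity)]
      congr 2
      ring
    · have hmem : (Fin.cons (r * t / √(1 - t ^ 2)) y : Fin (n + 2) → ℝ) ∉ euclBall (n + 2) := by
        intro h
        change euclNorm _ < 1 at h
        rw [h2] at h
        exact hlt ((div_lt_one h1).mp h)
      rw [hf, Set.indicator_of_notMem hmem, Set.indicator_of_notMem 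
          (show y ∉ {y : Fin (n + 1) → ℝ | euclNorm y < √(1 - t ^ 2)} from hlt), mul_zero,
        mul_zero]
  have hne : ∀ᵐ y : Fin (n + 1) → ℝ, y ≠ 0 := by
    simp [ae_iff]
  rw [← lintegral_indicator hBm, lintegral_finCons _ hfm,
    lintegral_congr_ae (hne.mono fun y hy => step1 y hy),
    lintegral_lintegral_swap hkm.aemeasurable, betaLaw_eq, lintegral_withDensity_eq_lintegral_mul _
      (measurable_betaDensity s s).ennreal_ofReal hF, ← lintegral_const_mul _
      ((measurable_betaDensity s s).ennreal_ofReal.mul hF)]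
  refine setLIntegral_congr_fun measurableSet_Ioo fun t ht => ?_
  have h1 := sqrt_one_sub_sq_pos ht
  have hm : MeasurableSet {y : Fin (n + 1) → ℝ | euclNorm y < √(1 - t ^ 2)} :=
    (isOpen_lt continuous_euclNorm continuous_const).measurableSet
  simp only [hk, Pi.mul_apply]
  rw [lintegral_const_mul _ (continuous_euclNorm.measurable.ennreal_ofReal.indicator hm),
    lintegral_indicator hm, lintegral_euclNorm_scale h1, ← hJ]
  have hdens : 1 / √(1 - t ^ 2) ^ 3 * √(1 - t ^ 2) ^ (n + 1 + 1) = c⁻¹ * betaDensity s s t := by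
    have hx : 0 < 1 - t := by linarith [ht.2]
    have hy : 0 < 1 + t := by linarith [ht.1]
    have hxy : 0 < 1 - t ^ 2 := by nlinarith
    unfold betaDensity
    rw [← hc, ← Real.mul_rpow hx.le hy.le, show (1 - t) * (1 + t) = 1 - t ^ 2 by ring, ← mul_assoc,
      inv_mul_cancel₀ hcpos.ne', one_mul, Real.sqrt_eq_rpow]
    generalize 1 - t ^ 2 = x at hxy
    rw [← Real.rpow_natCast, ← Real.rpow_natCast, ← Real.rpow_mul hxy.le, ← Real.rpow_mul hxy.le, one_div,
      ← Real.rpow_neg hxy.le, ← Real.rpow_add hxy]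
    congr 1
    rw [hs]
    push_cast
    ring
  calc ENNReal.ofReal (1 / √(1 - t ^ 2) ^ 3) * F t *
        (ENNReal.ofReal (√(1 - t ^ 2) ^ (n + 1 + 1)) * J)
      = J * (ENNReal.ofReal (1 / √(1 - t ^ 2) ^ 3) * ENNReal.ofReal (√(1 - t ^ 2) ^ (n + 1 + 1)))
          * F t := by ring
    _ = J * ENNReal.ofReal c⁻¹ * (ENNReal.ofReal (betaDensity s s t) * F t) := by
      rw [← ENNReal.ofReal_mul (by positivity), hdens, ENNReal.ofReal_mul (by positivity)]
      ring

end Direction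

/-! ### Rotation-invariant laws on orthogonal matrices -/

section RotationLaws

open Matrix

variable {N n : ℕ}

instance instMeasurableSpaceMatrix (N : ℕ) : MeasurableSpace (Matrix (Fin N) (Fin N) ℝ) :=
  inferInstanceAs (MeasurableSpace (Fin N → Fin N → ℝ))

instance instBorelSpaceMatrix (N : ℕ) : BorelSpace (Matrix (Fin N) (Fin N) ℝ) :=
  inferInstanceAs (BorelSpace (Fin N → Fin N → ℝ))

instance instSecondCountableTopologyMatrix (N : ℕ) :
    SecondCountableTopology (Matrix (Fin N) (Fin N) ℝ) :=
  inferInstanceAs (SecondCountableTopology (Fin N → Fin N → ℝ))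

/-- Probability laws on orthogonal matrices that are invariant under left rotations. -/
structure IsRotationLaw (m : Measure (Matrix (Fin N) (Fin N) ℝ)) : Prop where
  isProbabilityMeasure : IsProbabilityMeasure m
  orthogonal : ∀ᵐ A ∂m, Aᵀ * A = 1
  map_mul_left : ∀ R : Matrix (Fin N) (Fin N) ℝ, Rᵀ * R = 1 → R.det = 1 → m.map (R * ·) = m

/-- Applied below to a sign change of a column, to V ↦ RᵀVO and to a permutation of rows and
columns. -/
lemma IsRotationLaw.map {m : Measure (Matrix (Fin N) (Fin N) ℝ)} (hm : IsRotationLaw m)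
    {T : Matrix (Fin N) (Fin N) ℝ → Matrix (Fin N) (Fin N) ℝ} (hT : Measurable T)
    (horth : ∀ A, Aᵀ * A = 1 → (T A)ᵀ * T A = 1)
    (hrot : ∀ R : Matrix (Fin N) (Fin N) ℝ, Rᵀ * R = 1 → R.det = 1 →
      ∃ S : Matrix (Fin N) (Fin N) ℝ, Sᵀ * S = 1 ∧ S.det = 1 ∧ ∀ A, R * T A = T (S * A)) :
    IsRotationLaw (m.map T) where
  isProbabilityMeasure :=
    have := hm.isProbabilityMeasure
    Measure.isProbabilityMeasure_map hT.aemeasurable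
  orthogonal := by
    have hc : MeasurableSet {A : Matrix (Fin N) (Fin N) ℝ | Aᵀ * A = 1} :=
      (isClosed_eq (by fun_prop) continuous_const).measurableSet
    rw [ae_map_iff hT.aemeasurable hc]
    exact hm.orthogonal.mono horth
  map_mul_left R h1 h2 := by
    obtain ⟨S, h3, h4, h5⟩ := hrot R h1 h2
    have hR : Measurable (R * ·) := (continuous_const.mul continuous_id).measurable
    have hS : Measurable (S * ·) := (continuous_const.mul continuous_id).measurable
    rw [Measure.map_map hR hT]
    conv_rhs => rw [← hm.map_mul_left S h3 h4, Measure.map_map hT hS]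
    congr 1
    exact funext h5

lemma isRotationLaw_map_val {G : Submonoid (Matrix (Fin N) (Fin N) ℝ)} {μ : Measure G}
    (hμ : IsProbabilityMeasure μ) (horth : ∀ A ∈ G, Aᵀ * A = 1)
    (hrot : ∀ R : Matrix (Fin N) (Fin N) ℝ, Rᵀ * R = 1 → R.det = 1 →
      ∃ h : R ∈ G, μ.map (fun g : G => ⟨R, h⟩ * g) = μ) :
    IsRotationLaw (μ.map Subtype.val) := by
  have hval : Measurable (Subtype.val : G → Matrix (Fin N) (Fin N) ℝ) :=
    continuous_subtype_val.measurable
  have hc : MeasurableSet {A : Matrix (Fin N) (Fin N) ℝ | Aᵀ * A = 1} :=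
    (isClosed_eq (by fun_prop) continuous_const).measurableSet
  refine ⟨Measure.isProbabilityMeasure_map hval.aemeasurable, ?_, fun R h1 h2 => ?_⟩
  · rw [ae_map_iff hval.aemeasurable hc]
    exact Filter.Eventually.of_forall fun g => horth g.1 g.2
  · obtain ⟨h, hg⟩ := hrot R h1 h2
    have hR : Measurable (R * · : Matrix (Fin N) (Fin N) ℝ → _) :=
      (continuous_const.mul continuous_id).measurable
    have hgm : Measurable fun g : G => (⟨R, h⟩ : G) * g :=
      (continuous_const.mul continuous_id).measurable
    rw [Measure.map_map hR hval]
    conv_rhs => rw [← hg, Measure.map_map hval hgm]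
    rfl

/-- Normalized Haar measure on the compact group SO(N); it supplies the auxiliary independent
rotation of the induction. -/
lemma exists_isRotationLaw (N : ℕ) : ∃ m : Measure (Matrix (Fin N) (Fin N) ℝ),
    IsRotationLaw m ∧ ∀ᵐ A ∂m, Aᵀ * A = 1 ∧ A.det = 1 := by
  set G := Matrix.specialOrthogonalGroup (Fin N) ℝ with hG
  have hmem : ∀ A : Matrix (Fin N) (Fin N) ℝ, A ∈ G ↔ Aᵀ * A = 1 ∧ A.det = 1 := fun A => by
    rw [hG, mem_specialOrthogonalGroup_iff, mem_orthogonalGroup_iff']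
  have : IsTopologicalGroup G :=
    { continuous_inv := by
        refine Continuous.subtype_mk (f := fun g : G => (g : Matrix (Fin N) (Fin N) ℝ)ᵀ) ?_ _
        exact continuous_subtype_val.matrix_transpose }
  have hclosed : IsClosed (G : Set (Matrix (Fin N) (Fin N) ℝ)) := by
    have : (G : Set (Matrix (Fin N) (Fin N) ℝ)) = {A | Aᵀ * A = 1} ∩ {A | A.det = 1} :=
      Set.ext fun A => hmem A
    rw [this]
    exact (isClosed_eq (by fun_prop) continuous_const).inter
      (isClosed_eq (Continuous.matrix_det continuous_id) continuous_const)
  have hcompact : IsCompact (G : Set (Matrix (Fin N) (Fin N) ℝ)) := by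
    refine IsCompact.of_isClosed_subset (isCompact_univ_pi fun _ : Fin N =>
      isCompact_univ_pi fun _ : Fin N => isCompact_Icc (a := (-1 : ℝ)) (b := 1)) hclosed ?_
    intro A hA i _ j _
    have h1 := congrFun (congrFun ((hmem A).mp hA).1 j) j
    rw [Matrix.mul_apply, Matrix.one_apply_eq] at h1
    simp only [transpose_apply] at h1
    have h2 := single_le_sum (f := fun i => A i j * A i j) (fun _ _ => mul_self_nonneg _)
      (mem_univ i)
    rw [h1] at h2
    exact abs_le.mp (abs_le_one_iff_mul_self_le_one.mpr h2)
  have : CompactSpace G := isCompact_iff_compactSpace.mp hcompact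
  set μ : Measure G := Measure.haarMeasure ⊤ with hμ
  have : IsProbabilityMeasure μ := ⟨Measure.haarMeasure_self⟩
  have hval : Measurable (Subtype.val : G → Matrix (Fin N) (Fin N) ℝ) :=
    continuous_subtype_val.measurable
  have hc1 : MeasurableSet {A : Matrix (Fin N) (Fin N) ℝ | Aᵀ * A = 1} :=
    (isClosed_eq (by fun_prop) continuous_const).measurableSet
  have hc2 : MeasurableSet {A : Matrix (Fin N) (Fin N) ℝ | A.det = 1} :=
    (isClosed_eq (Continuous.matrix_det continuous_id) continuous_const).measurableSet
  have hae : ∀ᵐ A ∂(μ.map Subtype.val), Aᵀ * A = 1 ∧ A.det = 1 := by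
    have hc : MeasurableSet {A : Matrix (Fin N) (Fin N) ℝ | Aᵀ * A = 1 ∧ A.det = 1} := hc1.inter hc2
    rw [ae_map_iff hval.aemeasurable hc]
    exact Filter.Eventually.of_forall fun g => (hmem g.1).mp g.2
  exact ⟨μ.map Subtype.val, isRotationLaw_map_val this (fun A hA => ((hmem A).mp hA).1)
    fun R h1 h2 => ⟨(hmem R).mpr ⟨h1, h2⟩, map_mul_left_eq_self μ _⟩, hae⟩

lemma euclNorm_mulVec {A : Matrix (Fin N) (Fin N) ℝ} (hA : Aᵀ * A = 1) (y : Fin N → ℝ) :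
    euclNorm (A *ᵥ y) = euclNorm y := by
  have h : ∀ z : Fin N → ℝ, ∑ i, z i ^ 2 = z ⬝ᵥ z := fun z => by simp [dotProduct, sq]
  rw [euclNorm, euclNorm, h, h, dotProduct_mulVec, ← mulVec_transpose, mulVec_mulVec, hA,
    one_mulVec]

lemma lintegral_mulVec_orthogonal {A : Matrix (Fin N) (Fin N) ℝ} (hA : Aᵀ * A = 1)
    {f : (Fin N → ℝ) → ℝ≥0∞} (hf : Measurable f) : ∫⁻ y, f (A *ᵥ y) = ∫⁻ y, f y := by
  have hdet : A.det * A.det = 1 := by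
    have := congrArg Matrix.det hA
    simpa using this
  have h0 : A.det ≠ 0 := fun h => by simp [h] at hdet
  have habs : |A.det⁻¹| = 1 := by
    rcases mul_self_eq_one_iff.mp hdet with h | h <;> simp [h]
  have hmap := Real.map_matrix_volume_pi_eq_smul_volume_pi h0
  rw [habs, ENNReal.ofReal_one, one_smul] at hmap
  have hcont : Measurable (Matrix.toLin' A) :=
    (LinearMap.continuous_of_finiteDimensional _).measurable
  conv_rhs => rw [← hmap, lintegral_map hf hcont]
  rfl

/-- The law of a diagonal entry of a random orthogonal matrix. -/
lemma IsRotationLaw.map_apply_zero {m : Measure (Matrix (Fin (n + 2)) (Fin (n + 2)) ℝ)}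
    (hm : IsRotationLaw m) :
    m.map (fun A => A 0 0) = betaLaw (((n : ℝ) + 1) / 2) (((n : ℝ) + 1) / 2) := by
  have := hm.isProbabilityMeasure
  have hs : (0 : ℝ) < ((n : ℝ) + 1) / 2 := by positivity
  have := isProbabilityMeasure_betaLaw hs hs
  obtain ⟨K, hK⟩ := exists_lintegral_direction n
  have hentry : Measurable fun A : Matrix (Fin (n + 2)) (Fin (n + 2)) ℝ => A 0 0 :=
    Continuous.measurable (by fun_prop)
  -- The integral of f(Aᵀy) over A and y is computed in both orders. For fixed A, volume is
  -- invariant under Aᵀ. For fixed y with y/|y| = Re_0, the direction coordinate of Aᵀy is (RᵀA)_00,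
  -- which is distributed as A_00.
  have key : ∀ F : ℝ → ℝ≥0∞, Measurable F →
      volume (euclBall (n + 2)) * ∫⁻ A, F (A 0 0) ∂m =
        K * ∫⁻ x, F x ∂betaLaw (((n : ℝ) + 1) / 2) (((n : ℝ) + 1) / 2) := by
    intro F hF
    have hBm := (isOpen_euclBall (n + 2)).measurableSet
    rw [← hK F hF, ← lintegral_indicator hBm]
    set f : (Fin (n + 2) → ℝ) → ℝ≥0∞ :=
      (euclBall (n + 2)).indicator fun y => F (y 0 / euclNorm y) with hf
    have hfm : Measurable f := (hF.comp (by
      have := (continuous_euclNorm (n := n + 2)).measurable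
      fun_prop)).indicator hBm
    have hfm2 : Measurable fun q : Matrix (Fin (n + 2)) (Fin (n + 2)) ℝ × (Fin (n + 2) → ℝ) =>
        f (q.1ᵀ *ᵥ q.2) := by
      refine hfm.comp (Continuous.measurable ?_)
      exact (continuous_fst.matrix_transpose).matrix_mulVec continuous_snd
    have h1 : ∫⁻ A, (∫⁻ y : Fin (n + 2) → ℝ, f (Aᵀ *ᵥ y)) ∂m = ∫⁻ y, f y := by
      rw [lintegral_congr_ae (g := fun _ => ∫⁻ y, f y)]
      · simp
      · filter_upwards [hm.orthogonal] with A hA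
        refine lintegral_mulVec_orthogonal ?_ hfm
        rw [transpose_transpose]
        exact mul_eq_one_comm.mp hA
    have h2 : ∀ y : Fin (n + 2) → ℝ, y ≠ 0 →
        ∫⁻ A, f (Aᵀ *ᵥ y) ∂m = (euclBall (n + 2)).indicator
          (fun _ => ∫⁻ A, F (A 0 0) ∂m) y := by
      intro y hy
      have hpos := euclNorm_pos hy
      obtain ⟨R, hR, hRdet, hRy⟩ := exists_rotation (x := (euclNorm y)⁻¹ • y) (by
        have h3 : y ⬝ᵥ y = euclNorm y ^ 2 := by rw [euclNorm_sq]; simp [dotProduct, sq]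
        rw [smul_dotProduct, dotProduct_smul, h3, smul_eq_mul, smul_eq_mul]
        field_simp)
      have hR' : Rᵀᵀ * Rᵀ = 1 := by rw [transpose_transpose]; exact mul_eq_one_comm.mp hR
      have hinv := hm.map_mul_left Rᵀ hR' (by rw [det_transpose, hRdet])
      have h3 : ∀ A : Matrix (Fin (n + 2)) (Fin (n + 2)) ℝ,
          (Aᵀ *ᵥ y) 0 / euclNorm y = (Rᵀ * A) 0 0 := by
        intro A
        have h4 : ∀ i, R i 0 = (euclNorm y)⁻¹ * y i := fun i => by
          have := congrFun hRy i
          simpa using this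
        rw [Matrix.mul_apply, mulVec, dotProduct, sum_div]
        refine sum_congr rfl fun i _ => ?_
        rw [transpose_apply, transpose_apply, h4]
        ring
      have h5 : ∫⁻ A, F ((Rᵀ * A) 0 0) ∂m = ∫⁻ A, F (A 0 0) ∂m := by
        have hR : Measurable (Rᵀ * · : Matrix (Fin (n + 2)) (Fin (n + 2)) ℝ → _) :=
          (continuous_const.mul continuous_id).measurable
        conv_rhs => rw [← hinv]
        exact (lintegral_map (hF.comp hentry) hR).symm
      by_cases hyB : y ∈ euclBall (n + 2)
      · rw [Set.indicator_of_mem hyB, ← h5]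
        refine lintegral_congr_ae (hm.orthogonal.mono fun A hA => ?_)
        have h6 : euclNorm (Aᵀ *ᵥ y) = euclNorm y :=
          euclNorm_mulVec (by rw [transpose_transpose]; exact mul_eq_one_comm.mp hA) y
        have h7 : Aᵀ *ᵥ y ∈ euclBall (n + 2) := by
          change euclNorm _ < 1
          rw [h6]; exact hyB
        simp only [hf]
        rw [Set.indicator_of_mem h7, h6, h3]
      · rw [Set.indicator_of_notMem hyB, ← lintegral_zero (μ := m)]
        refine lintegral_congr_ae (hm.orthogonal.mono fun A hA => ?_)
        have h6 : euclNorm (Aᵀ *ᵥ y) = euclNorm y :=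
          euclNorm_mulVec (by rw [transpose_transpose]; exact mul_eq_one_comm.mp hA) y
        have h7 : Aᵀ *ᵥ y ∉ euclBall (n + 2) := fun h => hyB (by
          change euclNorm _ < 1 at h
          rwa [h6] at h)
        simp only [hf]
        rw [Set.indicator_of_notMem h7]
    have hne : ∀ᵐ y : Fin (n + 2) → ℝ, y ≠ 0 := by simp [ae_iff]
    rw [← h1, lintegral_lintegral_swap hfm2.aemeasurable,
      lintegral_congr_ae (hne.mono h2), lintegral_indicator hBm, setLIntegral_const, mul_comm]
  -- F = 1 identifies K with the volume of the ball, which is then cancelled.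
  have hone := key 1 measurable_one
  simp only [Pi.one_apply, lintegral_const, measure_univ, mul_one] at hone
  refine Measure.ext_of_lintegral _ fun F hF => ?_
  rw [lintegral_map hF hentry]
  have := key F hF
  rw [← hone] at this
  exact (ENNReal.mul_right_inj (volume_euclBall_ne_zero _) (volume_euclBall_ne_top _)).mp this

end RotationLaws

/-! ### Induction on the size for truncations -/

section Truncations

open Matrix Polynomial

variable {n : ℕ}

lemma continuous_charpoly_coeff (n i : ℕ) :
    Continuous fun A : Matrix (Fin n) (Fin n) ℝ => A.charpoly.coeff i := by
  have h : (fun A : Matrix (Fin n) (Fin n) ℝ => A.charpoly.coeff i) = fun A =>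
      MvPolynomial.eval (fun q : Fin n × Fin n => A q.1 q.2)
        ((Matrix.charpoly.univ ℝ (Fin n)).coeff i) := by
    funext A
    have := Matrix.charpoly.univ_coeff_eval₂Hom (n := Fin n) (RingHom.id ℝ)
      (fun q : Fin n × Fin n => A q.1 q.2) i
    exact this.symm
  rw [h]
  exact (MvPolynomial.continuous_eval _).comp
    (continuous_pi fun q => continuous_id.matrix_elem q.1 q.2)

/-- The coefficients of the characteristic polynomial. -/
def charCoeff {n : ℕ} (A : Matrix (Fin n) (Fin n) ℝ) : Fin n → ℝ := coeffVec n A.charpoly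

lemma continuous_charCoeff (n : ℕ) : Continuous (charCoeff (n := n)) :=
  continuous_pi fun i => continuous_charpoly_coeff n i

lemma continuous_minor (i : Fin (n + 1)) :
    Continuous (minor i : Matrix (Fin (n + 1)) (Fin (n + 1)) ℝ → _) :=
  continuous_id.matrix_submatrix _ _

/-- The block-diagonal matrix with the blocks `1` and `V`. -/
def oneSum {n : ℕ} (V : Matrix (Fin n) (Fin n) ℝ) : Matrix (Fin (n + 1)) (Fin (n + 1)) ℝ :=
  Matrix.of (Fin.cons (Fin.cons 1 0) fun i => Fin.cons 0 (V i))

@[simp] lemma oneSum_zero_zero (V : Matrix (Fin n) (Fin n) ℝ) : oneSum V 0 0 = 1 := rfl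
@[simp] lemma oneSum_zero_succ (V : Matrix (Fin n) (Fin n) ℝ) (j : Fin n) :
    oneSum V 0 j.succ = 0 := rfl
@[simp] lemma oneSum_succ_zero (V : Matrix (Fin n) (Fin n) ℝ) (i : Fin n) :
    oneSum V i.succ 0 = 0 := rfl
@[simp] lemma oneSum_succ_succ (V : Matrix (Fin n) (Fin n) ℝ) (i j : Fin n) :
    oneSum V i.succ j.succ = V i j := rfl

lemma oneSum_orthogonal {V : Matrix (Fin n) (Fin n) ℝ} (hV : Vᵀ * V = 1) :
    (oneSum V)ᵀ * oneSum V = 1 := by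
  have h : ∀ i j, ∑ k, V k i * V k j = (1 : Matrix (Fin n) (Fin n) ℝ) i j := fun i j => by
    rw [← hV]; rfl
  ext i j
  rw [Matrix.mul_apply, Fin.sum_univ_succ]
  simp only [transpose_apply]
  refine Fin.cases ?_ (fun i => ?_) i <;> refine Fin.cases ?_ (fun j => ?_) j
  · simp
  · simp [(Fin.succ_ne_zero j).symm]
  · simp
  · simp [h, Matrix.one_apply]

lemma det_oneSum (V : Matrix (Fin n) (Fin n) ℝ) : (oneSum V).det = V.det := by
  rw [det_succ_row_zero, Fin.sum_univ_succ]
  simp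
  rfl

lemma minor_zero_oneSum_mul (V : Matrix (Fin n) (Fin n) ℝ)
    (A : Matrix (Fin (n + 1)) (Fin (n + 1)) ℝ) :
    minor 0 (oneSum V * A) = V * minor 0 A := by
  rw [minor_mul_of_col _ _ _ fun j => by simp]
  rfl

/-- The law of the coefficients of the characteristic polynomial of a truncation. -/
theorem IsRotationLaw.map_charCoeff_minor_zero (n : ℕ)
    {m : Measure (Matrix (Fin (n + 1)) (Fin (n + 1)) ℝ)} (hm : IsRotationLaw m) :
    m.map (fun A => charCoeff (minor 0 A)) =
      szegoLaw (fun k => betaLaw (((k : ℝ) + 1) / 2) (((k : ℝ) + 1) / 2)) n := by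
  have := hm.isProbabilityMeasure
  have hν : ∀ k : ℕ, IsProbabilityMeasure (betaLaw (((k : ℝ) + 1) / 2) (((k : ℝ) + 1) / 2)) :=
    fun k => isProbabilityMeasure_betaLaw (by positivity) (by positivity)
  induction n with
  | zero =>
    have h1 : (fun A : Matrix (Fin (0 + 1)) (Fin (0 + 1)) ℝ => charCoeff (minor 0 A)) =
        fun _ => 0 := funext fun A => Subsingleton.elim _ _
    rw [h1, Measure.map_const, measure_univ, one_smul, szegoLaw]
  | succ n ih =>
    have hmeas : Measurable fun A : Matrix (Fin (n + 2)) (Fin (n + 2)) ℝ =>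
        charCoeff (minor 0 A) :=
      ((continuous_charCoeff _).comp (continuous_minor 0)).measurable
    have hmeas' : Measurable fun A : Matrix (Fin (n + 1)) (Fin (n + 1)) ℝ =>
        charCoeff (minor 0 A) :=
      ((continuous_charCoeff _).comp (continuous_minor 0)).measurable
    set ν : ℕ → Measure ℝ := fun k => betaLaw (((k : ℝ) + 1) / 2) (((k : ℝ) + 1) / 2) with hνdef
    have hνp : ∀ k, IsProbabilityMeasure (ν k) := hν
    -- An independent rotation V of the truncation is introduced, so that for a fixed A there is
    -- still a random matrix of the smaller size to which the induction hypothesis applies.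
    obtain ⟨m', hm', hdet'⟩ := exists_isRotationLaw (n + 1)
    have := hm'.isProbabilityMeasure
    set γ : Matrix (Fin (n + 2)) (Fin (n + 2)) ℝ → ℝ := fun A =>
      (-1) ^ n * (A.det * A 0 0) with hγ
    have hγm : Measurable γ := Continuous.measurable
      (continuous_const.mul ((Continuous.matrix_det continuous_id).mul
        (continuous_id.matrix_elem 0 0)))
    -- the law of `γ`
    have hγlaw : m.map γ = ν n := by
      -- γ is the corner entry after column 0 is multiplied by the sign (−1)^n det A. Left rotations
      -- do not change this sign, so the new matrix again has a rotation law.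
      set T : Matrix (Fin (n + 2)) (Fin (n + 2)) ℝ → Matrix (Fin (n + 2)) (Fin (n + 2)) ℝ :=
        fun A => A * diagonal (Function.update 1 0 ((-1) ^ n * A.det)) with hT
      have hTm : Measurable T := Continuous.measurable
        (continuous_id.mul (Continuous.matrix_diagonal (continuous_const.update 0
          (continuous_const.mul (Continuous.matrix_det continuous_id)))))
      have hlaw : IsRotationLaw (m.map T) := by
        refine hm.map hTm (fun A hA => ?_) fun R h1 h2 => ⟨R, h1, h2, fun A => ?_⟩
        · have hdet : A.det * A.det = 1 := by
            have := congrArg Matrix.det hA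
            simpa using this
          have hsq : ((-1 : ℝ) ^ n * A.det) * ((-1) ^ n * A.det) = 1 := by
            rw [mul_mul_mul_comm, hdet, ← mul_pow]; simp
          simp only [hT]
          rw [transpose_mul, diagonal_transpose, Matrix.mul_assoc, ← Matrix.mul_assoc Aᵀ, hA,
            Matrix.one_mul, diagonal_mul_diagonal, ← diagonal_one]
          congr 1
          ext i
          by_cases hi : i = 0
          · subst hi; simpa using hsq
          · simp [hi]
        · simp only [hT]
          rw [det_mul, h2, one_mul, Matrix.mul_assoc]
      have h1 := hlaw.map_apply_zero
      have h2 : Measurable fun A : Matrix (Fin (n + 2)) (Fin (n + 2)) ℝ => A 0 0 :=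
        Continuous.measurable (continuous_id.matrix_elem 0 0)
      rw [Measure.map_map h2 hTm] at h1
      refine Eq.trans ?_ h1
      congr 1
      funext A
      simp only [hT, hγ, Function.comp_apply, mul_diagonal, Function.update_self]
      ring
    refine Measure.ext_of_lintegral _ fun F hF => ?_
    have hstep : Measurable fun q : ℝ × (Fin n → ℝ) => coeffStep q.1 q.2 :=
      (continuous_coeffStep n).measurable
    have hjoint : Measurable fun q : Matrix (Fin (n + 1)) (Fin (n + 1)) ℝ ×
        Matrix (Fin (n + 2)) (Fin (n + 2)) ℝ => F (charCoeff (q.1 * minor 0 q.2)) :=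
      hF.comp (((continuous_charCoeff _).comp
        (continuous_fst.mul ((continuous_minor 0).comp continuous_snd))).measurable)
    -- Left multiplication of A by 1 ⊕ V multiplies its truncation by V and preserves m.
    have h1 : ∀ᵐ V ∂m', ∫⁻ A, F (charCoeff (minor 0 A)) ∂m =
        ∫⁻ A, F (charCoeff (V * minor 0 A)) ∂m := by
      filter_upwards [hdet'] with V hV
      have hinv := hm.map_mul_left (oneSum V) (oneSum_orthogonal hV.1)
        (by rw [det_oneSum, hV.2])
      have hR : Measurable (oneSum V * · : Matrix (Fin (n + 2)) (Fin (n + 2)) ℝ → _) :=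
        (continuous_const.mul continuous_id).measurable
      conv_lhs => rw [← hinv]
      refine (lintegral_map (hF.comp hmeas) hR).trans ?_
      simp only [Function.comp_apply, minor_zero_oneSum_mul]
    -- For fixed A the matrix RᵀVO has a rotation law. The induction hypothesis gives the same law
    -- for every A, so the result depends on A only through γ(A): this is the independence of the
    -- new Verblunsky coefficient.
    have h2 : ∀ A : Matrix (Fin (n + 2)) (Fin (n + 2)) ℝ, Aᵀ * A = 1 →
        ∫⁻ V, F (charCoeff (V * minor 0 A)) ∂m' =
          ∫⁻ c, F (coeffStep (γ A) c) ∂(szegoLaw ν n) := by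
      intro A hA
      obtain ⟨R, O, hR, hRdet, hO, hchar⟩ := exists_charpoly_mul_minor_zero hA
      have hR' : R * Rᵀ = 1 := mul_eq_one_comm.mp hR
      have hTm : Measurable fun V : Matrix (Fin (n + 1)) (Fin (n + 1)) ℝ => Rᵀ * V * O :=
        ((continuous_const.mul continuous_id).mul continuous_const).measurable
      have hlaw : IsRotationLaw (m'.map fun V => Rᵀ * V * O) := by
        refine hm'.map hTm (fun V hV => ?_) fun S h1 h2 => ⟨R * S * Rᵀ, ?_, ?_, fun V => ?_⟩
        · rw [transpose_mul, transpose_mul, transpose_transpose]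
          calc Oᵀ * (Vᵀ * R) * (Rᵀ * V * O) = Oᵀ * (Vᵀ * (R * Rᵀ) * V) * O := by
                simp only [Matrix.mul_assoc]
            _ = 1 := by rw [hR', Matrix.mul_one, hV, Matrix.mul_one, hO]
        · rw [transpose_mul, transpose_mul, transpose_transpose]
          calc R * (Sᵀ * Rᵀ) * (R * S * Rᵀ) = R * (Sᵀ * (Rᵀ * R) * S) * Rᵀ := by
                simp only [Matrix.mul_assoc]
            _ = 1 := by rw [hR, Matrix.mul_one, h1, Matrix.mul_one, hR']
        · rw [det_mul, det_mul, det_transpose, hRdet, h2]; norm_num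
        · calc S * (Rᵀ * V * O) = 1 * S * Rᵀ * V * O := by
                rw [Matrix.one_mul]; simp only [Matrix.mul_assoc]
            _ = Rᵀ * (R * S * Rᵀ * V) * O := by rw [← hR]; simp only [Matrix.mul_assoc]
      have hprob := hlaw.isProbabilityMeasure
      have hih := ih hlaw hprob
      have hF' : Measurable fun c => F (coeffStep (γ A) c) :=
        hF.comp (hstep.comp measurable_prodMk_left)
      rw [← hih, lintegral_map hF' hmeas']
      refine Eq.trans ?_ (lintegral_map (hF'.comp hmeas') hTm).symm
      refine lintegral_congr_ae (hdet'.mono fun V hV => ?_)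
      have h3 : charCoeff (V * minor 0 A) =
          coeffStep (γ A) (charCoeff (minor 0 (Rᵀ * V * O))) := by
        rw [charCoeff, hchar V hV.1 hV.2, coeffVec_szegoStep _ (charpoly_monic _)
          (by rw [charpoly_natDegree_eq_dim, Fintype.card_fin])]
        rfl
      simp only [h3]
      rfl
    calc ∫⁻ c, F c ∂(m.map fun A => charCoeff (minor 0 A))
        = ∫⁻ A, F (charCoeff (minor 0 A)) ∂m := lintegral_map hF hmeas
      _ = ∫⁻ _, ∫⁻ A, F (charCoeff (minor 0 A)) ∂m ∂m' := by simp
      _ = ∫⁻ V, ∫⁻ A, F (charCoeff (V * minor 0 A)) ∂m ∂m' := lintegral_congr_ae h1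
      _ = ∫⁻ A, ∫⁻ V, F (charCoeff (V * minor 0 A)) ∂m' ∂m :=
          lintegral_lintegral_swap hjoint.aemeasurable
      _ = ∫⁻ A, ∫⁻ c, F (coeffStep (γ A) c) ∂(szegoLaw ν n) ∂m :=
          lintegral_congr_ae (hm.orthogonal.mono h2)
      _ = ∫⁻ x, ∫⁻ c, F (coeffStep x c) ∂(szegoLaw ν n) ∂(m.map γ) :=
          (lintegral_map (hF.comp hstep).lintegral_prod_right' hγm).symm
      _ = ∫⁻ x, ∫⁻ c, F (coeffStep x c) ∂(szegoLaw ν n) ∂(ν n) := by rw [hγlaw]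
      _ = ∫⁻ q : ℝ × (Fin n → ℝ), F (coeffStep q.1 q.2) ∂((ν n).prod (szegoLaw ν n)) :=
          (lintegral_prod _ (hF.comp hstep).aemeasurable).symm
      _ = ∫⁻ c, F c ∂(szegoLaw ν (n + 1)) := (lintegral_map hF hstep).symm

end Truncations

/-! ### Arbitrary index and the Haar measures -/

section HaarTruncations

open Matrix

variable {Ω : Type*} [MeasurableSpace Ω] {P : Measure Ω} {n : ℕ}

lemma minor_eq_minor_zero_submatrix (i : Fin (n + 1)) (A : Matrix (Fin (n + 1)) (Fin (n + 1)) ℝ) :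
    minor i A = minor 0 (A.submatrix i.cycleRange.symm i.cycleRange.symm) := by
  ext j k
  simp [minor, Fin.cycleRange_symm_succ]

/-- A simultaneous permutation of rows and columns moves index i to 0, and conjugating a rotation by
a permutation gives a rotation. -/
lemma IsRotationLaw.map_charCoeff_minor {m : Measure (Matrix (Fin (n + 1)) (Fin (n + 1)) ℝ)}
    (hm : IsRotationLaw m) (i : Fin (n + 1)) :
    m.map (fun A => charCoeff (minor i A)) =
      szegoLaw (fun k => betaLaw (((k : ℝ) + 1) / 2) (((k : ℝ) + 1) / 2)) n := by
  set σ := i.cycleRange.symm with hσ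
  set T : Matrix (Fin (n + 1)) (Fin (n + 1)) ℝ → Matrix (Fin (n + 1)) (Fin (n + 1)) ℝ :=
    fun A => A.submatrix σ σ with hT
  have hTm : Measurable T := (continuous_id.matrix_submatrix _ _).measurable
  have hlaw : IsRotationLaw (m.map T) := by
    refine hm.map hTm (fun A hA => ?_) fun R h1 h2 =>
      ⟨R.submatrix σ.symm σ.symm, ?_, ?_, fun A => ?_⟩
    · simp only [hT]
      rw [transpose_submatrix, submatrix_mul_equiv, hA, submatrix_one_equiv]
    · rw [transpose_submatrix, submatrix_mul_equiv, h1, submatrix_one_equiv]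
    · rw [det_submatrix_equiv_self, h2]
    · simp only [hT]
      rw [← submatrix_mul_equiv _ _ σ σ σ, submatrix_submatrix]
      simp
  have hmeas : Measurable fun A : Matrix (Fin (n + 1)) (Fin (n + 1)) ℝ => charCoeff (minor 0 A) :=
    ((continuous_charCoeff _).comp (continuous_minor 0)).measurable
  rw [← hlaw.map_charCoeff_minor_zero n, Measure.map_map hmeas hTm]
  congr 1
  funext A
  simp only [hT, hσ, Function.comp_apply, minor_eq_minor_zero_submatrix i A]

lemma betaLaw_params_two (k : ℕ) :
    paramS 2 (-1 / 2) (-1 / 2) k = ((k : ℝ) + 1) / 2 ∧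
      paramT 2 (-1 / 2) k = ((k : ℝ) + 1) / 2 := by
  unfold paramS paramT
  constructor <;> split_ifs <;> ring

/-- The eigenvalues of truncations of random orthogonal matrices. -/
theorem hasLaw_eigenvalues_minor {X : Ω → Matrix (Fin (n + 1)) (Fin (n + 1)) ℝ}
    (hX : AEMeasurable X P) (h : IsRotationLaw (P.map X)) (i : Fin (n + 1)) :
    HasLaw (fun ω => eigenvalues ((minor i (X ω)).map Complex.ofReal))
      (eigenvalueLaw n 2 (-1 / 2) (-1 / 2)) P := by
  have hprob : ∀ k : ℕ, IsProbabilityMeasure (betaLaw (((k : ℝ) + 1) / 2) (((k : ℝ) + 1) / 2)) :=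
    fun k => isProbabilityMeasure_betaLaw (by positivity) (by positivity)
  have hroots := hasLaw_rootsSym n (β := 2) (a := -1 / 2) (b := -1 / 2) (by norm_num)
    (by norm_num) (by norm_num) (fun k => betaLaw (((k : ℝ) + 1) / 2) (((k : ℝ) + 1) / 2))
    fun k _ => by rw [(betaLaw_params_two k).1, (betaLaw_params_two k).2]
  have hmeas : Measurable fun A : Matrix (Fin (n + 1)) (Fin (n + 1)) ℝ => charCoeff (minor i A) :=
    ((continuous_charCoeff _).comp (continuous_minor i)).measurable
  have hcoeff : HasLaw (fun A => charCoeff (minor i A)) _ (P.map X) :=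
    ⟨hmeas.aemeasurable, h.map_charCoeff_minor i⟩
  have key := hroots.fun_comp (hcoeff.fun_comp ⟨hX, rfl⟩)
  refine key.congr (Filter.Eventually.of_forall fun ω => ?_)
  exact eigenvalues_eq_rootsSym _ (charpoly_monic _)
    (by rw [charpoly_natDegree_eq_dim, Fintype.card_fin])
    (charpoly_map (minor i (X ω)) Complex.ofRealHom)

lemma hasLaw_eigenvalues_minor_val {G : Submonoid (Matrix (Fin (n + 1)) (Fin (n + 1)) ℝ)}
    {μ : Measure G} (hμ : IsProbabilityMeasure μ) (horth : ∀ A ∈ G, Aᵀ * A = 1)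
    (hrot : ∀ R : Matrix (Fin (n + 1)) (Fin (n + 1)) ℝ, Rᵀ * R = 1 → R.det = 1 →
      ∃ h : R ∈ G, μ.map (fun g : G => ⟨R, h⟩ * g) = μ) {U : Ω → G} (hU : HasLaw U μ P)
    (i : Fin (n + 1)) :
    HasLaw (fun ω => eigenvalues ((minor i (U ω).1).map Complex.ofReal))
      (eigenvalueLaw n 2 (-1 / 2) (-1 / 2)) P := by
  have hval : Measurable (Subtype.val : G → Matrix (Fin (n + 1)) (Fin (n + 1)) ℝ) :=
    continuous_subtype_val.measurable
  refine hasLaw_eigenvalues_minor (X := fun ω => (U ω).1)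
    (hval.comp_aemeasurable hU.aemeasurable) ?_ i
  have h := isRotationLaw_map_val hμ horth hrot
  rwa [← hU.map_eq, AEMeasurable.map_map_of_aemeasurable hval.aemeasurable hU.aemeasurable] at h

/-- Multiplication by a rotation preserves the conditioning event, so the invariance of Haar measure
passes to the conditional law. -/
lemma map_mul_left_cond_det (μ : Measure (Matrix.orthogonalGroup (Fin (n + 1)) ℝ))
    [μ.IsHaarMeasure] (g : Matrix.orthogonalGroup (Fin (n + 1)) ℝ) (hg : g.1.det = 1) (d : ℝ) :
    (ProbabilityTheory.cond μ {Q | Q.1.det = d}).map (g * ·) =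
      ProbabilityTheory.cond μ {Q | Q.1.det = d} := by
  have hs : MeasurableSet {Q : Matrix.orthogonalGroup (Fin (n + 1)) ℝ | Q.1.det = d} :=
    (isClosed_eq (Continuous.matrix_det continuous_subtype_val) continuous_const).measurableSet
  have hgm : Measurable (g * · : Matrix.orthogonalGroup (Fin (n + 1)) ℝ → _) :=
    (continuous_const.mul continuous_id).measurable
  have hpre : (g * ·) ⁻¹' {Q : Matrix.orthogonalGroup (Fin (n + 1)) ℝ | Q.1.det = d} =
      {Q | Q.1.det = d} := by
    ext Q
    change (g.1 * Q.1).det = d ↔ Q.1.det = d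
    rw [det_mul, hg, one_mul]
  rw [ProbabilityTheory.cond, Measure.map_smul]
  congr 1
  have h := Measure.restrict_map hgm hs (μ := μ)
  rw [hpre, map_mul_left_eq_self] at h
  exact h.symm

end HaarTruncations

end TruncatedOrthogonal
end

/-! ### The theorem -/

open TruncatedOrthogonal in
theorem mainTheorem3 {Ω : Type*} [MeasurableSpace Ω] (P : Measure Ω) [IsProbabilityMeasure P]
    (n : ℕ) :
    -- the eigenvalues of the random CMV matrix
    (∀ β a b : ℝ, 0 < β → -1 < a → -1 < b → ∀ α : Fin n → Ω → ℝ,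
      IndepBeta P α
        (fun k => if Even k then β * k / 4 + a + 1 else β * ((k : ℝ) - 1) / 4 + a + b + 2)
        (fun k => if Even k then β * k / 4 + b + 1 else β * ((k : ℝ) + 1) / 4) →
      HasLaw (fun ω => eigenvalues (cmv fun k => (α k ω : ℂ))) (eigenvalueLaw n β a b) P) ∧
    -- truncations of the real orthogonal β-ensemble of even size `n + 1` and determinant `1`
    (Odd n → ∀ β a b : ℝ, 0 < β → -1 < a → -1 < b → ∀ α : Fin n → Ω → ℝ,
      IndepBeta P α
        (fun k => if Even k then ((n : ℝ) - 1 - k) / 4 * β + a + 1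
          else ((n : ℝ) - 2 - k) / 4 * β + a + b + 2)
        (fun k => if Even k then ((n : ℝ) - 1 - k) / 4 * β + b + 1 else ((n : ℝ) - k) / 4 * β) →
      HasLaw (fun ω => eigenvalues (minor 0
        (cmv (Fin.snoc (fun k => (α k ω : ℂ)) (-1) : Fin (n + 1) → ℂ))))
        (eigenvalueLaw n β a b) P) ∧
    -- truncations of the real orthogonal β-ensembles of size `n + 1` in the other cases
    (∀ β : ℝ, 0 < β → ∀ σ : ℝ, σ = 1 ∨ σ = -1 → ∀ α : Fin n → Ω → ℝ,
      IndepBeta P α (fun k => ((n : ℝ) - k) / 4 * β) (fun k => ((n : ℝ) - k) / 4 * β) →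
      HasLaw (fun ω => eigenvalues (minor 0
        (cmv (Fin.snoc (fun k => (α k ω : ℂ)) (σ : ℂ) : Fin (n + 1) → ℂ))))
        (eigenvalueLaw n β (-1 + β / 4) (-1 + β / 4)) P) ∧
    -- truncations of Haar distributed matrices from `O(n+1)`
    (∀ (μ : Measure (Matrix.orthogonalGroup (Fin (n + 1)) ℝ)) [μ.IsHaarMeasure]
      [IsProbabilityMeasure μ] (i : Fin (n + 1))
      (U : Ω → Matrix.orthogonalGroup (Fin (n + 1)) ℝ), HasLaw U μ P →
      HasLaw (fun ω => eigenvalues ((minor i (U ω).1).map Complex.ofReal))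
        (eigenvalueLaw n 2 (-1 / 2) (-1 / 2)) P) ∧
    -- truncations of Haar distributed matrices from `SO(n+1)`
    (∀ (μ : Measure (Matrix.specialOrthogonalGroup (Fin (n + 1)) ℝ)) [μ.IsHaarMeasure]
      [IsProbabilityMeasure μ] (i : Fin (n + 1))
      (U : Ω → Matrix.specialOrthogonalGroup (Fin (n + 1)) ℝ), HasLaw U μ P →
      HasLaw (fun ω => eigenvalues ((minor i (U ω).1).map Complex.ofReal))
        (eigenvalueLaw n 2 (-1 / 2) (-1 / 2)) P) ∧
    -- truncations of Haar distributed matrices from `O(n+1) \ SO(n+1)`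
    (∀ (μ : Measure (Matrix.orthogonalGroup (Fin (n + 1)) ℝ)) [μ.IsHaarMeasure]
      [IsProbabilityMeasure μ] (i : Fin (n + 1))
      (U : Ω → Matrix.orthogonalGroup (Fin (n + 1)) ℝ),
      HasLaw U (ProbabilityTheory.cond μ {Q | Q.1.det = -1}) P →
      HasLaw (fun ω => eigenvalues ((minor i (U ω).1).map Complex.ofReal))
        (eigenvalueLaw n 2 (-1 / 2) (-1 / 2)) P) := by
  refine ⟨fun β a b hβ ha hb α h => hasLaw_eigenvalues_cmv hβ ha hb h,
    fun hn β a b hβ ha hb α h => hasLaw_eigenvalues_minor_cmv_of_odd hn hβ ha hb h,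
    fun β hβ σ hσ α h => hasLaw_eigenvalues_minor_cmv_of_eq hβ hσ h,
    fun μ _ hμ i U hU => ?_, fun μ _ hμ i U hU => ?_, fun μ _ hμ i U hU => ?_⟩
  · exact hasLaw_eigenvalues_minor_val hμ (fun A hA => (Matrix.mem_orthogonalGroup_iff' _ _).mp hA)
      (fun R h1 _ => ⟨(Matrix.mem_orthogonalGroup_iff' _ _).mpr h1, map_mul_left_eq_self μ _⟩) hU i
  · exact hasLaw_eigenvalues_minor_val hμ
      (fun A hA => (Matrix.mem_orthogonalGroup_iff' _ _).mp (Matrix.mem_specialOrthogonalGroup_iff.mp hA).1)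
      (fun R h1 h2 => ⟨Matrix.mem_specialOrthogonalGroup_iff.mpr
        ⟨(Matrix.mem_orthogonalGroup_iff' _ _).mpr h1, h2⟩, map_mul_left_eq_self μ _⟩) hU i
  -- The conditional measure is a probability measure because it is the law of U under P; the mass
  -- of the conditioning event need not be examined.
  · have hc := hU.isProbabilityMeasure_iff.mp inferInstance
    exact hasLaw_eigenvalues_minor_val hc (fun A hA => (Matrix.mem_orthogonalGroup_iff' _ _).mp hA)
      (fun R h1 h2 => ⟨(Matrix.mem_orthogonalGroup_iff' _ _).mpr h1, map_mul_left_cond_det μ _ h2 _⟩)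
      hU i
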